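/- **Setting.** Let $V$ be a finite-dimensional real vector space, $I$ a finite set, $(\alpha_i)_{i\in I}$ a free family in $V^*$ and $(\alpha_i^\vee)_{i\in I}$ a family in $V$ with $\alpha_i(\alpha_i^\vee)=2$. Put $r_i(v)=v-\alpha_i(v)\alpha_i^\vee$ and let $W^v\subset GL(V)$ be generated by $S=\{r_i\}$. Assume that $(W^v,S)$ is a Coxeter system. Let $\Phi=\{w\alpha_i\mid w\in W^v,\,i\in I\}$ be the set of real roots and assume that the following hold. For $\alpha=w\alpha_i\in\Phi$ the coroot $\alpha^\vee=w\alpha_i^\vee$ depends only on $\alpha$. Every $\alpha\in\Phi$ lies in $Q_+=\bigoplus_i\mathbb R_{\ge0}\alpha_i$ or in $-Q_+$. For $w\in W^v$ one has $w\alpha_i\in Q_+$ if and only if $\ell(wr_i)>\ell(w)$. Finally $\Phi\cap\mathbb R_{\ge 0}\alpha=\{\alpha\}$ for $\alpha\in\Phi$. Let $\Delta_{im}=-\Delta_{im}\subset V^*\setminus(\mathbb R\Phi\cup\{0\})$ be a set of imaginary roots such that $\Delta_{im}\subset Q_+\cup -Q_+$ and $\Delta_{im}\cap Q_+$ is stable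 under $W^v$ (moderately imaginary case). Put $\Delta=\Phi\cup\Delta_{im}$. For $J\subset I$ let $F^v(J)=\{v\mid\alpha_i(v)=0\ (i\in J),\ \alpha_i(v)>0\ (i\notin J)\}$. The sets $\varepsilon wF^v(J)$ ($w\in W^v$, $\varepsilon=\pm1$) are the vectorial facets of sign $\varepsilon$ and type $J$. They are spherical if $\langle r_i\mid i\in J\rangle$ is finite, chambers if $J=\emptyset$, and panels if $|J|=1$. The Tits cone $\mathcal T$ is the union of the positive facets; $x\le y$ means $y-x\in\mathcal T$. The model apartment $\mathbb A$ is an affine space under $V$ with a set $\mathcal M$ of affine hyperplanes (walls). The direction of each wall is $\ker\alpha$ for some $\alpha\in\Phi$, each $\alpha\in\Phi$ occurs for infinitely many walls, and the group $W$ generated by the reflections in the walls (with linear parts $v\mapsto v-\alpha(v)\alpha^\vee$) stabilizes $\mathcal M$. With an origin fixed, let $\Gamma_\alpha$ be the set of $k\in\mathbb R$ for which $\{\alpha+k=0\}$ is a wall if $\alpha\in\Phi$, and $\Gamma_\alpha=\mathbb R$ if $\alpha\in\Delta_{im}$. Put $D(\alpha,k)=\{\alpha+k\ge0\}$, $D^\circ(\alpha,k)=\{\alpha+k>0\}$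 and $D(\alpha,\infty)=D^\circ(\alpha,\infty)=\mathbb A$. A set is identified with the filter of its supersets. A filter $F$ is contained in $F'$ if every element of $F'$ is an element of $F$, and $F\cup F'$ is the filter of the sets that are elements of both. A map fixes a filter if it is the identity on one of its elements. The following filters are used. * The enclosure $cl(F)$ consists of the sets containing an element of $F$ of the form $\bigcap_{\alpha\in\Delta}D(\alpha,k_\alpha)$, with $k_\alpha\in\Gamma_\alpha\cup\{\infty\}$. * The facet $F(x,F^v)$ consists of the sets containing an intersection of half-spaces $D(\alpha,k_\alpha)$ or $D^\circ(\alpha,k_\alpha)$ (one for each $\alpha\in\Delta$, with $k_\alpha\in\Gamma_\alpha\cup\{\infty\}$) that contains the germ of $x+F^v$ at $x$. It is a chamber if $F^v$ can be taken to be a vectorial chamber, and a panel if $F^v$ can be taken to be a vectorial panel with $x+F^v$ and $x$ in a wall. A facet is dominated by a chamber $C$ if it is contained in the closure of $C$. * The chimney with base a facet $F$ and direction a vectorial facet $F^v$ is $cl(F+F^v)$. Its germ consists of the sets containing some $cl(F+\xi+F^v)$, $\xi\in\overline{F^v}$. It is splayed if $F^v$ is spherical, and solid if the direction of its support (the smallest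 affine subspace containing it) has a finite fixator in $W^v$. * A sector face is a set $x+F^v$. Its germ consists of the sets containing some $x+\xi+F^v$, $\xi\in\overline{F^v}$. It is spherical, resp. of sign $\varepsilon$, if its direction $F^v$ is so. An affine hovel of type $\mathbb A$ is a non-empty set $\mathcal I$ covered by a set $\mathcal A$ of subsets (apartments) with the following properties. * (MA1) Every $A\in\mathcal A$ has a set $\mathrm{Isom}(\mathbb A,A)$ of bijections $\mathbb A\to A$ that is of the form $f_0\circ W$. These bijections transport all the notions above to $A$. Isomorphisms $A\to A'$ are the maps $g\circ f^{-1}$ with $f\in \mathrm{Isom}(\mathbb A,A)$, $g\in \mathrm{Isom}(\mathbb A,A')$. * (MA2) Let $F$ be a point, the germ at $x$ of a half-open segment $]x,y]$ with $x\ne y$ and $x\le y$ or $y\le x$, a ray whose direction lies in a spherical vectorial facet, or a solid chimney of an apartment $A$. If an apartment $A'$ contains $F$, then $A\cap A'$ contains $cl_A(F)$, and some isomorphism $A\to A'$ fixes $cl_A(F)$. * (MA3) A germ $\mathfrak R$ of a splayed chimney and a facet or germ of a solid chimney $F$ are always contained in a common apartment. * (MA4) If $A$ and $A'$ both contain $\mathfrak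 R$ and $F$ as in (MA3), then $A\cap A'$ contains $cl_A(\mathfrak R\cup F)$, and some isomorphism $A\to A'$ fixes it. The hovel is thick if every panel of $\mathcal I$ is dominated by at least three chambers of $\mathcal I$. Two germs of spherical sector faces are parallel if in an apartment containing both they have the same direction. A germ $\mathfrak F$ dominates $\mathfrak F'$ if in an apartment containing both the direction of $\mathfrak F'$ is contained in the closure of that of $\mathfrak F$. For $\varepsilon=\pm$ let $\mathcal I^{\varepsilon\infty}$ be the set of parallelism classes of germs of spherical sector faces of sign $\varepsilon$. For $A\in\mathcal A$ let $A^{\varepsilon\infty}\subset\mathcal I^{\varepsilon\infty}$ be the set of classes with a representative contained in $A$, and let $\mathcal A^{\varepsilon\infty}=\{A^{\varepsilon\infty}\mid A\in\mathcal A\}$. **Theorem.** Let $\mathcal I$ be an affine hovel of type $\mathbb A$ and $\varepsilon\in\{+,-\}$. Parallelism is an equivalence relation on the germs of spherical sector faces of sign $\varepsilon$, and dominance induces a well-defined partial order on $\mathcal I^{\varepsilon\infty}$. With this order and the set of apartments $\mathcal A^{\varepsilon\infty}$, $\mathcal I^{\varepsilon\infty}$ is a combinatorial building of type $(W^v,S)$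 (of which only the spherical facets are kept). This means that $\mathcal A^{\varepsilon\infty}\neq\emptyset$ and that there is a type function from $\mathcal I^{\varepsilon\infty}$ to the subsets of $I$ such that: * every apartment contains with a facet all the facets it dominates, and is isomorphic, with its order and its types, to the set of cosets $wW^v_J$ with $W^v_J=\langle r_i\mid i\in J\rangle$ finite, ordered by reverse inclusion, $wW^v_J$ being of type $J$; * any two elements of $\mathcal I^{\varepsilon\infty}$ lie in a common apartment; * if two apartments both contain $a$ and $b$, there is an isomorphism between them, preserving order and types, that fixes $a$, $b$ and every element dominated by $a$ or by $b$. If $\mathcal I$ is thick, then the building $\mathcal I^{\varepsilon\infty}$ is thick: every panel (an element maximal among the non-maximal ones) is dominated by at least three chambers (maximal elements). -/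

import Mathlib

open Set Filter Topology
open scoped Pointwise

noncomputable section

/-! ## Vectorial data -/

/-- A free family of simple roots in the dual of `V` and a family of simple coroots in `V`, with
`αᵢ(αᵢ^∨) = 2`. -/
structure SimpleRoots (ι V : Type*) [AddCommGroup V] [Module ℝ V] where
  /-- the simple roots `αᵢ` -/
  root : ι → Module.Dual ℝ V
  /-- the simple coroots `αᵢ^∨` -/
  coroot : ι → V
  root_coroot : ∀ i, root i (coroot i) = 2
  root_free : LinearIndependent ℝ root

namespace SimpleRoots

variable {ι V : Type*} [AddCommGroup V] [Module ℝ V] (B : SimpleRoots ι V)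

/-- The reflection `rᵢ(v) = v - αᵢ(v) αᵢ^∨`. -/
def refl (i : ι) : V ≃ₗ[ℝ] V := Module.reflection (B.root_coroot i)

/-- The vectorial Weyl group `W^v`, a subgroup of `GL(V)`. -/
def vWeyl : Subgroup (V ≃ₗ[ℝ] V) := Subgroup.closure (range B.refl)

/-- The action of `GL(V)` on linear forms. -/
def act (w : V ≃ₗ[ℝ] V) (f : Module.Dual ℝ V) : Module.Dual ℝ V :=
  f ∘ₗ (w.symm : V →ₗ[ℝ] V)

/-- `f = w(αᵢ)` is a real root and `a = w(αᵢ^∨)` a corresponding coroot, for the same `w`, `i`.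
Then `w rᵢ w⁻¹` is the reflection `v ↦ v - f(v) a`. -/
def IsRootPair (f : Module.Dual ℝ V) (a : V) : Prop :=
  ∃ w ∈ B.vWeyl, ∃ i, f = act w (B.root i) ∧ a = w (B.coroot i)

/-- The set `Φ` of real roots. -/
def realRoots : Set (Module.Dual ℝ V) := {f | ∃ a, B.IsRootPair f a}

/-- The cone `⨁ ℝ⁺ αᵢ` in the dual of `V`. -/
def posCone [Fintype ι] : Set (Module.Dual ℝ V) :=
  {f | ∃ c : ι → ℝ, (∀ i, 0 ≤ c i) ∧ f = ∑ i, c i • B.root i}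

end SimpleRoots

/-- The vectorial datum: the simple roots and coroots, the Coxeter group `W^v`, the real roots, and
the imaginary roots in the moderately imaginary case. -/
structure VectorialDatum (ι V : Type*) [Fintype ι] [AddCommGroup V] [Module ℝ V]
    extends SimpleRoots ι V where
  /-- the Coxeter matrix of `W^v` -/
  coxeterMatrix : CoxeterMatrix ι
  /-- `W^v` is a Coxeter group, with the `rᵢ` as canonical generators -/
  cs : CoxeterSystem coxeterMatrix toSimpleRoots.vWeyl
  cs_simple : ∀ i, (cs.simple i : V ≃ₗ[ℝ] V) = toSimpleRoots.refl i
  /-- the reflection `r_α` depends only on the real root `α` -/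
  coroot_unique : ∀ f a b, toSimpleRoots.IsRootPair f a → toSimpleRoots.IsRootPair f b → a = b
  /-- every real root is positive or negative -/
  pos_or_neg : ∀ f ∈ toSimpleRoots.realRoots,
    f ∈ toSimpleRoots.posCone ∨ -f ∈ toSimpleRoots.posCone
  /-- `w(αᵢ)` is positive if and only if `ℓ(w rᵢ) > ℓ(w)` -/
  pos_iff_length : ∀ (w : toSimpleRoots.vWeyl) (i : ι),
    SimpleRoots.act (w : V ≃ₗ[ℝ] V) (root i) ∈ toSimpleRoots.posCone ↔
      cs.length w < cs.length (w * cs.simple i)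
  /-- `Φ ∩ ℝ⁺ α = {α}` for every real root `α` -/
  reduced : ∀ f ∈ toSimpleRoots.realRoots, ∀ c : ℝ, 0 ≤ c →
    c • f ∈ toSimpleRoots.realRoots → c • f = f
  /-- the set `Δ_im` of imaginary roots -/
  imag : Set (Module.Dual ℝ V)
  imag_ne_zero : ∀ f ∈ imag, f ≠ 0
  imag_disjoint : ∀ f ∈ imag, ∀ g ∈ toSimpleRoots.realRoots, ∀ c : ℝ, f ≠ c • g
  imag_neg : ∀ f ∈ imag, -f ∈ imag
  imag_pos_or_neg : ∀ f ∈ imag, f ∈ toSimpleRoots.posCone ∨ -f ∈ toSimpleRoots.posCone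
  /-- the set of positive imaginary roots is stable under `W^v` -/
  imag_pos_stable : ∀ f ∈ imag, f ∈ toSimpleRoots.posCone → ∀ w ∈ toSimpleRoots.vWeyl,
    SimpleRoots.act w f ∈ imag ∧ SimpleRoots.act w f ∈ toSimpleRoots.posCone

namespace VectorialDatum

variable {ι V : Type*} [Fintype ι] [AddCommGroup V] [Module ℝ V] (D : VectorialDatum ι V)

/-- The set `Δ = Φ ∪ Δ_im` of all roots. -/
def roots : Set (Module.Dual ℝ V) := D.realRoots ∪ D.imag

/-- The vectorial facet `F^v(J)` of the closed fundamental chamber. -/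
def stdFacet (J : Set ι) : Set V :=
  {v | (∀ i ∈ J, D.root i v = 0) ∧ ∀ i ∉ J, 0 < D.root i v}

/-- `J` is spherical: `W^v(J)` is finite. -/
def IsSpherical (J : Set ι) : Prop :=
  (Subgroup.closure (D.refl '' J) : Set (V ≃ₗ[ℝ] V)).Finite

/-- `F = ε w F^v(J)` for some `w ∈ W^v`: a vectorial facet of sign `ε` and type `J`. -/
def IsFacetOfType (ε : ℤˣ) (J : Set ι) (F : Set V) : Prop :=
  ∃ w ∈ D.vWeyl, F = (fun v => ((ε : ℤ) : ℝ) • w v) '' D.stdFacet J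

/-- Vectorial facets, positive or negative. -/
def IsVFacet (F : Set V) : Prop := ∃ ε J, D.IsFacetOfType ε J F

/-- Spherical vectorial facets of sign `ε`. -/
def IsSphericalFacet (ε : ℤˣ) (F : Set V) : Prop := ∃ J, D.IsSpherical J ∧ D.IsFacetOfType ε J F

/-- Vectorial chambers, positive or negative. -/
def IsVChamber (F : Set V) : Prop := ∃ ε, D.IsFacetOfType ε ∅ F

/-- Vectorial panels, positive or negative. -/
def IsVPanel (F : Set V) : Prop := ∃ ε i, D.IsFacetOfType ε {i} F

/-- The Tits cone: the union of the positive vectorial facets. -/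
def titsCone : Set V := {v | ∃ J F, D.IsFacetOfType 1 J F ∧ v ∈ F}

end VectorialDatum

/-! ## The model apartment -/

/-- The affine hyperplane `M(α, k)`. -/
def affWall {V : Type*} [AddCommGroup V] [Module ℝ V] (α : Module.Dual ℝ V) (k : ℝ) : Set V :=
  {x | α x + k = 0}

/-- The model affine apartment: the affine space `V` (no point of which plays a special role) with
a set of walls. -/
structure ModelApartment (ι V : Type*) [Fintype ι] [AddCommGroup V] [Module ℝ V]
    extends VectorialDatum ι V where
  /-- the set of real walls -/
  walls : Set (Set V)
  /-- the direction of a wall is the kernel of a real root -/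
  walls_dir : ∀ M ∈ walls, ∃ α ∈ toSimpleRoots.realRoots, ∃ k, M = affWall α k
  /-- there are infinitely many walls in the direction of each real root -/
  walls_infinite : ∀ α ∈ toSimpleRoots.realRoots, {M ∈ walls | ∃ k, M = affWall α k}.Infinite
  /-- the reflections in the walls permute the walls -/
  walls_stable : ∀ α a k, toSimpleRoots.IsRootPair α a → affWall α k ∈ walls →
    ∀ M ∈ walls, (fun x => x - (α x + k) • a) '' M ∈ walls

namespace ModelApartment

section Algebra

variable {ι V : Type*} [Fintype ι] [AddCommGroup V] [Module ℝ V] (𝔸 : ModelApartment ι V)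

/-- The affine Weyl group `W`, generated by the reflections in the walls. -/
def weyl : Subgroup (Equiv.Perm V) :=
  Subgroup.closure {g | ∃ α a k, 𝔸.IsRootPair α a ∧ affWall α k ∈ 𝔸.walls ∧
    ∀ x, g x = x - (α x + k) • a}

/-- The set `Γ_α` of all `k` such that `M(α, k)` is a wall, real or imaginary; it is all of `ℝ` if
`α` is imaginary. -/
def wallParams (α : Module.Dual ℝ V) : Set ℝ := {k | α ∈ 𝔸.imag ∨ affWall α k ∈ 𝔸.walls}

/-- The intersection over all `α ∈ Δ` of the half-spaces `D(α, k_α)`, or of the open half-spaces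
`D°(α, k_α)` if `α ∈ o`. The half-space is the whole space if `k_α = ∞`. -/
def halfSpaceInter (k : Module.Dual ℝ V → WithTop ℝ) (o : Set (Module.Dual ℝ V)) : Set V :=
  {x | ∀ α ∈ 𝔸.roots, ∀ r : ℝ, k α = r → 0 ≤ α x + r ∧ (α ∈ o → 0 < α x + r)}

/-- The family `k` has its values in `Γ_α ∪ {∞}`. -/
def IsAdmissible (k : Module.Dual ℝ V → WithTop ℝ) : Prop :=
  ∀ α ∈ 𝔸.roots, ∀ r : ℝ, k α = r → r ∈ 𝔸.wallParams α

lemma halfSpaceInter_inter (k k' : Module.Dual ℝ V → WithTop ℝ) (o o' : Set (Module.Dual ℝ V)) :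
    𝔸.halfSpaceInter k o ∩ 𝔸.halfSpaceInter k' o' = 𝔸.halfSpaceInter (fun α => min (k α) (k' α))
      ({α | α ∈ o ∧ k α ≤ k' α} ∪ {α | α ∈ o' ∧ k' α ≤ k α}) := by
  ext x
  simp only [halfSpaceInter, mem_inter_iff, Set.mem_ofPred_eq, ← forall_and, mem_union]
  refine forall₂_congr fun α _ => ?_
  cases hk : k α with
  | top => cases hk' : k' α with
    | top => simp
    | coe s => simp
  | coe r => cases hk' : k' α with
    | top => simp
    | coe s =>
      simp only [WithTop.coe_inj, WithTop.coe_le_coe, ← WithTop.coe_min, forall_and, forall_eq']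
      rcases lt_trichotomy r s with h | h | h
      · rw [min_eq_left h.le]
        constructor
        · rintro ⟨⟨h1, h2⟩, h3, h4⟩
          exact ⟨h1, fun h5 => h5.elim (fun h => h2 h.1) (fun h' => absurd h'.2 (not_le.2 h))⟩
        · rintro ⟨h1, h2⟩
          exact ⟨⟨h1, fun h5 => h2 (Or.inl ⟨h5, h.le⟩)⟩, by linarith, fun _ => by linarith⟩
      · subst h
        simp only [min_self, le_refl, and_true]
        tauto
      · rw [min_eq_right h.le]
        constructor
        · rintro ⟨⟨h1, h2⟩, h3, h4⟩
          exact ⟨h3, fun h5 => h5.elim (fun h' => absurd h'.2 (not_le.2 h)) (fun h => h4 h.1)⟩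
        · rintro ⟨h1, h2⟩
          exact ⟨⟨by linarith, fun _ => by linarith⟩, h1, fun h5 => h2 (Or.inr ⟨h5, h.le⟩)⟩

lemma IsAdmissible.min {𝔸 : ModelApartment ι V} {k k' : Module.Dual ℝ V → WithTop ℝ}
    (h : 𝔸.IsAdmissible k) (h' : 𝔸.IsAdmissible k') :
    𝔸.IsAdmissible (fun α => min (k α) (k' α)) := by
  intro α hα r hr
  rcases min_choice (k α) (k' α) with h1 | h1
  · exact h α hα r (h1 ▸ hr)
  · exact h' α hα r (h1 ▸ hr)

/-- The enclosure `cl(F)` of a filter `F`: the filter of all sets that contain an element of `F`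
of the form `⋂ D(α, k_α)`, with `k_α ∈ Γ_α ∪ {∞}`. -/
def cl (F : Filter V) : Filter V where
  sets := {S | ∃ k, 𝔸.IsAdmissible k ∧ 𝔸.halfSpaceInter k ∅ ∈ F ∧ 𝔸.halfSpaceInter k ∅ ⊆ S}
  univ_sets := ⟨fun _ => ⊤, by simp [IsAdmissible], by simp [halfSpaceInter], subset_univ _⟩
  sets_of_superset := by
    rintro S T ⟨k, hk, hF, hS⟩ hST
    exact ⟨k, hk, hF, hS.trans hST⟩
  inter_sets := by
    rintro S T ⟨k, hk, hF, hS⟩ ⟨k', hk', hF', hT⟩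
    have := 𝔸.halfSpaceInter_inter k k' ∅ ∅
    simp only [mem_empty_iff_false, false_and, Set.ofPred_false, union_empty] at this
    exact ⟨_, hk.min hk', this ▸ inter_mem hF hF', this ▸ inter_subset_inter hS hT⟩

/-- The support of a filter: the smallest affine subspace that contains it. -/
def supp (F : Filter V) : AffineSubspace ℝ V := sInf {E | (E : Set V) ∈ F}

/-- The direction of the support of `F` has a finite fixator in `W^v`. -/
def HasFiniteFixator (F : Filter V) : Prop :=
  {w : V ≃ₗ[ℝ] V | w ∈ 𝔸.vWeyl ∧ ∀ v ∈ (supp F).direction, w v = v}.Finite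

/-- The chimney `cl(B + F^v)` with base `B` and direction `F^v`. -/
def chimney (B : Filter V) (Fv : Set V) : Filter V := 𝔸.cl (B + 𝓟 Fv)

end Algebra

variable {ι V : Type*} [Fintype ι] [NormedAddCommGroup V] [NormedSpace ℝ V]
  (𝔸 : ModelApartment ι V)

/-- The local facet `F^ℓ(x, F^v)`: the germ at `x` of `x + F^v`. -/
def localFacet (x : V) (Fv : Set V) : Filter V := 𝓝[(fun v => x + v) '' Fv] x

/-- The facet `F(x, F^v)`: the filter of all sets that contain an intersection of half-spaces
`D(α, k_α)` or `D°(α, k_α)`, one for each `α ∈ Δ`, which contains the local facet. -/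
def facet (x : V) (Fv : Set V) : Filter V where
  sets := {S | ∃ k o, 𝔸.IsAdmissible k ∧ 𝔸.halfSpaceInter k o ∈ localFacet x Fv ∧
    𝔸.halfSpaceInter k o ⊆ S}
  univ_sets := ⟨fun _ => ⊤, ∅, by simp [IsAdmissible], by simp [halfSpaceInter], subset_univ _⟩
  sets_of_superset := by
    rintro S T ⟨k, o, hk, hF, hS⟩ hST
    exact ⟨k, o, hk, hF, hS.trans hST⟩
  inter_sets := by
    rintro S T ⟨k, o, hk, hF, hS⟩ ⟨k', o', hk', hF', hT⟩
    have := 𝔸.halfSpaceInter_inter k k' o o'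
    exact ⟨_, _, hk.min hk', this ▸ inter_mem hF hF', this ▸ inter_subset_inter hS hT⟩

/-- Facets of the apartment. -/
def IsFacet (F : Filter V) : Prop := ∃ x Fv, 𝔸.IsVFacet Fv ∧ F = 𝔸.facet x Fv

/-- Chambers of the apartment. -/
def IsChamber (F : Filter V) : Prop := ∃ x Cv, 𝔸.IsVChamber Cv ∧ F = 𝔸.facet x Cv

/-- Panels of the apartment: the facets `F(x, F^v)` with `F^v` a vectorial panel such that the
hyperplane through `x` that contains `x + F^v` is a real wall. -/
def IsPanel (F : Filter V) : Prop :=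
  ∃ x Fv, 𝔸.IsVPanel Fv ∧ (∃ M ∈ 𝔸.walls, x ∈ M ∧ ∀ v ∈ Fv, x + v ∈ M) ∧ F = 𝔸.facet x Fv

/-- The germ at `x` of the half-open segment `]x, y]`, with `x ≠ y` and `x ≤ y` or `y ≤ x`. -/
def IsPreorderedIntervalGerm (F : Filter V) : Prop :=
  ∃ x y, x ≠ y ∧ (y - x ∈ 𝔸.titsCone ∨ x - y ∈ 𝔸.titsCone) ∧
    F = 𝓝[(fun t : ℝ => x + t • (y - x)) '' Ioc 0 1] x

/-- A ray with origin `x` through `y ≠ x`, where `y - x` is in a spherical vectorial facet. -/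
def IsGenericRay (F : Filter V) : Prop :=
  ∃ x y, x ≠ y ∧ (∃ ε Fv, 𝔸.IsSphericalFacet ε Fv ∧ y - x ∈ Fv) ∧
    F = 𝓟 ((fun t : ℝ => x + t • (y - x)) '' Ici 0)

/-- Solid chimneys. -/
def IsSolidChimney (F : Filter V) : Prop :=
  ∃ B Fv, 𝔸.IsFacet B ∧ 𝔸.IsVFacet Fv ∧ 𝔸.HasFiniteFixator (𝔸.chimney B Fv) ∧
    F = 𝔸.chimney B Fv

/-- The germ of the chimney `cl(B + F^v)`: the filter of all sets that contain one of its
shortenings `cl(B + ξ + F^v)`, for `ξ` in the closure of `F^v`. -/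
def chimneyGerm (B : Filter V) (Fv : Set V) : Filter V :=
  ⨅ ξ ∈ closure Fv, 𝔸.cl (B + pure ξ + 𝓟 Fv)

/-- Germs of solid chimneys. -/
def IsSolidChimneyGerm (F : Filter V) : Prop :=
  ∃ B Fv, 𝔸.IsFacet B ∧ 𝔸.IsVFacet Fv ∧ 𝔸.HasFiniteFixator (𝔸.chimney B Fv) ∧
    F = 𝔸.chimneyGerm B Fv

/-- Germs of splayed chimneys: the direction is spherical, of any sign. -/
def IsSplayedChimneyGerm (F : Filter V) : Prop :=
  ∃ B Fv, 𝔸.IsFacet B ∧ (∃ ε, 𝔸.IsSphericalFacet ε Fv) ∧ F = 𝔸.chimneyGerm B Fv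

/-- The germ of the sector face `x + F^v`: the filter of all sets that contain one of its
shortenings `x + ξ + F^v`, for `ξ` in the closure of `F^v`. -/
def sectorFaceGerm (x : V) (Fv : Set V) : Filter V :=
  ⨅ ξ ∈ closure Fv, 𝓟 ((fun v => x + ξ + v) '' Fv)

end ModelApartment

/-! ## Affine hovels -/

/-- An affine hovel of type `𝔸` on the set `X`. The apartments are the ranges of the charts, and
the isomorphisms of `𝔸` onto an apartment `A` are the charts with range `A`. For a chart `f`, a
filter `F` on the model apartment stands for the filter `map f F` in the apartment `range f`; a set
`A` contains it if `A ∈ map f F`. An isomorphism from `range f` onto `A'` fixes `map f F` if it is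
the identity on an element of it; such isomorphisms have the form `g ∘ f⁻¹` with `g` a chart of
range `A'`. -/
structure AffineHovel {ι V : Type*} [Fintype ι] [NormedAddCommGroup V] [NormedSpace ℝ V]
    (𝔸 : ModelApartment ι V) (X : Type*) where
  /-- the isomorphisms of `𝔸` onto the apartments -/
  charts : Set (V → X)
  charts_injective : ∀ f ∈ charts, Function.Injective f
  /-- the charts onto a given apartment form one orbit of the affine Weyl group `W` -/
  charts_orbit : ∀ f ∈ charts, ∀ g : V → X,
    (g ∈ charts ∧ range g = range f) ↔ ∃ w ∈ 𝔸.weyl, g = f ∘ w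
  /-- the apartments cover `X` -/
  covering : ∀ p : X, ∃ f ∈ charts, p ∈ range f
  /-- axiom (MA2) -/
  ma2 : ∀ f ∈ charts, ∀ F : Filter V,
    ((∃ x, F = pure x) ∨ 𝔸.IsPreorderedIntervalGerm F ∨ 𝔸.IsGenericRay F ∨ 𝔸.IsSolidChimney F) →
    ∀ g ∈ charts, range g ∈ map f F →
      range g ∈ map f (𝔸.cl F) ∧
      ∃ g' ∈ charts, range g' = range g ∧ ∀ᶠ v in 𝔸.cl F, g' v = f v
  /-- axiom (MA3) -/
  ma3 : ∀ f ∈ charts, ∀ g ∈ charts, ∀ R F : Filter V,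
    𝔸.IsSplayedChimneyGerm R → (𝔸.IsFacet F ∨ 𝔸.IsSolidChimneyGerm F) →
    ∃ h ∈ charts, range h ∈ map f R ∧ range h ∈ map g F
  /-- axiom (MA4) -/
  ma4 : ∀ f ∈ charts, ∀ R F : Filter V,
    𝔸.IsSplayedChimneyGerm R → (𝔸.IsFacet F ∨ 𝔸.IsSolidChimneyGerm F) →
    ∀ g ∈ charts, range g ∈ map f R → range g ∈ map f F →
      range g ∈ map f (𝔸.cl (R ⊔ F)) ∧
      ∃ g' ∈ charts, range g' = range g ∧ ∀ᶠ v in 𝔸.cl (R ⊔ F), g' v = f v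

namespace AffineHovel

variable {ι V : Type*} [Fintype ι] [NormedAddCommGroup V] [NormedSpace ℝ V]
  {𝔸 : ModelApartment ι V} {X : Type*} (H : AffineHovel 𝔸 X)

/-- The set of apartments. -/
def apartments : Set (Set X) := range '' H.charts

/-- `C` is a chamber of the hovel that dominates the filter `P`: `P` is contained in the closure of
`C`. -/
def IsChamberDominating (P C : Filter X) : Prop :=
  ∃ g ∈ H.charts, ∃ C₀, 𝔸.IsChamber C₀ ∧ C = map g C₀ ∧ P ≤ map g (C₀.lift' closure)

/-- The hovel is thick: each of its panels is dominated by at least three chambers. -/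
def IsThick : Prop :=
  ∀ f ∈ H.charts, ∀ P, 𝔸.IsPanel P →
    ∃ C : Fin 3 → Filter X, Function.Injective C ∧ ∀ i, H.IsChamberDominating (map f P) (C i)

/-- The germs of spherical sector faces of sign `ε` in the hovel. -/
def FaceGerm (ε : ℤˣ) : Type _ :=
  {𝔉 : Filter X // ∃ f ∈ H.charts, ∃ x Fv, 𝔸.IsSphericalFacet ε Fv ∧
    𝔉 = map f (ModelApartment.sectorFaceGerm x Fv)}

/-- Two germs are parallel: they have the same direction in an apartment containing both. -/
def Parallel (ε : ℤˣ) (𝔉 𝔊 : H.FaceGerm ε) : Prop :=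
  ∃ f ∈ H.charts, ∃ x y Fv, 𝔸.IsSphericalFacet ε Fv ∧
    𝔉.1 = map f (ModelApartment.sectorFaceGerm x Fv) ∧
    𝔊.1 = map f (ModelApartment.sectorFaceGerm y Fv)

/-- `𝔉` dominates `𝔊`: in an apartment containing both, the direction of `𝔊` is contained in the
closure of the direction of `𝔉`. -/
def Dominates (ε : ℤˣ) (𝔉 𝔊 : H.FaceGerm ε) : Prop :=
  ∃ f ∈ H.charts, ∃ x y Fv Gv, 𝔸.IsSphericalFacet ε Fv ∧ 𝔸.IsSphericalFacet ε Gv ∧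
    𝔉.1 = map f (ModelApartment.sectorFaceGerm x Fv) ∧
    𝔊.1 = map f (ModelApartment.sectorFaceGerm y Gv) ∧ Gv ⊆ closure Fv

/-- The set of parallelism classes of germs of spherical sector faces of sign `ε`: the facets at
infinity of sign `ε`. -/
def Infinity (ε : ℤˣ) : Type _ := Quot (H.Parallel ε)

/-- The facet at infinity of a germ. -/
def toInfinity (ε : ℤˣ) (𝔉 : H.FaceGerm ε) : H.Infinity ε := Quot.mk _ 𝔉

/-- The relation on facets at infinity induced by dominance: `a ≤ b` if `b` dominates `a`. -/
def leInfinity (ε : ℤˣ) (a b : H.Infinity ε) : Prop :=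
  ∃ 𝔊 𝔉, H.toInfinity ε 𝔊 = a ∧ H.toInfinity ε 𝔉 = b ∧ H.Dominates ε 𝔉 𝔊

/-- The apartment at infinity of `A`: the classes with a representative in `A`. -/
def apartmentAtInfinity (ε : ℤˣ) (A : Set X) : Set (H.Infinity ε) :=
  {a | ∃ 𝔉, H.toInfinity ε 𝔉 = a ∧ A ∈ 𝔉.1}

/-- The set of apartments at infinity of sign `ε`. -/
def apartmentsAtInfinity (ε : ℤˣ) : Set (Set (H.Infinity ε)) :=
  H.apartmentAtInfinity ε '' H.apartments

end AffineHovel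

/-! ## Combinatorial buildings -/

section Building

variable {ι : Type*} {M : CoxeterMatrix ι} {W : Type*} [Group W]

/-- The standard parabolic subgroup `W_J`. -/
def CoxeterSystem.standardParabolic (cs : CoxeterSystem M W) (J : Set ι) : Subgroup W :=
  Subgroup.closure (cs.simple '' J)

/-- The cosets `w W_J` with `W_J` finite: the simplices of the Coxeter complex that have a finite
stabilizer. All the chambers and all the panels are among them. The face relation is the reverse
inclusion. -/
def CoxeterSystem.SphericalCoset (cs : CoxeterSystem M W) : Type _ :=
  {C : Set W // ∃ (w : W) (J : Set ι), (cs.standardParabolic J : Set W).Finite ∧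
    C = w • (cs.standardParabolic J : Set W)}

/-- A set `Y` of facets with a face relation `le`, a set `𝒜` of apartments and a type function `τ`
is a combinatorial building of type `(W, S)`, where only the spherical facets are kept (all of them
if `W` is finite). -/
structure IsTypedBuilding (cs : CoxeterSystem M W) {Y : Type*} (le : Y → Y → Prop)
    (𝒜 : Set (Set Y)) (τ : Y → Set ι) : Prop where
  partialOrder : IsPartialOrder Y le
  nonempty : 𝒜.Nonempty
  /-- each apartment is a subcomplex -/
  face_mem : ∀ A ∈ 𝒜, ∀ a ∈ A, ∀ b, le b a → b ∈ A
  /-- each apartment is isomorphic to the Coxeter complex, with its types -/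
  coxeter : ∀ A ∈ 𝒜, ∃ φ : A ≃ cs.SphericalCoset,
    (∀ a b : A, le a b ↔ ((φ b).1 : Set W) ⊆ (φ a).1) ∧
    ∀ a : A, ∃ w : W, (φ a).1 = w • (cs.standardParabolic (τ a) : Set W)
  /-- two facets are always contained in a common apartment -/
  common : ∀ a b : Y, ∃ A ∈ 𝒜, a ∈ A ∧ b ∈ A
  /-- if two apartments contain the facets `a` and `b`, there is an isomorphism between them that
  fixes `a`, `b` and all their faces -/
  iso : ∀ A ∈ 𝒜, ∀ A' ∈ 𝒜, ∀ a b : Y, a ∈ A → b ∈ A → a ∈ A' → b ∈ A' →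
    ∃ φ : A ≃ A', (∀ c d : A, le c d ↔ le (φ c) (φ d)) ∧ (∀ c : A, τ (φ c) = τ c) ∧
      ∀ c : A, le c a ∨ le c b → (φ c : Y) = c

/-- Combinatorial buildings of type `(W, S)`. -/
def IsCombinatorialBuilding (cs : CoxeterSystem M W) {Y : Type*} (le : Y → Y → Prop)
    (𝒜 : Set (Set Y)) : Prop :=
  ∃ τ : Y → Set ι, IsTypedBuilding cs le 𝒜 τ

/-- Chambers: the maximal facets. -/
def IsBuildingChamber {Y : Type*} (le : Y → Y → Prop) (c : Y) : Prop := ∀ d, le c d → d = c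

/-- Panels: the facets that are maximal among the non-maximal ones. -/
def IsBuildingPanel {Y : Type*} (le : Y → Y → Prop) (p : Y) : Prop :=
  ¬ IsBuildingChamber le p ∧ ∀ d, le p d → ¬ IsBuildingChamber le d → d = p

/-- The building is thick: each panel is dominated by at least three chambers. -/
def IsThickBuilding {Y : Type*} (le : Y → Y → Prop) : Prop :=
  ∀ p, IsBuildingPanel le p →
    ∃ C : Fin 3 → Y, Function.Injective C ∧ ∀ i, IsBuildingChamber le (C i) ∧ le p (C i)

end Building

end

open Set Filter Topology
open scoped Pointwise

noncomputable section

/-! Inside one apartment everything is visible: the facets at infinity of sign `ε` are the spherical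
vectorial facets, and sending such a facet to the set of chambers containing it identifies them with
the cosets of the finite standard parabolic subgroups. What needs proof is that nothing depends on
the apartment, or on the germ representing a class.

By (MA2) and (MA4), an apartment containing two germs of another apartment is related to it by an
isomorphism fixing both germs (`exists_chart_fixing_germs`), so the pair of directions of two germs
is well defined up to `W^v` (`directions_unique`). By (MA3), any two germs lie in a common
apartment. The heart is `InPosition.of_parallel_left`: for every `W^v`-invariant relation `ρ`
between directions, the validity of `ρ` for two germs depends only on their parallelism classes. The
base point of the first germ is moved along a line. Chimneys based at a facet with origin on this
line give an apartment containing the second germ and all germs of the moving family just after (or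
just before) a given parameter, so the relative position is locally constant, hence constant. This
needs the line to be directed by a vectorial facet, which can be arranged because a spherical facet
is interior to the Tits cone up to sign (`IsSphericalFacet.exists_add_smul_mem`). Three choices of
`ρ` are used: equality gives transitivity of parallelism, inclusion in the closure gives the order,
and "simultaneous image of a given pair under `W^v`" gives the isomorphisms between apartments.

For thickness, a panel at infinity is represented by a panel of the hovel at a special point `x`.
Each of three chambers dominating this panel lies in a common apartment with the germ of the sector
face, and there it is the chamber at `x` of a sector bordered by this face
(`exists_chart_of_isChamberDominating`). Two sectors with the same chamber at infinity have the same
chamber at `x` (`map_facet_eq_of_atInfinity_eq`), so the three chambers at infinity are distinct.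
The delicate point is that facets are filters defined by possibly infinitely many roots:
`IsSpecial.facet_eq_of_le` and `facet_le_of_le_closure` show that, within one apartment, only the
two expected chambers dominate a panel at a special point. -/

/-! ## Faces of simplicial cones -/

section Face

variable {ι V : Type*}

section Algebra

variable [AddCommGroup V] [Module ℝ V]

/-- The relatively open face of type `J` of the simplicial cone defined by the linear forms `b`. -/
def face (b : ι → Module.Dual ℝ V) (J : Set ι) : Set V :=
  {v | (∀ i ∈ J, b i v = 0) ∧ ∀ i ∉ J, 0 < b i v}

/-- The closed face of type `J` of the simplicial cone defined by the linear forms `b`. -/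
def closedFace (b : ι → Module.Dual ℝ V) (J : Set ι) : Set V :=
  {v | (∀ i ∈ J, b i v = 0) ∧ ∀ i, 0 ≤ b i v}

/-- `f` is a combination of the linear forms `b` with nonnegative coefficients. -/
def IsPosComb [Fintype ι] (b : ι → Module.Dual ℝ V) (f : Module.Dual ℝ V) : Prop :=
  ∃ c : ι → ℝ, (∀ i, 0 ≤ c i) ∧ f = ∑ i, c i • b i

variable {b : ι → Module.Dual ℝ V} {J K : Set ι} {u v : V}

lemma face_subset_closedFace : face b J ⊆ closedFace b J := fun v hv =>
  ⟨hv.1, fun i => by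
    by_cases hi : i ∈ J
    · exact (hv.1 i hi).ge
    · exact (hv.2 i hi).le⟩

lemma add_mem_face (hu : u ∈ closedFace b J) (hv : v ∈ face b J) : u + v ∈ face b J :=
  ⟨fun i hi => by rw [map_add, hu.1 i hi, hv.1 i hi, add_zero], fun i hi => by
    rw [map_add]; exact add_pos_of_nonneg_of_pos (hu.2 i) (hv.2 i hi)⟩

lemma smul_mem_face {t : ℝ} (ht : 0 < t) (hv : v ∈ face b J) : t • v ∈ face b J :=
  ⟨fun i hi => by simp [hv.1 i hi], fun i hi => by
    simpa using mul_pos ht (hv.2 i hi)⟩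

lemma add_mem_closedFace (hu : u ∈ closedFace b J) (hv : v ∈ closedFace b J) :
    u + v ∈ closedFace b J :=
  ⟨fun i hi => by rw [map_add, hu.1 i hi, hv.1 i hi, add_zero], fun i => by
    rw [map_add]; exact add_nonneg (hu.2 i) (hv.2 i)⟩

lemma zero_mem_closedFace : (0 : V) ∈ closedFace b J := ⟨fun _ _ => by simp, fun _ => by simp⟩

lemma closedFace_anti (h : J ⊆ K) : closedFace b K ⊆ closedFace b J :=
  fun _ hv => ⟨fun i hi => hv.1 i (h hi), hv.2⟩

lemma IsPosComb.nonneg [Fintype ι] {f : Module.Dual ℝ V} (hf : IsPosComb b f)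
    (hv : v ∈ closedFace b J) : 0 ≤ f v := by
  obtain ⟨c, hc, rfl⟩ := hf
  simp only [LinearMap.sum_apply, LinearMap.smul_apply, smul_eq_mul]
  exact Finset.sum_nonneg fun i _ => mul_nonneg (hc i) (hv.2 i)

/-- A positive combination that vanishes at a point of a face only involves the forms that vanish
on the face. -/
lemma IsPosComb.coeff_eq_zero [Fintype ι] {c : ι → ℝ} (hc : ∀ i, 0 ≤ c i) (hv : v ∈ face b J)
    (h : (∑ i, c i • b i) v ≤ 0) {i : ι} (hi : i ∉ J) : c i = 0 := by
  simp only [LinearMap.sum_apply, LinearMap.smul_apply, smul_eq_mul] at h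
  have hnn : ∀ i ∈ Finset.univ, 0 ≤ c i * b i v := fun i _ =>
    mul_nonneg (hc i) ((face_subset_closedFace hv).2 i)
  have h0 := (Finset.sum_eq_zero_iff_of_nonneg hnn).1 (le_antisymm h (Finset.sum_nonneg hnn)) i
    (Finset.mem_univ i)
  rcases mul_eq_zero.1 h0 with h0 | h0
  · exact h0
  · exact absurd h0 (hv.2 i hi).ne'

/-- A form of constant sign on the cone that is nonnegative at one point of a face is nonnegative
on the closed face. -/
lemma nonneg_on_closedFace [Fintype ι] {f : Module.Dual ℝ V}
    (hf : IsPosComb b f ∨ IsPosComb b (-f)) (hv : v ∈ face b J) (h : 0 ≤ f v)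
    (hu : u ∈ closedFace b J) : 0 ≤ f u := by
  rcases hf with hf | ⟨c, hc, hf⟩
  · exact hf.nonneg hu
  -- Here `-f` is a positive combination that is at most `0` at `v`, so only forms indexed by `J`
  -- occur in it, and these vanish on the closed face.
  · have h1 : (∑ i, c i • b i) v ≤ 0 := by rw [← hf]; simpa using h
    have h2 : (∑ i, c i • b i) u = 0 := by
      simp only [LinearMap.sum_apply, LinearMap.smul_apply, smul_eq_mul]
      refine Finset.sum_eq_zero fun i _ => ?_
      by_cases hi : i ∈ J
      · rw [hu.1 i hi, mul_zero]
      · rw [IsPosComb.coeff_eq_zero hc hv h1 hi, zero_mul]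
    rw [← hf] at h2
    simp only [LinearMap.neg_apply, neg_eq_zero] at h2
    exact h2.ge

/-- A free family of linear forms takes arbitrary values at a suitable point. -/
lemma LinearIndependent.exists_dual_apply_eq [Fintype ι] (hb : LinearIndependent ℝ b)
    (c : ι → ℝ) : ∃ v, ∀ i, b i v = c i := by
  have hs : LinearMap.range (LinearMap.pi b) = ⊤ := by
    -- A nonzero functional vanishing on the range would be a linear relation between the `b i`, its
    -- coefficients being its values on the standard basis.
    by_contra hne
    obtain ⟨φ, hφ, hle⟩ := Submodule.exists_le_ker_of_lt_top _ (lt_top_iff_ne_top.2 hne)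
    classical
    have h0 : ∑ i, φ (fun j => if i = j then 1 else 0) • b i = 0 := by
      ext v
      have h1 : φ (LinearMap.pi b v) = 0 := hle ⟨v, rfl⟩
      rw [LinearMap.pi_apply_eq_sum_univ φ] at h1
      simpa [mul_comm] using h1
    have h2 := Fintype.linearIndependent_iff.1 hb _ h0
    refine hφ (LinearMap.ext fun x => ?_)
    rw [LinearMap.pi_apply_eq_sum_univ φ]
    exact Finset.sum_eq_zero fun i _ => by rw [h2 i, smul_zero]
  obtain ⟨v, hv⟩ := LinearMap.range_eq_top.1 hs c
  exact ⟨v, fun i => by rw [← hv]; rfl⟩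

lemma face_nonempty [Fintype ι] (hb : LinearIndependent ℝ b) (J : Set ι) : (face b J).Nonempty := by
  classical
  obtain ⟨v, hv⟩ := hb.exists_dual_apply_eq fun i => if i ∈ J then 0 else 1
  exact ⟨v, fun i hi => by simp [hv, hi], fun i hi => by simp [hv, hi]⟩

end Algebra

variable [NormedAddCommGroup V] [NormedSpace ℝ V] [FiniteDimensional ℝ V]

lemma isClosed_closedFace (b : ι → Module.Dual ℝ V) (J : Set ι) : IsClosed (closedFace b J) := by
  have hc : ∀ i, Continuous (b i) := fun i => (b i).continuous_of_finiteDimensional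
  have : closedFace b J = (⋂ i ∈ J, {v | b i v = 0}) ∩ ⋂ i, {v | 0 ≤ b i v} := by
    ext v; simp [closedFace]
  rw [this]
  exact (isClosed_biInter fun i _ => isClosed_eq (hc i) continuous_const).inter
    (isClosed_iInter fun i => isClosed_le continuous_const (hc i))

/-- Adding a small positive multiple of a point of the open face moves a point of the closed face
into the open one. Freeness only serves to make the open face nonempty. -/
lemma closure_face [Fintype ι] {b : ι → Module.Dual ℝ V} (hb : LinearIndependent ℝ b) (J : Set ι) :
    closure (face b J) = closedFace b J := by
  refine subset_antisymm (closure_minimal face_subset_closedFace (isClosed_closedFace b J)) ?_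
  intro v hv
  obtain ⟨c, hc⟩ := face_nonempty hb J
  have hlim : Tendsto (fun t : ℝ => v + t • c) (𝓝[>] 0) (𝓝 v) := by
    have : Continuous fun t : ℝ => v + t • c := by fun_prop
    have h := this.tendsto 0
    simp only [zero_smul, add_zero] at h
    exact h.mono_left nhdsWithin_le_nhds
  refine mem_closure_of_tendsto hlim ?_
  filter_upwards [self_mem_nhdsWithin] with t ht
  exact add_mem_face hv (smul_mem_face ht hc)

end Face

/-! ## Combinatorics of the vectorial facets -/

namespace SimpleRoots

variable {ι V : Type*} [AddCommGroup V] [Module ℝ V]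

lemma act_apply (w : V ≃ₗ[ℝ] V) (f : Module.Dual ℝ V) (v : V) : act w f v = f (w⁻¹ v) := rfl

lemma act_apply_apply (w : V ≃ₗ[ℝ] V) (f : Module.Dual ℝ V) (v : V) : act w f (w v) = f v := by
  simp [act]

lemma act_mul (u w : V ≃ₗ[ℝ] V) (f : Module.Dual ℝ V) : act (u * w) f = act u (act w f) := rfl

lemma act_one (f : Module.Dual ℝ V) : act 1 f = f := rfl

lemma act_neg (w : V ≃ₗ[ℝ] V) (f : Module.Dual ℝ V) : act w (-f) = -act w f := rfl

lemma act_smul (w : V ≃ₗ[ℝ] V) (c : ℝ) (f : Module.Dual ℝ V) : act w (c • f) = c • act w f := rfl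

lemma act_inv_act (w : V ≃ₗ[ℝ] V) (f : Module.Dual ℝ V) : act w⁻¹ (act w f) = f := by
  rw [← act_mul, inv_mul_cancel, act_one]

lemma act_act_inv (w : V ≃ₗ[ℝ] V) (f : Module.Dual ℝ V) : act w (act w⁻¹ f) = f := by
  rw [← act_mul, mul_inv_cancel, act_one]

lemma act_sum {κ : Type*} (s : Finset κ) (w : V ≃ₗ[ℝ] V) (f : κ → Module.Dual ℝ V) :
    act w (∑ i ∈ s, f i) = ∑ i ∈ s, act w (f i) := by
  ext v
  simp [act_apply, LinearMap.sum_apply]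

variable (B : SimpleRoots ι V)

lemma refl_apply (i : ι) (v : V) : B.refl i v = v - B.root i v • B.coroot i :=
  Module.reflection_apply ..

lemma refl_mem (i : ι) : B.refl i ∈ B.vWeyl := Subgroup.subset_closure ⟨i, rfl⟩

lemma refl_inv (i : ι) : (B.refl i)⁻¹ = B.refl i := by
  rw [inv_eq_iff_mul_eq_one]
  ext v
  exact Module.involutive_reflection (B.root_coroot i) v

lemma act_refl (i : ι) (f : Module.Dual ℝ V) :
    act (B.refl i) f = f - f (B.coroot i) • B.root i := by
  ext v
  rw [act_apply, refl_inv, refl_apply]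
  simp [mul_comm]

lemma act_refl_root (i : ι) : act (B.refl i) (B.root i) = -B.root i := by
  rw [act_refl, root_coroot, two_smul]
  abel

lemma root_mem_realRoots (i : ι) : B.root i ∈ B.realRoots :=
  ⟨B.coroot i, 1, one_mem _, i, rfl, rfl⟩

variable {B}

lemma act_mem_realRoots {f : Module.Dual ℝ V} (hf : f ∈ B.realRoots) {w : V ≃ₗ[ℝ] V}
    (hw : w ∈ B.vWeyl) : act w f ∈ B.realRoots := by
  obtain ⟨a, u, hu, i, rfl, rfl⟩ := hf
  exact ⟨_, w * u, mul_mem hw hu, i, (act_mul ..).symm, rfl⟩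

lemma neg_mem_realRoots {f : Module.Dual ℝ V} (hf : f ∈ B.realRoots) : -f ∈ B.realRoots := by
  obtain ⟨a, u, hu, i, rfl, rfl⟩ := hf
  refine ⟨_, u * B.refl i, mul_mem hu (B.refl_mem i), i, ?_, rfl⟩
  rw [act_mul, act_refl_root, act_neg]

end SimpleRoots

namespace VectorialDatum

open SimpleRoots

section Algebra

variable {ι V : Type*} [Fintype ι] [AddCommGroup V] [Module ℝ V] (D : VectorialDatum ι V)

/-- The simple roots of the chamber `ε w C`. -/
def chamberRoot (ε : ℤˣ) (w : V ≃ₗ[ℝ] V) (i : ι) : Module.Dual ℝ V :=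
  ((ε : ℤ) : ℝ) • act w (D.root i)

/-- The subgroup `W^v(J)` of `GL(V)`. -/
def parabolic (J : Set ι) : Subgroup (V ≃ₗ[ℝ] V) := Subgroup.closure (D.refl '' J)

lemma parabolic_le (J : Set ι) : D.parabolic J ≤ D.vWeyl :=
  Subgroup.closure_mono (image_subset_range _ _)

variable {D}

lemma sign_mul_self (ε : ℤˣ) : ((ε : ℤ) : ℝ) * ((ε : ℤ) : ℝ) = 1 := by
  rcases Int.units_eq_one_or ε with rfl | rfl <;> simp

lemma sign_smul_smul (ε : ℤˣ) (v : V) : ((ε : ℤ) : ℝ) • ((ε : ℤ) : ℝ) • v = v := by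
  rw [smul_smul, sign_mul_self, one_smul]

lemma chamberRoot_apply (ε : ℤˣ) (w : V ≃ₗ[ℝ] V) (i : ι) (v : V) :
    D.chamberRoot ε w i v = D.root i (((ε : ℤ) : ℝ) • w⁻¹ v) := by
  simp [chamberRoot, act_apply]

lemma mem_face_chamberRoot {ε : ℤˣ} {w : V ≃ₗ[ℝ] V} {J : Set ι} {v : V} :
    v ∈ face (D.chamberRoot ε w) J ↔ ((ε : ℤ) : ℝ) • w⁻¹ v ∈ face D.root J := by
  simp only [face, Set.mem_ofPred_eq, chamberRoot_apply]

lemma mem_closedFace_chamberRoot {ε : ℤˣ} {w : V ≃ₗ[ℝ] V} {J : Set ι} {v : V} :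
    v ∈ closedFace (D.chamberRoot ε w) J ↔ ((ε : ℤ) : ℝ) • w⁻¹ v ∈ closedFace D.root J := by
  simp only [closedFace, Set.mem_ofPred_eq, chamberRoot_apply]

lemma isFacetOfType_iff {ε : ℤˣ} {J : Set ι} {F : Set V} :
    D.IsFacetOfType ε J F ↔ ∃ w ∈ D.vWeyl, F = face (D.chamberRoot ε w) J := by
  have key : ∀ w : V ≃ₗ[ℝ] V, (fun v => ((ε : ℤ) : ℝ) • w v) '' D.stdFacet J =
      face (D.chamberRoot ε w) J := by
    intro w
    ext v
    rw [mem_face_chamberRoot]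
    constructor
    · rintro ⟨u, hu, rfl⟩
      have : ((ε : ℤ) : ℝ) • w⁻¹ (((ε : ℤ) : ℝ) • w u) = u := by
        rw [map_smul, sign_smul_smul]
        exact w.symm_apply_apply u
      rw [this]
      exact hu
    · intro h
      refine ⟨_, h, ?_⟩
      simp only [map_smul, sign_smul_smul]
      exact w.apply_symm_apply v
  simp only [IsFacetOfType, key]

lemma linearIndependent_chamberRoot (ε : ℤˣ) (w : V ≃ₗ[ℝ] V) :
    LinearIndependent ℝ (D.chamberRoot ε w) := by
  rw [Fintype.linearIndependent_iff]
  intro c hc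
  refine Fintype.linearIndependent_iff.1 D.root_free c (LinearMap.ext fun v => ?_)
  have h := LinearMap.congr_fun hc (((ε : ℤ) : ℝ) • w v)
  have h1 : ∀ i, D.chamberRoot ε w i (((ε : ℤ) : ℝ) • w v) = D.root i v := fun i => by
    rw [chamberRoot_apply, map_smul w⁻¹, sign_smul_smul]
    exact congrArg _ (w.symm_apply_apply v)
  simp only [LinearMap.sum_apply, LinearMap.smul_apply, h1, LinearMap.zero_apply] at h ⊢
  exact h

lemma image_face_chamberRoot (ε : ℤˣ) (u w : V ≃ₗ[ℝ] V) (J : Set ι) :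
    u '' face (D.chamberRoot ε w) J = face (D.chamberRoot ε (u * w)) J := by
  ext v
  have h : (u : V → V) '' face (D.chamberRoot ε w) J =
      {v | u⁻¹ v ∈ face (D.chamberRoot ε w) J} := by
    ext x
    constructor
    · rintro ⟨y, hy, rfl⟩
      simpa [LinearEquiv.symm_apply_apply] using hy
    · intro hx
      exact ⟨_, hx, u.apply_symm_apply x⟩
  rw [h, Set.mem_ofPred_eq, mem_face_chamberRoot, mem_face_chamberRoot, mul_inv_rev]
  rfl

lemma neg_mem_face_chamberRoot {ε : ℤˣ} {w : V ≃ₗ[ℝ] V} {J : Set ι} {v : V} :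
    -v ∈ face (D.chamberRoot (-ε) w) J ↔ v ∈ face (D.chamberRoot ε w) J := by
  simp [mem_face_chamberRoot]

lemma act_mem_imag {f : Module.Dual ℝ V} (hf : f ∈ D.imag) {w : V ≃ₗ[ℝ] V} (hw : w ∈ D.vWeyl) :
    act w f ∈ D.imag := by
  rcases D.imag_pos_or_neg f hf with h | h
  · exact (D.imag_pos_stable f hf h w hw).1
  · have := D.imag_neg _ (D.imag_pos_stable _ (D.imag_neg f hf) h w hw).1
    rwa [act_neg, neg_neg] at this

lemma act_mem_roots {f : Module.Dual ℝ V} (hf : f ∈ D.roots) {w : V ≃ₗ[ℝ] V} (hw : w ∈ D.vWeyl) :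
    act w f ∈ D.roots :=
  hf.imp (fun h => act_mem_realRoots h hw) (fun h => act_mem_imag h hw)

lemma neg_mem_roots {f : Module.Dual ℝ V} (hf : f ∈ D.roots) : -f ∈ D.roots :=
  hf.imp neg_mem_realRoots (D.imag_neg f)

lemma isPosComb_or_neg {f : Module.Dual ℝ V} (hf : f ∈ D.roots) (ε : ℤˣ) {w : V ≃ₗ[ℝ] V}
    (hw : w ∈ D.vWeyl) : IsPosComb (D.chamberRoot ε w) f ∨ IsPosComb (D.chamberRoot ε w) (-f) := by
  have h1 : ∀ g, act w⁻¹ g ∈ D.posCone → IsPosComb (D.chamberRoot 1 w) g := by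
    rintro g ⟨c, hc, hg⟩
    refine ⟨c, hc, ?_⟩
    rw [← act_act_inv w g, hg, act_sum]
    simp [chamberRoot, act_smul]
  have h2 : ∀ g, IsPosComb (D.chamberRoot 1 w) g → IsPosComb (D.chamberRoot (-1) w) (-g) := by
    rintro g ⟨c, hc, rfl⟩
    refine ⟨c, hc, ?_⟩
    ext v
    simp [chamberRoot, LinearMap.sum_apply]
  have h3 : act w⁻¹ f ∈ D.posCone ∨ -act w⁻¹ f ∈ D.posCone := by
    rcases act_mem_roots hf (inv_mem hw) with h | h
    · exact D.pos_or_neg _ h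
    · exact D.imag_pos_or_neg _ h
  rw [← act_neg] at h3
  rcases Int.units_eq_one_or ε with rfl | rfl
  · exact h3.imp (h1 _) (h1 _)
  · rcases h3 with h | h
    · exact Or.inr (h2 _ (h1 _ h))
    · left
      simpa using h2 _ (h1 _ h)

/-- The closed fundamental chamber is a fundamental domain, and the fixator of a point in it is
the corresponding parabolic subgroup. -/
lemma mem_parabolic_of_mem_closedFace {J : Set ι} {v : V} (hv : v ∈ face D.root J) :
    ∀ (w : D.vWeyl), (w : V ≃ₗ[ℝ] V) v ∈ closedFace D.root ∅ →
      (w : V ≃ₗ[ℝ] V) ∈ D.parabolic J ∧ (w : V ≃ₗ[ℝ] V) v = v := by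
  intro w
  induction hn : D.cs.length w using Nat.strong_induction_on generalizing w with
  | _ n ih =>
    intro hwv
    by_cases h1 : w = 1
    · subst h1
      exact ⟨one_mem _, rfl⟩
    -- At a right descent `i` the root `w(αᵢ)` is negative. As `w v` is dominant this forces `αᵢ(v)
    -- ≤ 0`, so `i ∈ J` and `rᵢ` fixes `v`; the shorter element `w rᵢ` then takes over.
    obtain ⟨i, hi⟩ := D.cs.exists_rightDescent_of_ne_one h1
    have hlt : D.cs.length (w * D.cs.simple i) < D.cs.length w := hi
    have hnp : act (w : V ≃ₗ[ℝ] V) (D.root i) ∉ D.posCone := fun h =>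
      absurd ((D.pos_iff_length w i).1 h) (not_lt.2 hlt.le)
    have hneg := (D.pos_or_neg _ (act_mem_realRoots (D.root_mem_realRoots i) w.2)).resolve_left hnp
    have hle : 0 ≤ (-act (w : V ≃ₗ[ℝ] V) (D.root i)) ((w : V ≃ₗ[ℝ] V) v) :=
      IsPosComb.nonneg (b := D.root) hneg hwv
    rw [LinearMap.neg_apply, act_apply_apply] at hle
    have hiJ : i ∈ J := by
      by_contra hiJ
      have := hv.2 i hiJ
      linarith
    have hrv : D.refl i v = v := by rw [refl_apply, hv.1 i hiJ, zero_smul, sub_zero]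
    have hcoe : ((w * D.cs.simple i : D.vWeyl) : V ≃ₗ[ℝ] V) = (w : V ≃ₗ[ℝ] V) * D.refl i := by
      rw [Subgroup.coe_mul, D.cs_simple]
    have hwr : ((w * D.cs.simple i : D.vWeyl) : V ≃ₗ[ℝ] V) v = (w : V ≃ₗ[ℝ] V) v := by
      rw [hcoe, LinearEquiv.mul_apply, hrv]
    obtain ⟨h2, h3⟩ := ih _ (hn ▸ hlt) (w * D.cs.simple i) rfl (by rw [hwr]; exact hwv)
    refine ⟨?_, hwr ▸ h3⟩
    rw [hcoe] at h2
    have h4 := mul_mem h2 (Subgroup.subset_closure ⟨i, hiJ, rfl⟩ : D.refl i ∈ D.parabolic J)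
    nth_rewrite 2 [← D.refl_inv i] at h4
    rwa [mul_inv_cancel_right] at h4

lemma parabolic_fixes {J : Set ι} {v : V} (hv : v ∈ face D.root J) {w : V ≃ₗ[ℝ] V}
    (hw : w ∈ D.parabolic J) : w v = v := by
  induction hw using Subgroup.closure_induction with
  | mem x hx =>
    obtain ⟨i, hi, rfl⟩ := hx
    rw [refl_apply, hv.1 i hi, zero_smul, sub_zero]
  | one => rfl
  | mul x y _ _ hx hy => rw [LinearEquiv.mul_apply, hy, hx]
  | inv x _ hx =>
    nth_rewrite 1 [← hx]
    exact x.symm_apply_apply v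

/-- The group `W^v(J)` fixes the standard face of type `J` pointwise, so a chamber and its
translates under the conjugate group share this face. -/
lemma face_chamberRoot_mul {ε : ℤˣ} {u w : V ≃ₗ[ℝ] V} {J : Set ι} (hw : w ∈ D.parabolic J) :
    face (D.chamberRoot ε (u * w)) J = face (D.chamberRoot ε u) J := by
  have key : ∀ (w : V ≃ₗ[ℝ] V) (x : V), w ∈ D.parabolic J → x ∈ face D.root J →
      w x ∈ face D.root J := fun w x hw hx => by rwa [parabolic_fixes hx hw]
  have e1 : ∀ v, ((ε : ℤ) : ℝ) • (u * w)⁻¹ v = w⁻¹ (((ε : ℤ) : ℝ) • u⁻¹ v) := fun v => by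
    rw [mul_inv_rev, map_smul]; rfl
  ext v
  rw [mem_face_chamberRoot, mem_face_chamberRoot, e1]
  refine ⟨fun h => ?_, fun h => key _ _ (inv_mem hw) h⟩
  have := key w _ hw h
  rwa [show w (w⁻¹ (((ε : ℤ) : ℝ) • u⁻¹ v)) = ((ε : ℤ) : ℝ) • u⁻¹ v from
    w.apply_symm_apply _] at this

/-- If a facet meets a closed facet of the same sign, they have a common chamber. -/
lemma mem_parabolic_of_mem {ε : ℤˣ} {u u' : V ≃ₗ[ℝ] V} (hu : u ∈ D.vWeyl) (hu' : u' ∈ D.vWeyl)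
    {J J' : Set ι} {v : V} (hv : v ∈ face (D.chamberRoot ε u) J)
    (hv' : v ∈ closedFace (D.chamberRoot ε u') J') :
    u⁻¹ * u' ∈ D.parabolic J ∧ J' ⊆ J := by
  rw [mem_face_chamberRoot] at hv
  rw [mem_closedFace_chamberRoot] at hv'
  have hmem : u'⁻¹ * u ∈ D.vWeyl := mul_mem (inv_mem hu') hu
  have e1 : (u'⁻¹ * u) (((ε : ℤ) : ℝ) • u⁻¹ v) = ((ε : ℤ) : ℝ) • u'⁻¹ v := by
    rw [map_smul, LinearEquiv.mul_apply]
    exact congrArg (fun x => ((ε : ℤ) : ℝ) • u'⁻¹ x) (u.apply_symm_apply v)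
  obtain ⟨h1, h2⟩ := mem_parabolic_of_mem_closedFace hv ⟨_, hmem⟩
    (by rw [e1]; exact closedFace_anti (empty_subset _) hv')
  refine ⟨?_, ?_⟩
  · have := inv_mem h1
    rwa [mul_inv_rev, inv_inv] at this
  · rw [← e1, h2] at hv'
    intro i hi
    by_contra hiJ
    exact absurd (hv'.1 i hi) (hv.2 i hiJ).ne'

/-- One common point already forces the inclusion, by `mem_parabolic_of_mem`. This is the dictionary
between the geometry of facets and cosets. -/
lemma face_subset_closedFace_iff {ε : ℤˣ} {u u' : V ≃ₗ[ℝ] V} (hu : u ∈ D.vWeyl)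
    (hu' : u' ∈ D.vWeyl) {J J' : Set ι} :
    face (D.chamberRoot ε u) J ⊆ closedFace (D.chamberRoot ε u') J' ↔
      u⁻¹ * u' ∈ D.parabolic J ∧ J' ⊆ J := by
  constructor
  · intro h
    obtain ⟨v, hv⟩ := face_nonempty (D.linearIndependent_chamberRoot ε u) J
    exact mem_parabolic_of_mem hu hu' hv (h hv)
  · rintro ⟨h1, h2⟩
    have := face_chamberRoot_mul (ε := ε) (u := u) h1
    rw [mul_inv_cancel_left] at this
    rw [← this]
    exact face_subset_closedFace.trans (closedFace_anti h2)

lemma face_eq_iff {ε : ℤˣ} {u u' : V ≃ₗ[ℝ] V} (hu : u ∈ D.vWeyl)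
    (hu' : u' ∈ D.vWeyl) {J J' : Set ι} :
    face (D.chamberRoot ε u) J = face (D.chamberRoot ε u') J' ↔
      u⁻¹ * u' ∈ D.parabolic J ∧ J' = J := by
  constructor
  · intro h
    obtain ⟨h1, h2⟩ := (face_subset_closedFace_iff hu hu').1 (h.le.trans face_subset_closedFace)
    obtain ⟨_, h3⟩ := (face_subset_closedFace_iff hu' hu).1 (h.ge.trans face_subset_closedFace)
    exact ⟨h1, h2.antisymm h3⟩
  · rintro ⟨h1, rfl⟩
    have := face_chamberRoot_mul (ε := ε) (u := u) h1
    rwa [mul_inv_cancel_left, eq_comm] at this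

lemma IsFacetOfType.image {ε : ℤˣ} {J : Set ι} {F : Set V} (hF : D.IsFacetOfType ε J F)
    {w : V ≃ₗ[ℝ] V} (hw : w ∈ D.vWeyl) : D.IsFacetOfType ε J (w '' F) := by
  rw [isFacetOfType_iff] at hF ⊢
  obtain ⟨u, hu, rfl⟩ := hF
  exact ⟨w * u, mul_mem hw hu, image_face_chamberRoot ..⟩

lemma IsSphericalFacet.image {ε : ℤˣ} {F : Set V} (hF : D.IsSphericalFacet ε F)
    {w : V ≃ₗ[ℝ] V} (hw : w ∈ D.vWeyl) : D.IsSphericalFacet ε (w '' F) := by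
  obtain ⟨J, hJ, hF⟩ := hF
  exact ⟨J, hJ, hF.image hw⟩

lemma IsSphericalFacet.isVFacet {ε : ℤˣ} {F : Set V} (hF : D.IsSphericalFacet ε F) :
    D.IsVFacet F := by
  obtain ⟨J, _, hF⟩ := hF
  exact ⟨ε, J, hF⟩

/-- The type of a facet is unique. -/
lemma IsFacetOfType.type_unique {ε : ℤˣ} {J J' : Set ι} {F : Set V} (h : D.IsFacetOfType ε J F)
    (h' : D.IsFacetOfType ε J' F) : J = J' := by
  rw [isFacetOfType_iff] at h h'
  obtain ⟨u, hu, rfl⟩ := h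
  obtain ⟨u', hu', h'⟩ := h'
  exact ((face_eq_iff hu hu').1 h').2.symm

/-- The fixator of a spherical facet is finite. -/
lemma IsSphericalFacet.finite_fixator {ε : ℤˣ} {F : Set V} (hF : D.IsSphericalFacet ε F) :
    {w : V ≃ₗ[ℝ] V | w ∈ D.vWeyl ∧ ∀ v ∈ F, w v = v}.Finite := by
  obtain ⟨J, hJ, hF⟩ := hF
  rw [isFacetOfType_iff] at hF
  obtain ⟨u, hu, rfl⟩ := hF
  have hfin : ((fun g => u * g * u⁻¹) '' (D.parabolic J : Set (V ≃ₗ[ℝ] V))).Finite :=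
    Finite.image _ hJ
  refine hfin.subset fun w hw => ?_
  obtain ⟨v, hv⟩ := face_nonempty (D.linearIndependent_chamberRoot ε u) J
  -- If `w` fixes `v`, the faces of type `J` of the chambers of `u` and `w u` meet at `v`, which
  -- puts `w` in the conjugate of `W^v(J)` by `u`.
  have h1 : v ∈ face (D.chamberRoot ε (w * u)) J := by
    rw [← image_face_chamberRoot]
    exact ⟨v, hv, hw.2 v hv⟩
  have h2 := (mem_parabolic_of_mem hu (mul_mem hw.1 hu) hv (face_subset_closedFace h1)).1
  exact ⟨_, h2, by group⟩

lemma IsVFacet.nonempty {F : Set V} (hF : D.IsVFacet F) : F.Nonempty := by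
  obtain ⟨ε, J, hF⟩ := hF
  obtain ⟨w, hw, rfl⟩ := isFacetOfType_iff.1 hF
  exact face_nonempty (linearIndependent_chamberRoot ε w) J

lemma IsVFacet.smul_mem {F : Set V} (hF : D.IsVFacet F) {t : ℝ} (ht : 0 < t) {v : V}
    (hv : v ∈ F) : t • v ∈ F := by
  obtain ⟨ε, J, hF⟩ := hF
  obtain ⟨w, hw, rfl⟩ := isFacetOfType_iff.1 hF
  exact smul_mem_face ht hv

lemma IsVFacet.neg {F : Set V} (hF : D.IsVFacet F) : D.IsVFacet (-F) := by
  obtain ⟨ε, J, hF⟩ := hF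
  obtain ⟨w, hw, rfl⟩ := isFacetOfType_iff.1 hF
  refine ⟨-ε, J, isFacetOfType_iff.2 ⟨w, hw, ?_⟩⟩
  ext v
  rw [Set.mem_neg, ← neg_mem_face_chamberRoot, neg_neg]

end Algebra

section Normed

variable {ι V : Type*} [Fintype ι] [NormedAddCommGroup V] [NormedSpace ℝ V]
  [FiniteDimensional ℝ V] {D : VectorialDatum ι V}

lemma closure_face_chamberRoot (ε : ℤˣ) (w : V ≃ₗ[ℝ] V) (J : Set ι) :
    closure (face (D.chamberRoot ε w) J) = closedFace (D.chamberRoot ε w) J :=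
  closure_face (linearIndependent_chamberRoot ε w) J

lemma IsVFacet.add_mem {F : Set V} (hF : D.IsVFacet F) {u v : V} (hu : u ∈ closure F)
    (hv : v ∈ F) : u + v ∈ F := by
  obtain ⟨ε, J, hF⟩ := hF
  obtain ⟨w, hw, rfl⟩ := isFacetOfType_iff.1 hF
  rw [closure_face_chamberRoot] at hu
  exact add_mem_face hu hv

lemma IsVFacet.add_mem_closure {F : Set V} (hF : D.IsVFacet F) {u v : V} (hu : u ∈ closure F)
    (hv : v ∈ closure F) : u + v ∈ closure F := by
  obtain ⟨ε, J, hF⟩ := hF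
  obtain ⟨w, hw, rfl⟩ := isFacetOfType_iff.1 hF
  rw [closure_face_chamberRoot] at *
  exact add_mem_closedFace hu hv

lemma IsVFacet.zero_mem {F : Set V} (hF : D.IsVFacet F) : (0 : V) ∈ closure F := by
  obtain ⟨ε, J, hF⟩ := hF
  obtain ⟨w, hw, rfl⟩ := isFacetOfType_iff.1 hF
  rw [closure_face_chamberRoot]
  exact zero_mem_closedFace

/-- A root has constant sign on each closed chamber, so its sign at one point of a facet controls it
on the whole closed facet. This is how enclosures are handled without knowing the roots explicitly.
-/
lemma IsVFacet.nonneg {F : Set V} (hF : D.IsVFacet F) {f : Module.Dual ℝ V} (hf : f ∈ D.roots)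
    {u v : V} (hv : v ∈ F) (h : 0 ≤ f v) (hu : u ∈ closure F) : 0 ≤ f u := by
  obtain ⟨ε, J, hF⟩ := hF
  obtain ⟨w, hw, rfl⟩ := isFacetOfType_iff.1 hF
  rw [closure_face_chamberRoot] at hu
  exact nonneg_on_closedFace (isPosComb_or_neg hf ε hw) hv h hu

/-- Two facets of the same sign that are contained in the closure of each other are equal. -/
lemma IsFacetOfType.eq_of_subset_closure {ε : ℤˣ} {J J' : Set ι} {F G : Set V}
    (hF : D.IsFacetOfType ε J F) (hG : D.IsFacetOfType ε J' G) (h : F ⊆ closure G)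
    (h' : G ⊆ closure F) : F = G := by
  obtain ⟨u, hu, rfl⟩ := isFacetOfType_iff.1 hF
  obtain ⟨u', hu', rfl⟩ := isFacetOfType_iff.1 hG
  rw [closure_face_chamberRoot] at h h'
  obtain ⟨h1, h2⟩ := (face_subset_closedFace_iff hu hu').1 h
  obtain ⟨_, h3⟩ := (face_subset_closedFace_iff hu' hu).1 h'
  exact (face_eq_iff hu hu').2 ⟨h1, h2.antisymm h3⟩

/-- The facets of given type in the closure of a facet are unique. -/
lemma IsFacetOfType.eq_of_subset_closure_of_type {ε : ℤˣ} {J J' : Set ι} {F F' G : Set V}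
    (hF : D.IsFacetOfType ε J F) (hF' : D.IsFacetOfType ε J F') (hG : D.IsFacetOfType ε J' G)
    (h : F ⊆ closure G) (h' : F' ⊆ closure G) : F = F' := by
  obtain ⟨u, hu, rfl⟩ := isFacetOfType_iff.1 hF
  obtain ⟨u', hu', rfl⟩ := isFacetOfType_iff.1 hF'
  obtain ⟨x, hx, rfl⟩ := isFacetOfType_iff.1 hG
  rw [closure_face_chamberRoot] at h h'
  obtain ⟨h1, _⟩ := (face_subset_closedFace_iff hu hx).1 h
  obtain ⟨h2, _⟩ := (face_subset_closedFace_iff hu' hx).1 h'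
  refine (face_eq_iff hu hu').2 ⟨?_, rfl⟩
  have := mul_mem h1 (inv_mem h2)
  rwa [mul_inv_rev, inv_inv, mul_assoc, mul_inv_cancel_left] at this

end Normed

end VectorialDatum

/-! ## Spherical facets lie in the interior of the Tits cone -/

namespace VectorialDatum

open SimpleRoots

variable {ι V : Type*} [Fintype ι]

/-- If `W^v(J)` is finite, every orbit of it meets the dominant cone of `J`. -/
lemma IsSpherical.exists_dominant [AddCommGroup V] [Module ℝ V] [FiniteDimensional ℝ V]
    {D : VectorialDatum ι V} {J : Set ι} (hJ : D.IsSpherical J) (u : V) :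
    ∃ g ∈ D.parabolic J, ∀ j ∈ J, 0 ≤ D.root j (g u) := by
  have : Finite (D.parabolic J) := hJ
  let _ := Fintype.ofFinite (D.parabolic J)
  let b := Module.finBasis ℝ V
  -- Averaging an arbitrary scalar product over the finite group `W^v(J)` gives an invariant one.
  let B₀ : V → V → ℝ := fun x y => ∑ k, b.repr x k * b.repr y k
  let B : V → V → ℝ := fun x y => ∑ g : D.parabolic J, B₀ (g.1 x) (g.1 y)
  have B_inv : ∀ h ∈ D.parabolic J, ∀ x y, B (h x) (h y) = B x y := fun h hh x y =>
    Fintype.sum_equiv (Equiv.mulRight (⟨h, hh⟩ : D.parabolic J)) _ _ fun g => rfl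
  have B_sub : ∀ x x' y (t : ℝ), B (x - t • x') y = B x y - t * B x' y := fun x x' y t => by
    simp only [B, B₀, map_sub, map_smul, Finsupp.sub_apply, Finsupp.smul_apply, smul_eq_mul,
      Finset.mul_sum, ← Finset.sum_sub_distrib]
    exact Finset.sum_congr rfl fun _ _ => Finset.sum_congr rfl fun _ _ => by ring
  have B_comm : ∀ x y, B x y = B y x := fun x y =>
    Finset.sum_congr rfl fun _ _ => Finset.sum_congr rfl fun _ _ => mul_comm _ _
  have B_pos : ∀ x, x ≠ 0 → 0 < B x x := fun x hx => by
    have h0 : ∀ y, 0 ≤ B₀ y y := fun y => Finset.sum_nonneg fun k _ => mul_self_nonneg _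
    refine Finset.sum_pos' (fun g _ => h0 _) ⟨1, Finset.mem_univ _, ?_⟩
    refine lt_of_le_of_ne (h0 _) fun h => hx ?_
    have h1 := (Finset.sum_eq_zero_iff_of_nonneg fun k _ => mul_self_nonneg _).1 h.symm
    exact b.repr.map_eq_zero_iff.1
      (Finsupp.ext fun k => mul_self_eq_zero.1 (h1 k (Finset.mem_univ k)))
  -- The point `c` lies in the open fundamental chamber. The point of the orbit of `u` having the
  -- largest product with `c` is dominant for `J`: if some `αⱼ` were negative there, reflecting by
  -- `rⱼ` would increase the product.
  obtain ⟨c, hc⟩ := D.root_free.exists_dual_apply_eq fun _ => 1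
  obtain ⟨g, hg⟩ := Finite.exists_max fun g : D.parabolic J => B (g.1 u) c
  refine ⟨g, g.2, fun j hj => ?_⟩
  have hr : D.refl j ∈ D.parabolic J := Subgroup.subset_closure ⟨j, hj, rfl⟩
  have hne : D.coroot j ≠ 0 := fun h => by
    have := D.root_coroot j
    simp [h] at this
  -- Invariance under `rⱼ` gives `2 B(αⱼ^∨, c) = αⱼ(c) B(αⱼ^∨, αⱼ^∨)`, and `αⱼ(c) = 1`.
  have h1 : 0 < B (D.coroot j) c := by
    have h2 := B_inv _ hr (D.coroot j) c
    have h3 : D.refl j (D.coroot j) = (0 : V) - (1 : ℝ) • D.coroot j := by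
      rw [refl_apply, D.root_coroot]; module
    have h4 : B 0 (D.refl j c) = 0 := by simp [B, B₀]
    rw [h3, B_sub, h4, B_comm, refl_apply, hc, B_sub, B_comm c] at h2
    have := B_pos _ hne
    linarith
  have h5 := hg (⟨_, hr⟩ * g)
  have h6 : ((⟨_, hr⟩ * g : D.parabolic J) : V ≃ₗ[ℝ] V) u = D.refl j (g.1 u) := rfl
  simp only [h6] at h5
  rw [refl_apply, B_sub] at h5
  by_contra hlt
  have := mul_neg_of_neg_of_pos (not_le.1 hlt) h1
  linarith

/-- The translates of a point far away in the direction of a spherical facet lie in a facet. -/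
lemma IsSphericalFacet.exists_add_smul_mem [AddCommGroup V] [Module ℝ V] [FiniteDimensional ℝ V]
    {D : VectorialDatum ι V} {ε : ℤˣ} {F : Set V} (hF : D.IsSphericalFacet ε F) {v : V}
    (hv : v ∈ F) (u : V) : ∃ t : ℝ, 0 < t ∧ ∃ F₁, D.IsVFacet F₁ ∧ u + t • v ∈ F₁ := by
  obtain ⟨J, hJ, hF⟩ := hF
  obtain ⟨w, hw, rfl⟩ := isFacetOfType_iff.1 hF
  rw [mem_face_chamberRoot] at hv
  obtain ⟨g, hg, hdom⟩ := IsSpherical.exists_dominant hJ (((ε : ℤ) : ℝ) • w⁻¹ u)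
  set v' := ((ε : ℤ) : ℝ) • w⁻¹ v
  set u' := ((ε : ℤ) : ℝ) • w⁻¹ u
  -- The element `g` fixes `v'` and makes the forms of `J` nonnegative at `g u'`; the other forms
  -- are positive at `v'`, so a large multiple of `v'` makes them nonnegative too. A dominant point
  -- lies in the facet whose type is the set of simple roots vanishing at it.
  have h1 : ∀ᶠ t : ℝ in atTop, ∀ i, i ∉ J → 0 ≤ D.root i (g u') + t * D.root i v' := by
    rw [eventually_all]
    intro i
    by_cases hi : i ∈ J
    · simp [hi]
    · have : Tendsto (fun t : ℝ => D.root i (g u') + t * D.root i v') atTop atTop :=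
        tendsto_atTop_add_const_left _ _ (tendsto_id.atTop_mul_const (hv.2 i hi))
      filter_upwards [this.eventually_ge_atTop 0] with t ht _ using ht
  obtain ⟨t, ht, ht0⟩ := (h1.and (eventually_gt_atTop 0)).exists
  refine ⟨t, ht0, face (D.chamberRoot ε (w * g⁻¹)) {i | D.root i (g (u' + t • v')) = 0},
    ⟨ε, _, isFacetOfType_iff.2 ⟨_, mul_mem hw (inv_mem (D.parabolic_le J hg)), rfl⟩⟩, ?_⟩
  have h2 : ((ε : ℤ) : ℝ) • (w * g⁻¹)⁻¹ (u + t • v) = g (u' + t • v') := by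
    rw [mul_inv_rev, inv_inv, LinearEquiv.mul_apply, ← map_smul]
    congr 1
    simp only [u', v', map_add, map_smul, smul_add]
    rw [smul_comm]
  rw [mem_face_chamberRoot, h2]
  refine ⟨fun i hi => hi, fun i hi => lt_of_le_of_ne ?_ (Ne.symm hi)⟩
  have h3 : D.root i (g (u' + t • v')) = D.root i (g u') + t * D.root i v' := by
    rw [map_add g, map_smul g t, parabolic_fixes hv hg, map_add, map_smul (D.root i) t, smul_eq_mul]
  rw [h3]
  by_cases hiJ : i ∈ J
  · rw [hv.1 i hiJ, mul_zero, add_zero]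
    exact hdom i hiJ
  · exact ht i hiJ

end VectorialDatum

/-! ## Filters in the model apartment -/

namespace ModelApartment

open VectorialDatum SimpleRoots

section Algebra

variable {V : Type*} [AddCommGroup V]

lemma mem_add_pure_add_principal {B : Filter V} {ξ : V} {F S : Set V} :
    S ∈ B + pure ξ + 𝓟 F ↔ ∃ b ∈ B, ∀ x ∈ b, ∀ v ∈ F, x + ξ + v ∈ S := by
  constructor
  · intro h
    obtain ⟨t, ht, G, hG, hsub⟩ := Filter.mem_add.1 h
    obtain ⟨b, hb, p, hp, hsub'⟩ := Filter.mem_add.1 ht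
    exact ⟨b, hb, fun x hx v hv => hsub (add_mem_add (hsub' (add_mem_add hx hp)) (hG hv))⟩
  · rintro ⟨b, hb, h⟩
    refine Filter.mem_add.2 ⟨b + {ξ}, Filter.add_mem_add hb (mem_pure.2 rfl), F,
      mem_principal_self F, ?_⟩
    rintro _ ⟨_, ⟨x, hx, _, rfl, rfl⟩, v, hv, rfl⟩
    exact h x hx v hv

lemma mem_add_principal {B : Filter V} {F S : Set V} :
    S ∈ B + 𝓟 F ↔ ∃ b ∈ B, ∀ x ∈ b, ∀ v ∈ F, x + v ∈ S := by
  constructor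
  · intro h
    obtain ⟨b, hb, G, hG, hsub⟩ := Filter.mem_add.1 h
    exact ⟨b, hb, fun x hx v hv => hsub (add_mem_add hx (hG hv))⟩
  · rintro ⟨b, hb, h⟩
    refine Filter.mem_add.2 ⟨b, hb, F, mem_principal_self F, ?_⟩
    rintro _ ⟨x, hx, v, hv, rfl⟩
    exact h x hx v hv

variable {ι : Type*} [Fintype ι] [Module ℝ V] {𝔸 : ModelApartment ι V}

lemma cl_mono {F G : Filter V} (h : F ≤ G) : 𝔸.cl F ≤ 𝔸.cl G := by
  rintro S ⟨k, hk, hG, hS⟩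
  exact ⟨k, hk, h hG, hS⟩

lemma le_cl (F : Filter V) : F ≤ 𝔸.cl F := by
  rintro S ⟨k, hk, hF, hS⟩
  exact mem_of_superset hF hS

/-- The elements of the affine Weyl group are affine maps with linear part in `W^v`. -/
lemma exists_linear_of_mem_weyl {w : Equiv.Perm V} (hw : w ∈ 𝔸.weyl) :
    ∃ u ∈ 𝔸.vWeyl, ∀ x v, w (x + v) = w x + u v := by
  induction hw using Subgroup.closure_induction with
  | mem g hg =>
    obtain ⟨α, a, k, ⟨u, hu, i, rfl, rfl⟩, _, hg⟩ := hg
    refine ⟨u * 𝔸.refl i * u⁻¹, mul_mem (mul_mem hu (𝔸.refl_mem i)) (inv_mem hu), fun x v => ?_⟩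
    have h1 : (u * 𝔸.refl i * u⁻¹) v = v - act u (𝔸.root i) v • u (𝔸.coroot i) := by
      rw [LinearEquiv.mul_apply, LinearEquiv.mul_apply, refl_apply, map_sub, map_smul, act_apply]
      congr 1
      exact u.apply_symm_apply v
    rw [h1, hg, hg, map_add]
    module
  | one => exact ⟨1, one_mem _, fun x v => rfl⟩
  | mul x y _ _ hx hy =>
    obtain ⟨u, hu, hx⟩ := hx
    obtain ⟨u', hu', hy⟩ := hy
    refine ⟨u * u', mul_mem hu hu', fun z v => ?_⟩
    rw [Equiv.Perm.mul_apply, hy, hx]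
    rfl
  | inv x _ hx =>
    obtain ⟨u, hu, hx⟩ := hx
    refine ⟨u⁻¹, inv_mem hu, fun z v => x.injective ?_⟩
    rw [hx, Equiv.Perm.inv_def, Equiv.apply_symm_apply, Equiv.apply_symm_apply]
    congr 1
    exact (u.apply_symm_apply v).symm

end Algebra

variable {ι V : Type*} [Fintype ι] [NormedAddCommGroup V] [NormedSpace ℝ V]
  [FiniteDimensional ℝ V] {𝔸 : ModelApartment ι V} {F G : Set V} {x y : V}

/-- The shortenings by `ξ` and by `η` both contain the one by `ξ + η`, because `closure F + F ⊆ F`.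
The family is thus directed, and one shortening suffices to test membership. -/
lemma mem_sectorFaceGerm (hF : 𝔸.IsVFacet F) {S : Set V} :
    S ∈ sectorFaceGerm x F ↔ ∃ ξ ∈ closure F, ∀ v ∈ F, x + ξ + v ∈ S := by
  unfold sectorFaceGerm
  rw [mem_biInf_of_directed]
  · simp only [mem_principal, subset_def, forall_mem_image]
  · intro ξ hξ η hη
    refine ⟨ξ + η, hF.add_mem_closure hξ hη, ?_, ?_⟩
    · simp only [ge_iff_le, Order.Preimage, principal_mono]
      rintro _ ⟨v, hv, rfl⟩
      exact ⟨η + v, hF.add_mem hη hv, by simp only; abel⟩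
    · simp only [ge_iff_le, Order.Preimage, principal_mono]
      rintro _ ⟨v, hv, rfl⟩
      exact ⟨ξ + v, hF.add_mem hξ hv, by simp only; abel⟩
  · exact ⟨0, hF.zero_mem⟩

lemma mem_chimneyGerm {B : Filter V} (hF : 𝔸.IsVFacet F) {S : Set V} :
    S ∈ 𝔸.chimneyGerm B F ↔ ∃ ξ ∈ closure F, S ∈ 𝔸.cl (B + pure ξ + 𝓟 F) := by
  unfold chimneyGerm
  rw [mem_biInf_of_directed]
  · intro ξ hξ η hη
    refine ⟨ξ + η, hF.add_mem_closure hξ hη, ?_, ?_⟩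
    · refine cl_mono fun S hS => ?_
      obtain ⟨b, hb, h⟩ := mem_add_pure_add_principal.1 hS
      refine mem_add_pure_add_principal.2 ⟨b, hb, fun x hx v hv => ?_⟩
      have := h x hx (η + v) (hF.add_mem hη hv)
      rwa [← add_assoc, add_assoc x] at this
    · refine cl_mono fun S hS => ?_
      obtain ⟨b, hb, h⟩ := mem_add_pure_add_principal.1 hS
      refine mem_add_pure_add_principal.2 ⟨b, hb, fun x hx v hv => ?_⟩
      have := h x hx (ξ + v) (hF.add_mem hξ hv)
      rwa [← add_assoc, add_assoc x, add_comm η] at this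
  · exact ⟨0, hF.zero_mem⟩

lemma sectorFaceGerm_add (hF : 𝔸.IsVFacet F) {ξ : V} (hξ : ξ ∈ closure F) :
    sectorFaceGerm (x + ξ) F = sectorFaceGerm x F := by
  ext S
  rw [mem_sectorFaceGerm hF, mem_sectorFaceGerm hF]
  constructor
  · rintro ⟨η, hη, h⟩
    exact ⟨ξ + η, hF.add_mem_closure hξ hη, fun v hv => by rw [← add_assoc]; exact h v hv⟩
  · rintro ⟨η, hη, h⟩
    refine ⟨η, hη, fun v hv => ?_⟩
    have := h (ξ + v) (hF.add_mem hξ hv)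
    rwa [show x + η + (ξ + v) = x + ξ + η + v by abel] at this

/-- For every `v ∈ G`, the vector `t⁻¹ v` plus a constant lies in the cone `F`; multiplying by `t`
and letting `t` tend to `0` puts `v` in the closure. -/
lemma subset_closure_of_sectorFaceGerm_le (hF : 𝔸.IsVFacet F) (hG : 𝔸.IsVFacet G)
    (h : sectorFaceGerm y G ≤ sectorFaceGerm x F) : G ⊆ closure F := by
  have h1 : (fun v => x + v) '' F ∈ sectorFaceGerm x F :=
    (mem_sectorFaceGerm hF).2 ⟨0, hF.zero_mem, fun v hv => ⟨v, hv, by simp⟩⟩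
  obtain ⟨ξ, hξ, h2⟩ := (mem_sectorFaceGerm hG).1 (h h1)
  intro v hv
  have hlim : Tendsto (fun t : ℝ => v + t • (y + ξ - x)) (𝓝[>] 0) (𝓝 v) := by
    have : Continuous fun t : ℝ => v + t • (y + ξ - x) := by fun_prop
    have h := this.tendsto 0
    simp only [zero_smul, add_zero] at h
    exact h.mono_left nhdsWithin_le_nhds
  refine mem_closure_of_tendsto hlim ?_
  filter_upwards [self_mem_nhdsWithin] with t ht
  obtain ⟨f, hf, he⟩ := h2 (t⁻¹ • v) (hG.smul_mem (inv_pos.2 ht) hv)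
  simp only at he
  have : f = y + ξ - x + t⁻¹ • v := by
    rw [eq_comm, ← sub_eq_zero] at he ⊢
    rw [← he]; abel
  have h3 := hF.smul_mem ht hf
  rwa [this, smul_add, smul_smul, mul_inv_cancel₀ (ne_of_gt ht), one_smul, add_comm] at h3

/-- Equal germs give inclusions in the closure both ways, and facets of the same sign with this
property coincide. -/
lemma direction_unique {ε : ℤˣ} (hF : 𝔸.IsSphericalFacet ε F) (hG : 𝔸.IsSphericalFacet ε G)
    (h : sectorFaceGerm x F = sectorFaceGerm y G) : F = G := by
  have h1 := subset_closure_of_sectorFaceGerm_le hG.isVFacet hF.isVFacet h.le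
  have h2 := subset_closure_of_sectorFaceGerm_le hF.isVFacet hG.isVFacet h.ge
  obtain ⟨_, _, hF⟩ := hF
  obtain ⟨_, _, hG⟩ := hG
  exact hF.eq_of_subset_closure hG h1 h2

lemma image_closure_linearEquiv (u : V ≃ₗ[ℝ] V) (F : Set V) : u '' closure F = closure (u '' F) :=
  u.toContinuousLinearEquiv.toHomeomorph.image_closure F

lemma map_sectorFaceGerm (hF : 𝔸.IsVFacet F) {w : V → V} {u : V ≃ₗ[ℝ] V} (hu : u ∈ 𝔸.vWeyl)
    (hw : ∀ x v, w (x + v) = w x + u v) :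
    map w (sectorFaceGerm x F) = sectorFaceGerm (w x) (u '' F) := by
  have hF' : 𝔸.IsVFacet (u '' F) := by
    obtain ⟨ε, J, h⟩ := hF
    exact ⟨ε, J, h.image hu⟩
  ext S
  rw [mem_map, mem_sectorFaceGerm hF, mem_sectorFaceGerm hF', ← image_closure_linearEquiv]
  simp [mem_preimage, hw]

/-- The enclosure of a ray with direction in a facet contains the sector face. -/
lemma forall_add_mem_of_ray (hF : 𝔸.IsVFacet F) {v : V} (hv : v ∈ F)
    {k : Module.Dual ℝ V → WithTop ℝ}
    (h : ∀ t : ℝ, 0 ≤ t → x + t • v ∈ 𝔸.halfSpaceInter k ∅) {u : V} (hu : u ∈ closure F) :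
    x + u ∈ 𝔸.halfSpaceInter k ∅ := by
  intro α hα r hr
  refine ⟨?_, fun h => h.elim⟩
  have h1 : ∀ t : ℝ, 0 ≤ t → 0 ≤ α x + t * α v + r := fun t ht => by
    simpa using (h t ht α hα r hr).1
  have h0 := h1 0 le_rfl
  -- A root bounded below along the ray cannot decrease on it: at the parameter chosen here, `α + r`
  -- would take the value `-1`.
  have h2 : 0 ≤ α v := by
    by_contra hneg
    rw [not_le] at hneg
    have h3 := h1 ((α x + r + 1) / (-α v)) (div_nonneg (by linarith) (by linarith))
    have h4 : (α x + r + 1) / (-α v) * α v = -(α x + r + 1) := by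
      rw [div_mul_eq_mul_div, mul_div_assoc, div_neg, div_self hneg.ne, mul_neg_one]
    rw [h4] at h3
    linarith
  have h3 := hF.nonneg hα hv h2 hu
  rw [map_add]
  linarith

/-- An enclosed set containing a sector face is stable under translations in its direction. -/
lemma add_mem_halfSpaceInter (hF : 𝔸.IsVFacet F) {k : Module.Dual ℝ V → WithTop ℝ}
    (h : ∀ v ∈ F, x + v ∈ 𝔸.halfSpaceInter k ∅) (hy : y ∈ 𝔸.halfSpaceInter k ∅)
    {u : V} (hu : u ∈ closure F) : y + u ∈ 𝔸.halfSpaceInter k ∅ := by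
  intro α hα r hr
  refine ⟨?_, fun h => h.elim⟩
  obtain ⟨v, hv⟩ := hF.nonempty
  have h1 : ∀ t : ℝ, 0 < t → 0 ≤ α x + t * α v + r := fun t ht => by
    simpa using (h _ (hF.smul_mem ht hv) α hα r hr).1
  have h2 : 0 ≤ α v := by
    by_contra hneg
    rw [not_le] at hneg
    -- The point `x` itself is not known to lie in the set, so `α x + r` has no known sign; the
    -- absolute value keeps the parameter positive.
    have h3 := h1 ((|α x + r| + 1) / (-α v)) (div_pos (by positivity) (by linarith))
    have h4 : (|α x + r| + 1) / (-α v) * α v = -(|α x + r| + 1) := by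
      rw [div_mul_eq_mul_div, mul_div_assoc, div_neg, div_self hneg.ne, mul_neg_one]
    rw [h4] at h3
    linarith [le_abs_self (α x + r)]
  have h3 := hF.nonneg hα hv h2 hu
  have h4 := (hy α hα r hr).1
  rw [map_add]
  linarith

lemma isClosed_halfSpaceInter (k : Module.Dual ℝ V → WithTop ℝ) :
    IsClosed (𝔸.halfSpaceInter k ∅) := by
  have : 𝔸.halfSpaceInter k ∅ =
      ⋂ α ∈ 𝔸.roots, ⋂ r : ℝ, ⋂ (_ : k α = r), {x | 0 ≤ α x + r} := by
    ext x; simp [halfSpaceInter]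
  rw [this]
  refine isClosed_biInter fun α _ => isClosed_iInter fun r => isClosed_iInter fun _ =>
    isClosed_le continuous_const ?_
  exact (α.continuous_of_finiteDimensional).add continuous_const

/-- The enclosure of `x + F^v` contains the germ of the chimney with base `F(x, F^v)`. -/
lemma chimneyGerm_le_cl (hF : 𝔸.IsVFacet F) :
    𝔸.chimneyGerm (𝔸.facet x F) F ≤ 𝔸.cl (𝓟 ((fun v => x + v) '' F)) := by
  rintro S ⟨k, hk, hE, hS⟩
  have hE' : ∀ v ∈ F, x + v ∈ 𝔸.halfSpaceInter k ∅ := fun v hv => hE ⟨v, hv, rfl⟩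
  -- No shortening is needed: the enclosed set is itself an element of the base facet, and it is
  -- stable under translation by `F`.
  refine (mem_chimneyGerm hF).2 ⟨0, hF.zero_mem, k, hk, ?_, hS⟩
  refine mem_add_pure_add_principal.2 ⟨𝔸.halfSpaceInter k ∅, ?_, fun y hy v hv => ?_⟩
  · exact ⟨k, ∅, hk, mem_of_superset self_mem_nhdsWithin hE, Subset.rfl⟩
  · rw [add_zero]
    exact add_mem_halfSpaceInter hF hE' hy (subset_closure hv)

/-- An enclosed set containing `b + ξ + F^v`, for an element `b` of the facet `F(x, F₁)`, contains
the sector faces based at points close to `x + ξ` in the direction of `F₁`. -/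
lemma exists_forall_add_mem {F₁ : Set V} (hF₁ : 𝔸.IsVFacet F₁) {η ξ : V} (hη : η ∈ F₁)
    {b : Set V} (hb : b ∈ 𝔸.facet x F₁) {k : Module.Dual ℝ V → WithTop ℝ}
    (h : ∀ y ∈ b, ∀ v ∈ F, y + ξ + v ∈ 𝔸.halfSpaceInter k ∅) :
    ∃ δ > 0, ∀ s : ℝ, 0 ≤ s → s < δ → ∀ v ∈ F, x + s • η + ξ + v ∈ 𝔸.halfSpaceInter k ∅ := by
  obtain ⟨k', o', _, hb', hbsub⟩ := hb
  have hb1 : b ∈ localFacet x F₁ := mem_of_superset hb' hbsub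
  have hlim : Tendsto (fun s : ℝ => x + s • η) (𝓝[>] 0) (localFacet x F₁) := by
    refine tendsto_nhdsWithin_iff.2 ⟨?_, ?_⟩
    · have : Continuous fun s : ℝ => x + s • η := by fun_prop
      have h := this.tendsto 0
      simp only [zero_smul, add_zero] at h
      exact h.mono_left nhdsWithin_le_nhds
    · filter_upwards [self_mem_nhdsWithin] with s hs
      exact ⟨s • η, hF₁.smul_mem hs hη, rfl⟩
  obtain ⟨δ, hδ, hδ'⟩ := (mem_nhdsGT_iff_exists_Ioo_subset.1 (hlim hb1))
  refine ⟨δ, hδ, fun s hs hsδ v hv => ?_⟩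
  -- The point `x` need not belong to `b`; the parameter `0` is reached because enclosed sets are
  -- closed.
  rcases hs.eq_or_lt with rfl | hs
  · have hlim' : Tendsto (fun s : ℝ => x + s • η + ξ + v) (𝓝[>] 0)
        (𝓝 (x + (0 : ℝ) • η + ξ + v)) := by
      have : Continuous fun s : ℝ => x + s • η + ξ + v := by fun_prop
      exact (this.tendsto 0).mono_left nhdsWithin_le_nhds
    refine (isClosed_halfSpaceInter k).mem_of_tendsto hlim' ?_
    filter_upwards [Ioo_mem_nhdsGT hδ] with s hs
    exact h _ (hδ' hs) v hv
  · exact h _ (hδ' ⟨hs, hsδ⟩) v hv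

/-- A set containing the germ of a chimney with base `F(x, F₁)` contains the germs of the sector
faces with the same direction based at points close to `x` in the direction of `F₁`. -/
lemma exists_mem_sectorFaceGerm_of_mem_chimneyGerm (hF : 𝔸.IsVFacet F) {F₁ : Set V}
    (hF₁ : 𝔸.IsVFacet F₁) {η : V} (hη : η ∈ F₁) {S : Set V}
    (hS : S ∈ 𝔸.chimneyGerm (𝔸.facet x F₁) F) :
    ∃ δ > 0, ∀ s : ℝ, 0 ≤ s → s < δ → S ∈ sectorFaceGerm (x + s • η) F := by
  obtain ⟨ξ, hξ, k, hk, hE, hsub⟩ := (mem_chimneyGerm hF).1 hS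
  obtain ⟨b, hb, h⟩ := mem_add_pure_add_principal.1 hE
  obtain ⟨δ, hδ, hδ'⟩ := exists_forall_add_mem hF₁ hη hb h
  exact ⟨δ, hδ, fun s hs hsδ =>
    (mem_sectorFaceGerm hF).2 ⟨ξ, hξ, fun v hv => hsub (hδ' s hs hsδ v hv)⟩⟩

lemma sectorFaceGerm_le_chimneyGerm (hF : 𝔸.IsVFacet F) {F₁ : Set V} (hF₁ : 𝔸.IsVFacet F₁) :
    sectorFaceGerm x F ≤ 𝔸.chimneyGerm (𝔸.facet x F₁) F := by
  intro S hS
  obtain ⟨η, hη⟩ := hF₁.nonempty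
  obtain ⟨δ, hδ, h⟩ := exists_mem_sectorFaceGerm_of_mem_chimneyGerm hF hF₁ hη hS
  simpa using h 0 le_rfl hδ

/-- The chimney with base `F(x, F^v)` and direction `F^v` is solid if `F^v` is spherical. -/
lemma hasFiniteFixator_chimney {ε : ℤˣ} (hF : 𝔸.IsSphericalFacet ε F) :
    𝔸.HasFiniteFixator (𝔸.chimney (𝔸.facet x F) F) := by
  have hF' := hF.isVFacet
  refine hF.finite_fixator.subset fun w hw => ⟨hw.1, fun v hv => hw.2 v ?_⟩
  -- The support contains `x + F`. Its direction contains `2v - v = v` for `v ∈ F`, so whatever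
  -- fixes this direction fixes `F`.
  have key : ∀ v ∈ F, x + v ∈ supp (𝔸.chimney (𝔸.facet x F) F) := by
    intro v hv
    refine (AffineSubspace.mem_sInf_iff _ _).2 fun E hE => ?_
    obtain ⟨k, hk, hb, hS⟩ := hE
    obtain ⟨b, hb, h⟩ := mem_add_principal.1 hb
    obtain ⟨δ, hδ, h'⟩ := exists_forall_add_mem (ξ := 0) hF' hv hb
      fun y hy v hv => by rw [add_zero]; exact h y hy v hv
    simpa using hS (h' 0 le_rfl hδ v hv)
  have h1 := AffineSubspace.vsub_mem_direction (key _ (hF'.smul_mem two_pos hv)) (key v hv)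
  simpa [two_smul] using h1

end ModelApartment

/-! ## Germs of sector faces in a hovel -/

namespace ModelApartment

open VectorialDatum SimpleRoots

variable {ι V : Type*} [Fintype ι] [NormedAddCommGroup V] [NormedSpace ℝ V]
  [FiniteDimensional ℝ V] {𝔸 : ModelApartment ι V} {F G : Set V} {x y : V}

/-- The enclosure of a sector face contains its closure. -/
lemma add_mem_of_mem_cl {S : Set V} (hS : S ∈ 𝔸.cl (𝓟 ((fun v => x + v) '' F))) {u : V}
    (hu : u ∈ closure F) : x + u ∈ S := by
  obtain ⟨k, hk, hE, hS⟩ := hS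
  refine hS ?_
  have h1 : closure ((fun v => x + v) '' F) ⊆ 𝔸.halfSpaceInter k ∅ :=
    closure_minimal hE (isClosed_halfSpaceInter k)
  refine h1 ?_
  have := (Homeomorph.addLeft x).image_closure F
  exact this.le ⟨u, hu, rfl⟩

/-- A root bounded below on the ray is nonnegative on `F`, so an enclosed set containing the ray
contains the sector face. This turns (MA2) for rays into a statement about sector faces. -/
lemma cl_sector_le_cl_ray (hF : 𝔸.IsVFacet F) {v : V} (hv : v ∈ F) :
    𝔸.cl (𝓟 ((fun v => x + v) '' F)) ≤
      𝔸.cl (𝓟 ((fun t : ℝ => x + t • (x + v - x)) '' Ici 0)) := by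
  rintro S ⟨k, hk, hE, hS⟩
  refine ⟨k, hk, ?_, hS⟩
  rintro _ ⟨u, hu, rfl⟩
  refine forall_add_mem_of_ray hF hv (fun t ht => hE ⟨t, ht, ?_⟩) (subset_closure hu)
  simp

end ModelApartment

namespace AffineHovel

open ModelApartment VectorialDatum SimpleRoots

variable {ι V : Type*} [Fintype ι] [NormedAddCommGroup V] [NormedSpace ℝ V]
  {𝔸 : ModelApartment ι V} {X : Type*} {H : AffineHovel 𝔸 X}
  {F G : Set V} {x y : V} {f g : V → X} {ε : ℤˣ}

lemma exists_weyl_of_range_eq (hf : f ∈ H.charts) (hg : g ∈ H.charts) (h : range g = range f) :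
    ∃ w ∈ 𝔸.weyl, g = f ∘ w := (H.charts_orbit f hf g).1 ⟨hg, h⟩

variable (H) in
/-- In some apartment the directions of the germs `𝔉`, `𝔊` are in the relation `ρ`. -/
def InPosition (ε : ℤˣ) (ρ : Set V → Set V → Prop) (𝔉 𝔊 : Filter X) : Prop :=
  ∃ f ∈ H.charts, ∃ x y F G, 𝔸.IsSphericalFacet ε F ∧ 𝔸.IsSphericalFacet ε G ∧
    𝔉 = map f (sectorFaceGerm x F) ∧ 𝔊 = map f (sectorFaceGerm y G) ∧ ρ F G

variable (𝔸) in
/-- The relation `ρ` is invariant under `W^v`. -/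
def IsInvariant (ρ : Set V → Set V → Prop) : Prop :=
  ∀ u ∈ 𝔸.vWeyl, ∀ F G, ρ F G → ρ (u '' F) (u '' G)

lemma InPosition.flip {ρ : Set V → Set V → Prop} {𝔉 𝔊 : Filter X}
    (h : H.InPosition ε ρ 𝔉 𝔊) : H.InPosition ε (flip ρ) 𝔊 𝔉 := by
  obtain ⟨f, hf, x, y, F, G, hF, hG, h1, h2, h3⟩ := h
  exact ⟨f, hf, y, x, G, F, hG, hF, h2, h1, h3⟩

lemma parallel_iff {𝔉 𝔊 : H.FaceGerm ε} :
    H.Parallel ε 𝔉 𝔊 ↔ H.InPosition ε Eq 𝔉.1 𝔊.1 := by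
  constructor
  · rintro ⟨f, hf, x, y, F, hF, h1, h2⟩
    exact ⟨f, hf, x, y, F, F, hF, hF, h1, h2, rfl⟩
  · rintro ⟨f, hf, x, y, F, G, hF, hG, h1, h2, rfl⟩
    exact ⟨f, hf, x, y, F, hF, h1, h2⟩

lemma dominates_iff {𝔉 𝔊 : H.FaceGerm ε} :
    H.Dominates ε 𝔉 𝔊 ↔ H.InPosition ε (fun F G => G ⊆ closure F) 𝔉.1 𝔊.1 := Iff.rfl

lemma isInvariant_eq : IsInvariant 𝔸 Eq := fun _ _ _ _ h => h ▸ rfl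

lemma IsInvariant.flip {ρ : Set V → Set V → Prop} (hρ : IsInvariant 𝔸 ρ) :
    IsInvariant 𝔸 (flip ρ) := fun u hu F G h => hρ u hu G F h

variable [FiniteDimensional ℝ V]

/-- If an apartment contains the germ of a spherical sector face, it contains the enclosure of a
smaller sector face, and there is an isomorphism fixing it. -/
lemma exists_chart_fixing_sector (hf : f ∈ H.charts) (hg : g ∈ H.charts)
    (hF : 𝔸.IsSphericalFacet ε F) (h : range g ∈ map f (sectorFaceGerm x F)) :
    ∃ ξ ∈ closure F, range g ∈ map f (𝔸.cl (𝓟 ((fun v => x + ξ + v) '' F))) ∧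
      ∃ g' ∈ H.charts, range g' = range g ∧
        ∀ᶠ v in 𝔸.cl (𝓟 ((fun v => x + ξ + v) '' F)), g' v = f v := by
  have hF' := hF.isVFacet
  obtain ⟨ξ, hξ, h⟩ := (mem_sectorFaceGerm hF').1 h
  -- A ray needs a nonzero direction. If `F = {0}`, the sector face is a point, which (MA2) also
  -- covers.
  by_cases hne : ∃ v ∈ F, v ≠ 0
  · obtain ⟨v, hv, hv0⟩ := hne
    -- Only `x + ξ + F` is known to lie in the apartment of `g`, perhaps not `x + ξ`; hence the ray
    -- starts at `x + ξ + v`.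
    obtain ⟨h1, g', hg', hr, h2⟩ := H.ma2 f hf
      (𝓟 ((fun t : ℝ => x + (ξ + v) + t • (x + (ξ + v) + v - (x + (ξ + v)))) '' Ici 0))
      (Or.inr (Or.inr (Or.inl ⟨_, x + (ξ + v) + v, by simpa using hv0,
        ⟨ε, F, hF, by simpa using hv⟩, rfl⟩))) g hg (by
        rw [mem_map, mem_principal]
        rintro _ ⟨t, ht, rfl⟩
        have := h ((1 + t) • v) (hF'.smul_mem (by have : (0:ℝ) ≤ t := ht; linarith) hv)
        rw [show x + ξ + (1 + t) • v = x + (ξ + v) + t • (x + (ξ + v) + v - (x + (ξ + v))) by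
          module] at this
        exact this)
    have hle := cl_sector_le_cl_ray (x := x + (ξ + v)) hF' hv
    exact ⟨ξ + v, hF'.add_mem_closure hξ (subset_closure hv), map_mono hle h1, g', hg', hr, hle h2⟩
  · push Not at hne
    have hF0 : F = {0} := by
      obtain ⟨v, hv⟩ := hF'.nonempty
      exact Subset.antisymm hne (by rw [singleton_subset_iff, ← hne v hv]; exact hv)
    obtain ⟨h1, g', hg', hr, h2⟩ := H.ma2 f hf (pure (x + ξ)) (Or.inl ⟨_, rfl⟩) g hg (by
      have := h 0 (by simp [hF0])
      rwa [add_zero] at this)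
    refine ⟨ξ, hξ, ?_⟩
    have : (𝓟 ((fun v => x + ξ + v) '' F) : Filter V) = pure (x + ξ) := by
      simp [hF0]
    rw [this]
    exact ⟨h1, g', hg', hr, h2⟩

/-- If an apartment contains the germs of two spherical sector faces of another apartment, there is
an isomorphism that fixes both germs. -/
lemma exists_chart_fixing_germs {ε' : ℤˣ} (hf : f ∈ H.charts) (hg : g ∈ H.charts)
    (hF : 𝔸.IsSphericalFacet ε F) (hG : 𝔸.IsSphericalFacet ε' G)
    (hgF : range g ∈ map f (sectorFaceGerm x F)) (hgG : range g ∈ map f (sectorFaceGerm y G)) :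
    ∃ g' ∈ H.charts, range g' = range g ∧
      map g' (sectorFaceGerm x F) = map f (sectorFaceGerm x F) ∧
      map g' (sectorFaceGerm y G) = map f (sectorFaceGerm y G) := by
  have hF' := hF.isVFacet
  have hG' := hG.isVFacet
  obtain ⟨ξ, hξ, h1, -⟩ := exists_chart_fixing_sector hf hg hF hgF
  obtain ⟨η, hη, h2, -⟩ := exists_chart_fixing_sector hf hg hG hgG
  -- (MA4) speaks of chimneys. The apartment of `g` contains the enclosures of both shortened sector
  -- faces, hence the germs of the chimneys based at their facets at the vertex. These contain the
  -- germs of the sector faces, and the second chimney is solid because `G` is spherical.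
  obtain ⟨-, g', hg', hr, h3⟩ := H.ma4 f hf (𝔸.chimneyGerm (𝔸.facet (x + ξ) F) F)
    (𝔸.chimneyGerm (𝔸.facet (y + η) G) G)
    ⟨_, _, ⟨_, _, hF', rfl⟩, ⟨ε, hF⟩, rfl⟩
    (Or.inr ⟨_, _, ⟨_, _, hG', rfl⟩, hG', hasFiniteFixator_chimney hG, rfl⟩) g hg
    (map_mono (chimneyGerm_le_cl hF') h1) (map_mono (chimneyGerm_le_cl hG') h2)
  have h4 := le_cl _ h3
  refine ⟨g', hg', hr, map_congr ?_, map_congr ?_⟩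
  · rw [← sectorFaceGerm_add hF' hξ]
    exact sectorFaceGerm_le_chimneyGerm hF' hF' h4.1
  · rw [← sectorFaceGerm_add hG' hη]
    exact sectorFaceGerm_le_chimneyGerm hG' hG' h4.2

/-- The pair of directions of two germs in an apartment is unique up to the Weyl group. -/
lemma directions_unique {K L : Set V} {a b : V} (hf : f ∈ H.charts) (hg : g ∈ H.charts)
    (hF : 𝔸.IsSphericalFacet ε F) (hG : 𝔸.IsSphericalFacet ε G)
    (hK : 𝔸.IsSphericalFacet ε K) (hL : 𝔸.IsSphericalFacet ε L)
    (h1 : map f (sectorFaceGerm x F) = map g (sectorFaceGerm a K))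
    (h2 : map f (sectorFaceGerm y G) = map g (sectorFaceGerm b L)) :
    ∃ u ∈ 𝔸.vWeyl, F = u '' K ∧ G = u '' L := by
  -- The chart `f'` has the range of `f` and the same effect as `g` on both germs. It is therefore
  -- `f ∘ w`, and the linear part of `w` carries both directions at once.
  obtain ⟨f', hf', hr, h3, h4⟩ := exists_chart_fixing_germs hg hf hK hL
    (h1 ▸ range_mem_map) (h2 ▸ range_mem_map)
  obtain ⟨w, hw, rfl⟩ := exists_weyl_of_range_eq hf hf' hr
  obtain ⟨u, hu, huw⟩ := exists_linear_of_mem_weyl hw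
  have hinj := map_injective (H.charts_injective f hf)
  rw [← map_map, map_sectorFaceGerm hK.isVFacet hu huw, ← h1] at h3
  rw [← map_map, map_sectorFaceGerm hL.isVFacet hu huw, ← h2] at h4
  exact ⟨u, hu, direction_unique hF (hK.image hu) (hinj h3.symm),
    direction_unique hG (hL.image hu) (hinj h4.symm)⟩

/-- In any two apartments containing both germs the pairs of directions differ by one element of
`W^v`, so an invariant relation seen in one apartment is seen in all. -/
lemma InPosition.directions {ρ : Set V → Set V → Prop} (hρ : IsInvariant 𝔸 ρ) (hf : f ∈ H.charts)
    (hF : 𝔸.IsSphericalFacet ε F) (hG : 𝔸.IsSphericalFacet ε G)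
    (h : H.InPosition ε ρ (map f (sectorFaceGerm x F)) (map f (sectorFaceGerm y G))) : ρ F G := by
  obtain ⟨g, hg, a, b, K, L, hK, hL, h1, h2, h3⟩ := h
  obtain ⟨u, hu, rfl, rfl⟩ := directions_unique hf hg hF hG hK hL h1 h2
  exact hρ u hu _ _ h3

/-- There is an apartment containing the germ of a sector face and the germs of the parallel sector
faces based at close points in the direction of a facet. -/
lemma exists_chart_near {ε' : ℤˣ} (hf : f ∈ H.charts) (hg : g ∈ H.charts)
    (hF : 𝔸.IsSphericalFacet ε F) (hG : 𝔸.IsSphericalFacet ε' G) {F₁ : Set V}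
    (hF₁ : 𝔸.IsVFacet F₁) {η : V} (hη : η ∈ F₁) (x y : V) :
    ∃ h ∈ H.charts, range h ∈ map g (sectorFaceGerm y G) ∧
      ∃ δ > 0, ∀ s : ℝ, 0 ≤ s → s < δ → range h ∈ map f (sectorFaceGerm (x + s • η) F) := by
  have hF' := hF.isVFacet
  have hG' := hG.isVFacet
  -- The base of the first chimney points along `F₁` while its direction is `F`: this is what brings
  -- the germs at several base points into one apartment.
  obtain ⟨h, hh, h1, h2⟩ := H.ma3 f hf g hg (𝔸.chimneyGerm (𝔸.facet x F₁) F)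
    (𝔸.chimneyGerm (𝔸.facet y G) G)
    ⟨_, _, ⟨_, _, hF₁, rfl⟩, ⟨ε, hF⟩, rfl⟩
    (Or.inr ⟨_, _, ⟨_, _, hG', rfl⟩, hG', hasFiniteFixator_chimney hG, rfl⟩)
  refine ⟨h, hh, map_mono (sectorFaceGerm_le_chimneyGerm hG' hG') h2, ?_⟩
  exact exists_mem_sectorFaceGerm_of_mem_chimneyGerm hF' hF₁ hη h1

/-- A germ contained in an apartment is a germ of this apartment. -/
lemma exists_eq_map_of_range_mem (hf : f ∈ H.charts) (hg : g ∈ H.charts)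
    (hF : 𝔸.IsSphericalFacet ε F) (h : range g ∈ map f (sectorFaceGerm x F)) :
    ∃ y G, 𝔸.IsSphericalFacet ε G ∧ map f (sectorFaceGerm x F) = map g (sectorFaceGerm y G) := by
  obtain ⟨g', hg', hr, h1, -⟩ := exists_chart_fixing_germs hf hg hF hF h h
  obtain ⟨w, hw, rfl⟩ := exists_weyl_of_range_eq hg hg' hr
  obtain ⟨u, hu, huw⟩ := exists_linear_of_mem_weyl hw
  rw [← map_map, map_sectorFaceGerm hF.isVFacet hu huw] at h1
  exact ⟨_, _, hF.image hu, h1.symm⟩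

/-- Two germs are always contained in a common apartment. -/
lemma inPosition_true (hf : f ∈ H.charts) (hg : g ∈ H.charts)
    (hF : 𝔸.IsSphericalFacet ε F) (hG : 𝔸.IsSphericalFacet ε G) :
    H.InPosition ε (fun _ _ => True) (map f (sectorFaceGerm x F)) (map g (sectorFaceGerm y G)) := by
  obtain ⟨η, hη⟩ := hF.isVFacet.nonempty
  obtain ⟨h, hh, h1, δ, hδ, h2⟩ := exists_chart_near hf hg hF hG hF.isVFacet hη x y
  have h3 := h2 0 le_rfl hδ
  rw [zero_smul, add_zero] at h3
  obtain ⟨x', F', hF', e1⟩ := exists_eq_map_of_range_mem hf hh hF h3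
  obtain ⟨y', G', hG', e2⟩ := exists_eq_map_of_range_mem hg hh hG h1
  exact ⟨h, hh, x', y', F', G', hF', hG', e1, e2, trivial⟩

/-- Once the three germs lie in one apartment, the relation is read off from directions there, and
the first two germs have the same direction: the isomorphism onto that apartment fixes both. -/
lemma InPosition.of_common_chart {ρ : Set V → Set V → Prop} (hρ : IsInvariant 𝔸 ρ) {h : V → X}
    {x' : V} (hf : f ∈ H.charts) (hg : g ∈ H.charts) (hh : h ∈ H.charts)
    (hF : 𝔸.IsSphericalFacet ε F) (hG : 𝔸.IsSphericalFacet ε G)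
    (h1 : range h ∈ map f (sectorFaceGerm x F)) (h2 : range h ∈ map f (sectorFaceGerm x' F))
    (h3 : range h ∈ map g (sectorFaceGerm y G))
    (hp : H.InPosition ε ρ (map f (sectorFaceGerm x F)) (map g (sectorFaceGerm y G))) :
    H.InPosition ε ρ (map f (sectorFaceGerm x' F)) (map g (sectorFaceGerm y G)) := by
  obtain ⟨h', hh', hr, e1, e2⟩ := exists_chart_fixing_germs hf hh hF hF h1 h2
  obtain ⟨z, K, hK, e3⟩ := exists_eq_map_of_range_mem hg hh' hG (hr ▸ h3)
  rw [← e1, e3] at hp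
  rw [← e2, e3]
  exact ⟨h', hh', _, _, _, _, hF, hK, rfl, rfl, hp.directions hρ hh' hF hK⟩

/-- The relative position of two germs only depends on the parallelism class of the first. -/
lemma InPosition.of_parallel_left {ρ : Set V → Set V → Prop} (hρ : IsInvariant 𝔸 ρ)
    {𝔉 𝔉' 𝔊 : H.FaceGerm ε} (hpar : H.Parallel ε 𝔉 𝔉') (h : H.InPosition ε ρ 𝔉.1 𝔊.1) :
    H.InPosition ε ρ 𝔉'.1 𝔊.1 := by
  obtain ⟨f, hf, x, y, F, hF, e1, e2⟩ := hpar
  obtain ⟨g, hg, z, G, hG, e3⟩ := 𝔊.2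
  rw [e1, e3] at h
  rw [e2, e3]
  obtain ⟨v, hv⟩ := hF.isVFacet.nonempty
  -- The difference `y - x` need not lie in a vectorial facet. Replacing `y` by `y + t • v` does not
  -- change the germ and brings the difference into one.
  obtain ⟨t, ht, F₁, hF₁, hη⟩ := hF.exists_add_smul_mem hv (y - x)
  set η := y - x + t • v
  -- Chimneys based along `F₁` reach the parameters just above `s`, those based along `-F₁` the
  -- parameters just below; each gives an apartment that also contains `𝔊`.
  have hloc : IsLocallyConstant fun s : ℝ =>
      H.InPosition ε ρ (map f (sectorFaceGerm (x + s • η) F)) (map g (sectorFaceGerm z G)) := by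
    refine (IsLocallyConstant.iff_eventually_eq _).2 fun s => ?_
    have hη' : -η ∈ -F₁ := by simpa using hη
    obtain ⟨h, hh, h1, δ, hδ, h2⟩ := exists_chart_near hf hg hF hG hF₁ hη (x + s • η) z
    obtain ⟨h', hh', h1', δ', hδ', h2'⟩ := exists_chart_near hf hg hF hG hF₁.neg hη' (x + s • η) z
    filter_upwards [Ioo_mem_nhds (sub_lt_self s hδ') (lt_add_of_pos_right s hδ)] with r hr
    have key : ∀ k ∈ H.charts, range k ∈ map g (sectorFaceGerm z G) →
        range k ∈ map f (sectorFaceGerm (x + r • η) F) →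
        range k ∈ map f (sectorFaceGerm (x + s • η) F) →
        H.InPosition ε ρ (map f (sectorFaceGerm (x + r • η) F)) (map g (sectorFaceGerm z G)) =
        H.InPosition ε ρ (map f (sectorFaceGerm (x + s • η) F)) (map g (sectorFaceGerm z G)) :=
      fun k hk k1 k2 k3 => propext ⟨InPosition.of_common_chart hρ hf hg hk hF hG k2 k3 k1,
        InPosition.of_common_chart hρ hf hg hk hF hG k3 k2 k1⟩
    rcases le_total s r with hsr | hsr
    · refine key h hh h1 ?_ (by simpa using h2 0 le_rfl hδ)
      have := h2 (r - s) (sub_nonneg.2 hsr) (by linarith [hr.2])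
      rwa [show x + s • η + (r - s) • η = x + r • η by module] at this
    · refine key h' hh' h1' ?_ (by simpa using h2' 0 le_rfl hδ')
      have := h2' (s - r) (sub_nonneg.2 hsr) (by linarith [hr.1])
      rwa [show x + s • η + (s - r) • -η = x + r • η by module] at this
  have hc := hloc.apply_eq_of_isPreconnected isPreconnected_univ (mem_univ (0 : ℝ)) (mem_univ 1)
  simp only [zero_smul, add_zero, one_smul] at hc
  rw [hc, show x + η = y + t • v by simp only [η]; abel,
    sectorFaceGerm_add hF.isVFacet (subset_closure (hF.isVFacet.smul_mem ht hv))] at h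
  exact h

lemma isInvariant_subset_closure : IsInvariant 𝔸 (fun F G => G ⊆ closure F) := fun u _ F G h => by
  change u '' G ⊆ closure (u '' F)
  rw [← image_closure_linearEquiv]
  exact image_mono h

variable (H ε) in
/-- Parallelism is an equivalence relation. -/
lemma parallel_equivalence : Equivalence (H.Parallel ε) where
  refl 𝔉 := by
    obtain ⟨f, hf, x, F, hF, h⟩ := 𝔉.2
    exact ⟨f, hf, x, x, F, hF, h, h⟩
  symm := by
    rintro 𝔉 𝔊 ⟨f, hf, x, y, F, hF, h1, h2⟩
    exact ⟨f, hf, y, x, F, hF, h2, h1⟩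
  trans := by
    intro 𝔉 𝔊 𝔎 h1 h2
    have h1' : H.Parallel ε 𝔊 𝔉 := by
      obtain ⟨f, hf, x, y, F, hF, h1, h2⟩ := h1
      exact ⟨f, hf, y, x, F, hF, h2, h1⟩
    exact parallel_iff.2 (InPosition.of_parallel_left isInvariant_eq h1' (parallel_iff.1 h2))

lemma toInfinity_eq_iff {𝔉 𝔊 : H.FaceGerm ε} :
    H.toInfinity ε 𝔉 = H.toInfinity ε 𝔊 ↔ H.Parallel ε 𝔉 𝔊 :=
  (parallel_equivalence H ε).quot_mk_eq_iff 𝔉 𝔊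

/-- The relative position of two germs only depends on their parallelism classes. -/
lemma InPosition.of_toInfinity_eq {ρ : Set V → Set V → Prop} (hρ : IsInvariant 𝔸 ρ)
    {𝔉 𝔉' 𝔊 𝔊' : H.FaceGerm ε} (h1 : H.toInfinity ε 𝔉 = H.toInfinity ε 𝔉')
    (h2 : H.toInfinity ε 𝔊 = H.toInfinity ε 𝔊') (h : H.InPosition ε ρ 𝔉.1 𝔊.1) :
    H.InPosition ε ρ 𝔉'.1 𝔊'.1 := by
  have h3 := InPosition.of_parallel_left hρ (toInfinity_eq_iff.1 h1) h
  exact (InPosition.of_parallel_left hρ.flip (toInfinity_eq_iff.1 h2) h3.flip).flip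

/-- Dominance is compatible with parallelism. -/
lemma leInfinity_toInfinity_iff {𝔉 𝔊 : H.FaceGerm ε} :
    H.leInfinity ε (H.toInfinity ε 𝔊) (H.toInfinity ε 𝔉) ↔ H.Dominates ε 𝔉 𝔊 := by
  constructor
  · rintro ⟨𝔊', 𝔉', h1, h2, h3⟩
    exact dominates_iff.2 (InPosition.of_toInfinity_eq isInvariant_subset_closure h2 h1
      (dominates_iff.1 h3))
  · intro h
    exact ⟨𝔊, 𝔉, rfl, rfl, h⟩

end AffineHovel

/-! ## Spherical facets and cosets -/

namespace VectorialDatum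

open SimpleRoots

variable {ι V : Type*} [Fintype ι]

section Algebra

variable [AddCommGroup V] [Module ℝ V] {D : VectorialDatum ι V} {J J' : Set ι}

lemma mem_standardParabolic_iff {w : D.vWeyl} :
    w ∈ D.cs.standardParabolic J ↔ (w : V ≃ₗ[ℝ] V) ∈ D.parabolic J := by
  have h : (D.cs.standardParabolic J).map D.vWeyl.subtype = D.parabolic J := by
    rw [CoxeterSystem.standardParabolic, MonoidHom.map_closure, parabolic, image_image]
    simp only [Subgroup.subtype_apply, D.cs_simple]
  rw [← h]
  exact (Subgroup.mem_map_iff_mem D.vWeyl.subtype_injective).symm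

lemma isSpherical_iff_finite_standardParabolic :
    D.IsSpherical J ↔ (D.cs.standardParabolic J : Set D.vWeyl).Finite := by
  have h : ((↑) : D.vWeyl → V ≃ₗ[ℝ] V) '' (D.cs.standardParabolic J : Set D.vWeyl) =
      (D.parabolic J : Set (V ≃ₗ[ℝ] V)) := by
    ext w
    constructor
    · rintro ⟨w, hw, rfl⟩
      exact mem_standardParabolic_iff.1 hw
    · intro hw
      exact ⟨⟨w, D.parabolic_le J hw⟩, mem_standardParabolic_iff.2 hw, rfl⟩
  rw [IsSpherical, ← finite_image_iff Subtype.val_injective.injOn (s :=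
    (D.cs.standardParabolic J : Set D.vWeyl)), h]
  rfl

lemma isFacetOfType_face (ε : ℤˣ) {u : V ≃ₗ[ℝ] V} (hu : u ∈ D.vWeyl) (J : Set ι) :
    D.IsFacetOfType ε J (face (D.chamberRoot ε u) J) := isFacetOfType_iff.2 ⟨u, hu, rfl⟩

/-- A point of the standard face of type `J` is fixed by `W^v(J)`, whereas `rᵢ` moves every point at
which `αᵢ` does not vanish. -/
lemma mem_of_refl_mem_parabolic {i : ι} (h : D.refl i ∈ D.parabolic J) : i ∈ J := by
  obtain ⟨v, hv⟩ := face_nonempty D.root_free J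
  have h1 := parabolic_fixes hv h
  rw [refl_apply, sub_eq_self] at h1
  have h2 := congrArg (D.root i) h1
  rw [map_smul, D.root_coroot, smul_eq_mul, map_zero] at h2
  by_contra hi
  have := hv.2 i hi
  linarith

lemma isSpherical_empty : D.IsSpherical ∅ := by
  simp [IsSpherical]

lemma isSpherical_singleton (i : ι) : D.IsSpherical {i} := by
  have h : (Subgroup.closure (D.refl '' {i}) : Set (V ≃ₗ[ℝ] V)) ⊆ {1, D.refl i} := by
    intro w hw
    rw [image_singleton] at hw
    induction hw using Subgroup.closure_induction with
    | mem x hx => exact Or.inr hx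
    | one => exact Or.inl rfl
    | mul x y _ _ hx hy =>
      have h2 : D.refl i * D.refl i = 1 := by
        rw [← inv_eq_iff_mul_eq_one, D.refl_inv]
      rcases hx with rfl | rfl <;> rcases hy with rfl | rfl <;> simp [h2]
    | inv x _ hx =>
      rcases hx with rfl | rfl
      · left; simp
      · right; exact D.refl_inv i
  exact (Set.toFinite _).subset h

end Algebra

variable [NormedAddCommGroup V] [NormedSpace ℝ V] [FiniteDimensional ℝ V]
  {D : VectorialDatum ι V} {ε : ℤˣ} {J J' : Set ι} {F G : Set V}

variable (D ε) in
/-- The elements `w` of the Weyl group such that `F` is a face of the chamber `ε w C`. -/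
def cosetOf (F : Set V) : Set D.vWeyl :=
  {w | F ⊆ closure (face (D.chamberRoot ε w) ∅)}

lemma mem_cosetOf_face {u : V ≃ₗ[ℝ] V} (hu : u ∈ D.vWeyl) {w : D.vWeyl} :
    w ∈ cosetOf D ε (face (D.chamberRoot ε u) J) ↔ u⁻¹ * w ∈ D.parabolic J := by
  rw [cosetOf, Set.mem_ofPred_eq, closure_face_chamberRoot, face_subset_closedFace_iff hu w.2]
  simp

lemma cosetOf_face {u : V ≃ₗ[ℝ] V} (hu : u ∈ D.vWeyl) :
    cosetOf D ε (face (D.chamberRoot ε u) J) =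
      (⟨u, hu⟩ : D.vWeyl) • (D.cs.standardParabolic J : Set D.vWeyl) := by
  ext w
  rw [mem_cosetOf_face hu, mem_smul_set_iff_inv_smul_mem, SetLike.mem_coe,
    mem_standardParabolic_iff]
  rfl

/-- A facet is recovered from the chambers containing it. If `G` is a face of the chamber of `u`,
the chambers of `u` and of `u rⱼ` for `j ∈ J'` contain `G`, hence `F`; comparing them gives `rⱼ ∈
W^v(J)`, so `J' ⊆ J`. -/
lemma cosetOf_subset_iff (hF : D.IsFacetOfType ε J F) (hG : D.IsFacetOfType ε J' G) :
    cosetOf D ε G ⊆ cosetOf D ε F ↔ F ⊆ closure G := by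
  constructor
  · intro h
    obtain ⟨u', hu', rfl⟩ := isFacetOfType_iff.1 hF
    obtain ⟨u, hu, rfl⟩ := isFacetOfType_iff.1 hG
    have h1 : (⟨u, hu⟩ : D.vWeyl) ∈ cosetOf D ε (face (D.chamberRoot ε u') J) :=
      h ((mem_cosetOf_face hu).2 (by simp [one_mem]))
    have h2 := (mem_cosetOf_face hu').1 h1
    rw [closure_face_chamberRoot, face_subset_closedFace_iff hu' hu]
    refine ⟨h2, fun j hj => mem_of_refl_mem_parabolic (D := D) ?_⟩
    have h3 : (⟨u * D.refl j, mul_mem hu (D.refl_mem j)⟩ : D.vWeyl) ∈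
        cosetOf D ε (face (D.chamberRoot ε u') J) :=
      h ((mem_cosetOf_face hu).2 (by
        rw [inv_mul_cancel_left]
        exact Subgroup.subset_closure ⟨j, hj, rfl⟩))
    have h4 := mul_mem (inv_mem h2) ((mem_cosetOf_face hu').1 h3)
    convert h4 using 1
    group
  · intro h w hw
    exact h.trans (closure_minimal hw isClosed_closure)

lemma cosetOf_injective (hF : D.IsFacetOfType ε J F) (hG : D.IsFacetOfType ε J' G)
    (h : cosetOf D ε F = cosetOf D ε G) : F = G :=
  hF.eq_of_subset_closure hG ((cosetOf_subset_iff hF hG).1 h.ge) ((cosetOf_subset_iff hG hF).1 h.le)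

variable (D ε) in
/-- The spherical facets of given sign correspond to the spherical cosets. -/
def facetEquivCoset : {F // D.IsSphericalFacet ε F} ≃ D.cs.SphericalCoset :=
  Equiv.ofBijective
    (fun F => ⟨cosetOf D ε F.1, by
      obtain ⟨F, J, hJ, hF⟩ := F
      obtain ⟨u, hu, rfl⟩ := isFacetOfType_iff.1 hF
      exact ⟨⟨u, hu⟩, J, isSpherical_iff_finite_standardParabolic.1 hJ, cosetOf_face hu⟩⟩)
    ⟨by
      rintro ⟨F, J, hJ, hF⟩ ⟨G, J', hJ', hG⟩ h
      exact Subtype.ext (cosetOf_injective hF hG (Subtype.ext_iff.1 h)),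
    by
      rintro ⟨C, w, J, hJ, rfl⟩
      exact ⟨⟨face (D.chamberRoot ε w) J, J, isSpherical_iff_finite_standardParabolic.2 hJ,
        isFacetOfType_face ε w.2 J⟩, Subtype.ext (cosetOf_face w.2)⟩⟩

end VectorialDatum

/-! ## The building at infinity -/

namespace AffineHovel

open ModelApartment VectorialDatum SimpleRoots

variable {ι V : Type*} [Fintype ι] [NormedAddCommGroup V] [NormedSpace ℝ V]
  {𝔸 : ModelApartment ι V} {X : Type*} {H : AffineHovel 𝔸 X}
  {F G F' G' : Set V} {x y : V} {f g : V → X} {ε : ℤˣ}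

/-- The germ of the sector face `x + F` in the apartment with chart `f`. -/
def faceGerm (hf : f ∈ H.charts) (x : V) (hF : 𝔸.IsSphericalFacet ε F) : H.FaceGerm ε :=
  ⟨map f (sectorFaceGerm x F), f, hf, x, F, hF, rfl⟩

/-- The facet at infinity with direction `F` in the apartment with chart `f`. -/
def atInfinity (hf : f ∈ H.charts) (hF : 𝔸.IsSphericalFacet ε F) : H.Infinity ε :=
  H.toInfinity ε (faceGerm hf 0 hF)

lemma toInfinity_faceGerm (hf : f ∈ H.charts) (x : V) (hF : 𝔸.IsSphericalFacet ε F) :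
    H.toInfinity ε (faceGerm hf x hF) = atInfinity hf hF :=
  Quot.sound ⟨f, hf, x, 0, F, hF, rfl, rfl⟩

/-- The action of the vectorial Weyl group on the spherical facets. -/
def facetPerm (𝔸 : ModelApartment ι V) (ε : ℤˣ) {u : V ≃ₗ[ℝ] V} (hu : u ∈ 𝔸.vWeyl) :
    {F // 𝔸.IsSphericalFacet ε F} ≃ {F // 𝔸.IsSphericalFacet ε F} where
  toFun F := ⟨(u : V → V) '' F.1, F.2.image hu⟩
  invFun F := ⟨(u⁻¹ : V ≃ₗ[ℝ] V) '' F.1, F.2.image (inv_mem hu)⟩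
  left_inv F := Subtype.ext <| by
    simp only [image_image]
    exact (image_congr fun v _ => u.symm_apply_apply v).trans (image_id _)
  right_inv F := Subtype.ext <| by
    simp only [image_image]
    exact (image_congr fun v _ => u.apply_symm_apply v).trans (image_id _)

variable [FiniteDimensional ℝ V]

lemma exists_common_chart (a b : H.Infinity ε) :
    ∃ f, ∃ hf : f ∈ H.charts, ∃ F, ∃ hF : 𝔸.IsSphericalFacet ε F, ∃ G,
      ∃ hG : 𝔸.IsSphericalFacet ε G, a = atInfinity hf hF ∧ b = atInfinity hf hG := by
  induction a using Quot.ind with | _ 𝔉 =>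
  induction b using Quot.ind with | _ 𝔊 =>
  obtain ⟨f, hf, x, F, hF, h1⟩ := 𝔉.2
  obtain ⟨g, hg, y, G, hG, h2⟩ := 𝔊.2
  have := inPosition_true (x := x) (y := y) hf hg hF hG
  rw [← h1, ← h2] at this
  obtain ⟨h, hh, x', y', F', G', hF', hG', e1, e2, -⟩ := this
  refine ⟨h, hh, F', hF', G', hG', ?_, ?_⟩
  · rw [← toInfinity_faceGerm hh x' hF']
    exact congrArg _ (Subtype.ext e1)
  · rw [← toInfinity_faceGerm hh y' hG']
    exact congrArg _ (Subtype.ext e2)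

lemma exists_eq_atInfinity (a : H.Infinity ε) :
    ∃ f, ∃ hf : f ∈ H.charts, ∃ F, ∃ hF : 𝔸.IsSphericalFacet ε F, a = atInfinity hf hF := by
  obtain ⟨f, hf, F, hF, _, _, h, -⟩ := exists_common_chart a a
  exact ⟨f, hf, F, hF, h⟩

/-- The pair of directions of two facets at infinity is unique up to the Weyl group. -/
lemma exists_image_eq_of_atInfinity_eq {hf : f ∈ H.charts} {hg : g ∈ H.charts}
    {hF : 𝔸.IsSphericalFacet ε F} {hG : 𝔸.IsSphericalFacet ε G}
    {hF' : 𝔸.IsSphericalFacet ε F'} {hG' : 𝔸.IsSphericalFacet ε G'}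
    (h1 : atInfinity hf hF = atInfinity hg hF') (h2 : atInfinity hf hG = atInfinity hg hG') :
    ∃ u ∈ 𝔸.vWeyl, F' = u '' F ∧ G' = u '' G := by
  -- This relation is built so that its transport from `f` to `g` produces a single `u` serving both
  -- facets.
  have hρ : IsInvariant 𝔸 fun K L => ∃ u ∈ 𝔸.vWeyl, K = u '' F ∧ L = u '' G := by
    rintro u hu _ _ ⟨u', hu', rfl, rfl⟩
    exact ⟨u * u', mul_mem hu hu', image_image _ _ _, image_image _ _ _⟩
  refine InPosition.directions hρ hg hF' hG' (InPosition.of_toInfinity_eq hρ h1 h2 ?_)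
  exact ⟨f, hf, 0, 0, F, G, hF, hG, rfl, rfl, 1, one_mem _, (image_id F).symm, (image_id G).symm⟩

lemma atInfinity_eq_iff {hf : f ∈ H.charts} {hF : 𝔸.IsSphericalFacet ε F}
    {hG : 𝔸.IsSphericalFacet ε G} : atInfinity hf hF = atInfinity hf hG ↔ F = G := by
  constructor
  · intro h
    exact InPosition.directions isInvariant_eq hf hF hG
      (parallel_iff.1 (toInfinity_eq_iff.1 h))
  · rintro rfl
    rfl

lemma leInfinity_atInfinity_iff {hf : f ∈ H.charts} {hF : 𝔸.IsSphericalFacet ε F}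
    {hG : 𝔸.IsSphericalFacet ε G} :
    H.leInfinity ε (atInfinity hf hF) (atInfinity hf hG) ↔ F ⊆ closure G := by
  rw [atInfinity, atInfinity, leInfinity_toInfinity_iff, dominates_iff]
  constructor
  · intro h
    exact InPosition.directions (ρ := fun F G => G ⊆ closure F)
      isInvariant_subset_closure hf hG hF h
  · intro h
    exact ⟨f, hf, 0, 0, G, F, hG, hF, rfl, rfl, h⟩

lemma mem_apartmentAtInfinity_iff (hf : f ∈ H.charts) {a : H.Infinity ε} :
    a ∈ H.apartmentAtInfinity ε (range f) ↔
      ∃ F, ∃ hF : 𝔸.IsSphericalFacet ε F, a = atInfinity hf hF := by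
  constructor
  · rintro ⟨𝔉, rfl, h⟩
    obtain ⟨g, hg, x, F, hF, e⟩ := 𝔉.2
    rw [e] at h
    obtain ⟨y, G, hG, e'⟩ := exists_eq_map_of_range_mem hg hf hF h
    refine ⟨G, hG, ?_⟩
    rw [← toInfinity_faceGerm hf y hG]
    exact congrArg _ (Subtype.ext (e.trans e'))
  · rintro ⟨F, hF, rfl⟩
    exact ⟨_, rfl, range_mem_map⟩

/-- An apartment at infinity contains the faces of its facets. -/
lemma exists_eq_atInfinity_of_le {hf : f ∈ H.charts} {hF : 𝔸.IsSphericalFacet ε F}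
    {b : H.Infinity ε} (h : H.leInfinity ε b (atInfinity hf hF)) :
    ∃ G, ∃ hG : 𝔸.IsSphericalFacet ε G, b = atInfinity hf hG := by
  induction b using Quot.ind with | _ 𝔊 =>
  obtain ⟨g, hg, x, y, F', G', hF', hG', e1, e2, hsub⟩ :=
    dominates_iff.1 (leInfinity_toInfinity_iff.1 h)
  have hr : range f ∈ map g (sectorFaceGerm x F') := by
    rw [← e1]
    exact range_mem_map
  -- An isomorphism that fixes the enclosure of a sector face of direction `F'` also fixes the
  -- sector face of direction `G'` with the same vertex, as `G' ⊆ closure F'`; the latter represents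
  -- `b`.
  obtain ⟨ξ, hξ, -, f', hf', hrf, hfix⟩ := exists_chart_fixing_sector hg hf hF' hr
  have e3 : map f' (sectorFaceGerm (x + ξ) G') = map g (sectorFaceGerm (x + ξ) G') := by
    refine map_congr ((mem_sectorFaceGerm hG'.isVFacet).2 ⟨0, hG'.isVFacet.zero_mem, ?_⟩)
    intro v hv
    rw [add_zero]
    exact add_mem_of_mem_cl hfix (hsub hv)
  have e4 : Quot.mk _ 𝔊 = H.toInfinity ε (faceGerm hf' (x + ξ) hG') := by
    have : H.toInfinity ε (faceGerm hf' (x + ξ) hG') = H.toInfinity ε (faceGerm hg (x + ξ) hG') :=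
      congrArg _ (Subtype.ext e3)
    rw [this, toInfinity_faceGerm, ← toInfinity_faceGerm hg y hG']
    exact congrArg _ (Subtype.ext e2)
  refine (mem_apartmentAtInfinity_iff hf).1 ?_
  rw [← hrf]
  exact (mem_apartmentAtInfinity_iff hf').2 ⟨G', hG', e4.trans (toInfinity_faceGerm ..)⟩

variable (H ε) in
/-- Dominance is a partial order on the facets at infinity. -/
lemma isPartialOrder_leInfinity : IsPartialOrder (H.Infinity ε) (H.leInfinity ε) where
  refl a := by
    obtain ⟨f, hf, F, hF, rfl⟩ := exists_eq_atInfinity a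
    exact leInfinity_atInfinity_iff.2 subset_closure
  trans a b c hab hbc := by
    obtain ⟨f, hf, F, hF, G, hG, rfl, rfl⟩ := exists_common_chart b c
    obtain ⟨K, hK, rfl⟩ := exists_eq_atInfinity_of_le hab
    rw [leInfinity_atInfinity_iff] at hab hbc ⊢
    exact hab.trans (closure_minimal hbc isClosed_closure)
  antisymm a b hab hba := by
    obtain ⟨f, hf, F, hF, G, hG, rfl, rfl⟩ := exists_common_chart a b
    rw [leInfinity_atInfinity_iff] at hab hba
    rw [atInfinity_eq_iff]
    obtain ⟨_, _, hF⟩ := hF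
    obtain ⟨_, _, hG⟩ := hG
    exact hF.eq_of_subset_closure hG hab hba

lemma exists_typeAtInfinity (a : H.Infinity ε) : ∃ J : Set ι, ∃ f, ∃ hf : f ∈ H.charts, ∃ F,
    ∃ hF : 𝔸.IsSphericalFacet ε F, 𝔸.IsFacetOfType ε J F ∧ a = atInfinity hf hF := by
  obtain ⟨f, hf, F, hF, rfl⟩ := exists_eq_atInfinity a
  obtain ⟨J, _, hJ⟩ := id hF
  exact ⟨J, f, hf, F, hF, hJ, rfl⟩

/-- The type of a facet at infinity. -/
def typeAtInfinity (a : H.Infinity ε) : Set ι := (exists_typeAtInfinity a).choose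

/-- Two charts showing the same facet at infinity give directions that differ by `W^v`, which
preserves types, so the choice in the definition is harmless. -/
lemma typeAtInfinity_eq {J : Set ι} {hf : f ∈ H.charts} {hF : 𝔸.IsSphericalFacet ε F}
    (hJ : 𝔸.IsFacetOfType ε J F) : typeAtInfinity (atInfinity hf hF) = J := by
  obtain ⟨g, hg, G, hG, h1, h2⟩ := (exists_typeAtInfinity (atInfinity hf hF)).choose_spec
  obtain ⟨u, hu, rfl, -⟩ := exists_image_eq_of_atInfinity_eq h2 h2
  exact IsFacetOfType.type_unique h1 (hJ.image hu)

/-- The facets of the apartment with chart `f` at infinity correspond to the spherical vectorial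
facets. -/
def facetEquivApartment (ε : ℤˣ) (hf : f ∈ H.charts) :
    {F // 𝔸.IsSphericalFacet ε F} ≃ H.apartmentAtInfinity ε (range f) :=
  Equiv.ofBijective
    (fun F => ⟨atInfinity hf F.2, (mem_apartmentAtInfinity_iff hf).2 ⟨F.1, F.2, rfl⟩⟩)
    ⟨fun F G h => Subtype.ext (atInfinity_eq_iff.1 (Subtype.ext_iff.1 h)), fun a => by
      obtain ⟨F, hF, h⟩ := (mem_apartmentAtInfinity_iff hf).1 a.2
      exact ⟨⟨F, hF⟩, Subtype.ext h.symm⟩⟩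

lemma coe_facetEquivApartment (hf : f ∈ H.charts) (F : {F // 𝔸.IsSphericalFacet ε F}) :
    (facetEquivApartment ε hf F : H.Infinity ε) = atInfinity hf F.2 := rfl

variable (H ε) in
/-- The facets at infinity of a hovel form a combinatorial building. -/
theorem isTypedBuilding_infinity [Nonempty X] :
    IsTypedBuilding 𝔸.cs (H.leInfinity ε) (H.apartmentsAtInfinity ε) typeAtInfinity where
  partialOrder := isPartialOrder_leInfinity H ε
  nonempty := by
    obtain ⟨f, hf, -⟩ := H.covering (Classical.arbitrary X)
    exact ⟨_, _, ⟨f, hf, rfl⟩, rfl⟩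
  face_mem := by
    rintro _ ⟨_, ⟨f, hf, rfl⟩, rfl⟩ a ha b hba
    obtain ⟨F, hF, rfl⟩ := (mem_apartmentAtInfinity_iff hf).1 ha
    exact (mem_apartmentAtInfinity_iff hf).2 (exists_eq_atInfinity_of_le hba)
  coxeter := by
    rintro _ ⟨_, ⟨f, hf, rfl⟩, rfl⟩
    refine ⟨(facetEquivApartment ε hf).symm.trans (facetEquivCoset 𝔸.toVectorialDatum ε), ?_, ?_⟩
    · intro a b
      obtain ⟨⟨F, hF⟩, rfl⟩ := (facetEquivApartment ε hf).surjective a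
      obtain ⟨⟨G, hG⟩, rfl⟩ := (facetEquivApartment ε hf).surjective b
      simp only [Equiv.trans_apply, Equiv.symm_apply_apply, coe_facetEquivApartment]
      rw [leInfinity_atInfinity_iff]
      obtain ⟨_, _, hF⟩ := hF
      obtain ⟨_, _, hG⟩ := hG
      exact (cosetOf_subset_iff hF hG).symm
    · intro a
      obtain ⟨⟨F, J, hJ, hF⟩, rfl⟩ := (facetEquivApartment ε hf).surjective a
      simp only [Equiv.trans_apply, Equiv.symm_apply_apply, coe_facetEquivApartment]
      rw [typeAtInfinity_eq hF]
      obtain ⟨u, hu, rfl⟩ := isFacetOfType_iff.1 hF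
      exact ⟨⟨u, hu⟩, cosetOf_face hu⟩
  common := by
    intro a b
    obtain ⟨f, hf, F, hF, G, hG, rfl, rfl⟩ := exists_common_chart a b
    exact ⟨_, ⟨_, ⟨f, hf, rfl⟩, rfl⟩, (mem_apartmentAtInfinity_iff hf).2 ⟨F, hF, rfl⟩,
      (mem_apartmentAtInfinity_iff hf).2 ⟨G, hG, rfl⟩⟩
  iso := by
    rintro _ ⟨_, ⟨f, hf, rfl⟩, rfl⟩ _ ⟨_, ⟨g, hg, rfl⟩, rfl⟩ a b ha hb ha' hb'
    obtain ⟨F, hF, rfl⟩ := (mem_apartmentAtInfinity_iff hf).1 ha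
    obtain ⟨G, hG, rfl⟩ := (mem_apartmentAtInfinity_iff hf).1 hb
    obtain ⟨F', hF', h1⟩ := (mem_apartmentAtInfinity_iff hg).1 ha'
    obtain ⟨G', hG', h2⟩ := (mem_apartmentAtInfinity_iff hg).1 hb'
    -- One `u ∈ W^v` carries the directions of both `a` and `b` in the first apartment to those in
    -- the second; its action on spherical facets induces the isomorphism.
    obtain ⟨u, hu, rfl, rfl⟩ := exists_image_eq_of_atInfinity_eq h1 h2
    refine ⟨(facetEquivApartment ε hf).symm.trans ((facetPerm 𝔸 ε hu).trans
      (facetEquivApartment ε hg)), ?_, ?_, ?_⟩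
    · intro c d
      obtain ⟨⟨K, hK⟩, rfl⟩ := (facetEquivApartment ε hf).surjective c
      obtain ⟨⟨L, hL⟩, rfl⟩ := (facetEquivApartment ε hf).surjective d
      simp only [Equiv.trans_apply, Equiv.symm_apply_apply, coe_facetEquivApartment,
        leInfinity_atInfinity_iff]
      change K ⊆ closure L ↔ u '' K ⊆ closure (u '' L)
      rw [← image_closure_linearEquiv, image_subset_image_iff u.injective]
    · intro c
      obtain ⟨⟨K, J, hJ, hK⟩, rfl⟩ := (facetEquivApartment ε hf).surjective c
      simp only [Equiv.trans_apply, Equiv.symm_apply_apply, coe_facetEquivApartment]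
      rw [typeAtInfinity_eq hK]
      exact typeAtInfinity_eq (hK.image hu)
    · intro c hc
      obtain ⟨⟨K, hK⟩, rfl⟩ := (facetEquivApartment ε hf).surjective c
      simp only [Equiv.trans_apply, Equiv.symm_apply_apply, coe_facetEquivApartment] at hc ⊢
      -- A face of `a` or `b` belongs to the second apartment too, with some direction `K'`. Both `u
      -- '' K` and `K'` lie in the closure of `u '' L` and have the same type, so they coincide.
      have key : ∀ {L : Set V} (hL : 𝔸.IsSphericalFacet ε L),
          H.leInfinity ε (atInfinity hf hK) (atInfinity hf hL) →
          atInfinity hf hL = atInfinity hg (hL.image hu) →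
          atInfinity hg (hK.image hu) = atInfinity hf hK := by
        intro L hL hle heq
        have hle' := hle
        rw [heq] at hle'
        obtain ⟨K', hK', h3⟩ := exists_eq_atInfinity_of_le hle'
        rw [h3] at hle' ⊢
        rw [leInfinity_atInfinity_iff] at hle hle'
        rw [atInfinity_eq_iff]
        obtain ⟨J, _, hJ⟩ := id hK
        obtain ⟨J', _, hJ'⟩ := id hK'
        obtain ⟨J'', _, hJ''⟩ := id hL
        have hJJ : J = J' := by
          rw [← typeAtInfinity_eq (hf := hf) (hF := hK) hJ, h3, typeAtInfinity_eq hJ']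
        subst hJJ
        refine IsFacetOfType.eq_of_subset_closure_of_type (hJ.image hu) hJ' (hJ''.image hu) ?_ hle'
        rw [← image_closure_linearEquiv]
        exact image_mono hle
      rcases hc with hc | hc
      · exact key hF hc h1
      · exact key hG hc h2

end AffineHovel

/-! ## Facets of the model apartment -/

namespace VectorialDatum

open SimpleRoots

variable {ι V : Type*} [Fintype ι] [AddCommGroup V] [Module ℝ V] {D : VectorialDatum ι V}

lemma ne_zero_of_mem_roots {f : Module.Dual ℝ V} (hf : f ∈ D.roots) : f ≠ 0 := by
  rcases hf with ⟨a, u, hu, i, rfl, rfl⟩ | hf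
  · intro h
    have h1 := LinearMap.congr_fun h (u (D.coroot i))
    rw [act_apply_apply, D.root_coroot] at h1
    simp at h1
  · exact D.imag_ne_zero f hf

lemma chamberRoot_mem_realRoots (ε : ℤˣ) {w : V ≃ₗ[ℝ] V} (hw : w ∈ D.vWeyl) (i : ι) :
    D.chamberRoot ε w i ∈ D.realRoots := by
  have h := act_mem_realRoots (D.root_mem_realRoots i) hw
  rcases Int.units_eq_one_or ε with rfl | rfl
  · simpa [chamberRoot] using h
  · have e : D.chamberRoot (-1) w i = -act w (D.root i) := by ext v; simp [chamberRoot]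
    rw [e]
    exact neg_mem_realRoots h

/-- A positive combination vanishing at a point of an open chamber has only zero coefficients, but a
root is nonzero. -/
lemma pos_of_mem_chamber {f : Module.Dual ℝ V} (hf : f ∈ D.roots) {b : ι → Module.Dual ℝ V}
    (hfb : IsPosComb b f) {v : V} (hv : v ∈ face b ∅) : 0 < f v := by
  refine lt_of_le_of_ne (hfb.nonneg (face_subset_closedFace hv)) fun h => ne_zero_of_mem_roots hf ?_
  obtain ⟨c, hc, rfl⟩ := hfb
  exact Finset.sum_eq_zero fun i _ => by
    rw [IsPosComb.coeff_eq_zero hc hv h.ge (notMem_empty i), zero_smul]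

end VectorialDatum

namespace ModelApartment

open VectorialDatum SimpleRoots

section Weyl

variable {ι V : Type*} [Fintype ι] [AddCommGroup V] [Module ℝ V] {𝔸 : ModelApartment ι V}

/-- The reflection in a wall. -/
def wallReflection {α : Module.Dual ℝ V} {a : V} (h : 𝔸.IsRootPair α a) (k : ℝ) :
    Equiv.Perm V :=
  Function.Involutive.toPerm (fun x => x - (α x + k) • a) <| by
    intro x
    obtain ⟨u, -, i, rfl, rfl⟩ := h
    simp only [map_sub, map_smul, act_apply_apply, 𝔸.root_coroot, smul_eq_mul]
    module

lemma wallReflection_apply {α : Module.Dual ℝ V} {a : V} (h : 𝔸.IsRootPair α a) (k : ℝ) (x : V) :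
    wallReflection h k x = x - (α x + k) • a := rfl

lemma wallReflection_mem {α : Module.Dual ℝ V} {a : V} (h : 𝔸.IsRootPair α a) {k : ℝ}
    (hk : affWall α k ∈ 𝔸.walls) : wallReflection h k ∈ 𝔸.weyl :=
  Subgroup.subset_closure ⟨α, a, k, h, hk, fun _ => rfl⟩

lemma image_mem_walls {w : Equiv.Perm V} (hw : w ∈ 𝔸.weyl) :
    ∀ M ∈ 𝔸.walls, w '' M ∈ 𝔸.walls := by
  -- The statement for the inverse is carried along to make the inverse step of the induction work.
  have key : ∀ w ∈ 𝔸.weyl, (∀ M ∈ 𝔸.walls, w '' M ∈ 𝔸.walls) ∧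
      ∀ M ∈ 𝔸.walls, (w⁻¹ : Equiv.Perm V) '' M ∈ 𝔸.walls := by
    intro w hw
    induction hw using Subgroup.closure_induction with
    | mem g hg =>
      obtain ⟨α, a, k, h, hk, hg⟩ := hg
      have e : g = wallReflection h k := Equiv.ext hg
      have e' : (wallReflection h k)⁻¹ = wallReflection h k := Equiv.ext fun x => rfl
      rw [e, e']
      exact ⟨fun M hM => 𝔸.walls_stable α a k h hk M hM,
        fun M hM => 𝔸.walls_stable α a k h hk M hM⟩
    | one => simp
    | mul x y _ _ hx hy =>
      constructor
      · intro M hM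
        rw [Equiv.Perm.coe_mul, image_comp]
        exact hx.1 _ (hy.1 M hM)
      · intro M hM
        rw [mul_inv_rev, Equiv.Perm.coe_mul, image_comp]
        exact hy.2 _ (hx.2 M hM)
    | inv x _ hx => exact ⟨hx.2, by simpa using hx.1⟩
  exact (key w hw).1

lemma image_affWall {w : Equiv.Perm V} {u : V ≃ₗ[ℝ] V} (hw : ∀ x v, w (x + v) = w x + u v)
    (α : Module.Dual ℝ V) (k : ℝ) (x : V) :
    w '' affWall α k = affWall (act u α) (k + α x - act u α (w x)) := by
  have h1 : ∀ z, act u α (w z) = act u α (w x) + (α z - α x) := fun z => by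
    have := hw x (z - x)
    rw [add_sub_cancel] at this
    rw [this, map_add, act_apply_apply, map_sub]
  ext z
  constructor
  · rintro ⟨z, hz, rfl⟩
    have hz : α z + k = 0 := hz
    change act u α (w z) + _ = 0
    rw [h1]
    linarith
  · intro hz
    refine ⟨w.symm z, ?_, w.apply_symm_apply z⟩
    have hz : act u α z + (k + α x - act u α (w x)) = 0 := hz
    have h2 := h1 (w.symm z)
    rw [w.apply_symm_apply] at h2
    change α (w.symm z) + k = 0
    linarith

lemma affWall_neg (α : Module.Dual ℝ V) (k : ℝ) : affWall (-α) (-k) = affWall α k := by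
  ext x
  simp only [affWall, Set.mem_ofPred_eq, LinearMap.neg_apply]
  constructor <;> intro h <;> linarith

lemma neg_mem_wallParams {α : Module.Dual ℝ V} {r : ℝ} (h : r ∈ 𝔸.wallParams α) :
    -r ∈ 𝔸.wallParams (-α) :=
  h.imp (𝔸.imag_neg α) fun h => by rwa [affWall_neg]

/-- Weyl group elements pull back enclosed sets to enclosed sets. -/
lemma exists_preimage_halfSpaceInter {w : Equiv.Perm V} (hwW : w ∈ 𝔸.weyl) {u : V ≃ₗ[ℝ] V}
    (hu : u ∈ 𝔸.vWeyl) (hw : ∀ x v, w (x + v) = w x + u v) {k : Module.Dual ℝ V → WithTop ℝ}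
    (hk : 𝔸.IsAdmissible k) (o : Set (Module.Dual ℝ V)) :
    ∃ k' o', 𝔸.IsAdmissible k' ∧ w ⁻¹' 𝔸.halfSpaceInter k o = 𝔸.halfSpaceInter k' o' := by
  have h1 : ∀ (α : Module.Dual ℝ V) z, act u α (w z) = α z + act u α (w 0) := fun α z => by
    have := hw 0 z
    rw [zero_add] at this
    rw [this, map_add, act_apply_apply, add_comm]
  have hk1 : ∀ (α : Module.Dual ℝ V) (r : ℝ),
      (k (act u α)).map (fun s => s + act u α (w 0)) = (r : WithTop ℝ) ↔
        k (act u α) = ((r - act u α (w 0) : ℝ) : WithTop ℝ) := by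
    intro α r
    cases hc : k (act u α) with
    | top => exact ⟨fun h => (WithTop.top_ne_coe h).elim, fun h => (WithTop.top_ne_coe h).elim⟩
    | coe s =>
      rw [WithTop.map_coe, WithTop.coe_inj, WithTop.coe_inj]
      constructor <;> intro h <;> linarith
  -- Since `(u α)(w z) = α z + (u α)(w 0)`, the half-space of `u α` with parameter `s` pulls back to
  -- that of `α` with parameter `s + (u α)(w 0)`.
  refine ⟨fun α => (k (act u α)).map (fun s => s + act u α (w 0)), {α | act u α ∈ o}, ?_, ?_⟩
  · intro α hα r hr
    rcases hk _ (act_mem_roots hα hu) _ ((hk1 α r).1 hr) with h | h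
    · left
      have := act_mem_imag h (inv_mem hu)
      rwa [act_inv_act] at this
    · right
      have h2 := image_mem_walls (inv_mem hwW) _ h
      have hw' : ∀ x v, w⁻¹ (x + v) = w⁻¹ x + u⁻¹ v := fun x v => by
        apply w.injective
        rw [hw, Equiv.Perm.inv_def, Equiv.apply_symm_apply, Equiv.apply_symm_apply]
        congr 1
        exact (u.apply_symm_apply v).symm
      rw [image_affWall hw' _ _ (w 0), act_inv_act] at h2
      convert h2 using 2
      rw [Equiv.Perm.inv_def, Equiv.symm_apply_apply, map_zero α]
      ring
  · ext z
    constructor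
    · intro hz α hα r hr
      obtain ⟨h2, h3⟩ := hz _ (act_mem_roots hα hu) _ ((hk1 α r).1 hr)
      rw [h1] at h2 h3
      exact ⟨by linarith, fun h => by linarith [h3 h]⟩
    · intro hz α hα r hr
      have hα' : α = act u (act u⁻¹ α) := (act_act_inv u α).symm
      obtain ⟨h2, h3⟩ := hz (act u⁻¹ α) (act_mem_roots hα (inv_mem hu)) (r + α (w 0)) (by
        rw [hk1, ← hα']
        simpa using hr)
      have h4 := h1 (act u⁻¹ α) z
      rw [← hα'] at h4
      rw [h4]
      refine ⟨by linarith, fun h => ?_⟩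
      have := h3 (show act u (act u⁻¹ α) ∈ o by rwa [← hα'])
      linarith

end Weyl

variable {V : Type*} [NormedAddCommGroup V] {F G : Set V} {x y : V}

lemma mem_localFacet_iff {S : Set V} : S ∈ localFacet x F ↔ ∀ᶠ η in 𝓝[F] 0, x + η ∈ S := by
  have h := (Homeomorph.addLeft x).isEmbedding.map_nhdsWithin_eq F 0
  have h0 : (Homeomorph.addLeft x) 0 = x := by simp
  rw [h0] at h
  rw [localFacet]
  change S ∈ 𝓝[(Homeomorph.addLeft x) '' F] x ↔ _
  rw [← h]
  rfl

variable {ι : Type*} [Fintype ι] [NormedSpace ℝ V] {𝔸 : ModelApartment ι V}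

lemma localFacet_le_facet : localFacet x F ≤ 𝔸.facet x F := by
  rintro S ⟨k, o, _, h, hS⟩
  exact mem_of_superset h hS

lemma localFacet_neBot (hF : 𝔸.IsVFacet F) : (localFacet x F).NeBot := by
  have h : (𝓝[F] (0 : V)).NeBot := by
    obtain ⟨v, hv⟩ := hF.nonempty
    have hlim : Tendsto (fun t : ℝ => t • v) (𝓝[>] 0) (𝓝 0) := by
      have : Continuous fun t : ℝ => t • v := by fun_prop
      have h := this.tendsto 0
      rw [zero_smul] at h
      exact h.mono_left nhdsWithin_le_nhds
    refine mem_closure_iff_nhdsWithin_neBot.1 (mem_closure_of_tendsto hlim ?_)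
    filter_upwards [self_mem_nhdsWithin] with t ht using hF.smul_mem ht hv
  rw [neBot_iff]
  intro hbot
  have h1 : (∅ : Set V) ∈ localFacet x F := by rw [hbot]; exact mem_bot
  obtain ⟨η, hη⟩ := (mem_localFacet_iff.1 h1).exists
  exact hη

lemma facet_neBot (hF : 𝔸.IsVFacet F) : (𝔸.facet x F).NeBot :=
  (localFacet_neBot (𝔸 := 𝔸) hF).mono localFacet_le_facet

lemma mem_closure_of_mem_localFacet (hF : 𝔸.IsVFacet F) {S : Set V} (hS : S ∈ localFacet x F) :
    x ∈ closure S := by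
  have := localFacet_neBot (𝔸 := 𝔸) (x := x) hF
  exact mem_closure_of_tendsto (f := id) (b := localFacet x F)
    (tendsto_id.mono_left nhdsWithin_le_nhds) hS

/-- Taking the parameter `∞` at all other roots makes one half-space an admissible intersection. For
half-spaces bounded by walls, a facet and its local facet thus contain the same ones. -/
lemma halfSpace_mem_facet {α : Module.Dual ℝ V} (hα : α ∈ 𝔸.roots) {r : ℝ}
    (hr : r ∈ 𝔸.wallParams α) (h : {z | 0 ≤ α z + r} ∈ localFacet y F) :
    {z | 0 ≤ α z + r} ∈ 𝔸.facet y F := by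
  classical
  have he : 𝔸.halfSpaceInter (fun β => if β = α then (r : WithTop ℝ) else ⊤) ∅ =
      {z | 0 ≤ α z + r} := by
    ext z
    constructor
    · intro hz
      exact (hz α hα r (by simp)).1
    · intro hz β hβ s hs
      by_cases hb : β = α
      · subst hb
        simp only [if_true, WithTop.coe_inj] at hs
        subst hs
        exact ⟨hz, fun h => h.elim⟩
      · simp [hb] at hs
  refine ⟨_, ∅, ?_, he ▸ h, he.le⟩
  intro β hβ s hs
  by_cases hb : β = α
  · subst hb
    simp only [if_true, WithTop.coe_inj] at hs
    exact hs ▸ hr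
  · simp [hb] at hs

lemma openHalfSpace_mem_facet {α : Module.Dual ℝ V} (hα : α ∈ 𝔸.roots) {r : ℝ}
    (hr : r ∈ 𝔸.wallParams α) (h : {z | 0 < α z + r} ∈ localFacet y F) :
    {z | 0 < α z + r} ∈ 𝔸.facet y F := by
  classical
  have he : 𝔸.halfSpaceInter (fun β => if β = α then (r : WithTop ℝ) else ⊤) univ =
      {z | 0 < α z + r} := by
    ext z
    constructor
    · intro hz
      exact (hz α hα r (by simp)).2 trivial
    · intro hz β hβ s hs
      by_cases hb : β = α
      · subst hb
        simp only [if_true, WithTop.coe_inj] at hs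
        subst hs
        exact ⟨le_of_lt hz, fun _ => hz⟩
      · simp [hb] at hs
  refine ⟨_, univ, ?_, he ▸ h, he.le⟩
  intro β hβ s hs
  by_cases hb : β = α
  · subst hb
    simp only [if_true, WithTop.coe_inj] at hs
    exact hs ▸ hr
  · simp [hb] at hs

variable [FiniteDimensional ℝ V]

lemma continuous_of_linear_part {w : V → V} {u : V ≃ₗ[ℝ] V} (hw : ∀ x v, w (x + v) = w x + u v) :
    Continuous w := by
  have : w = fun v => w 0 + u v := funext fun v => by rw [← hw, zero_add]
  rw [this]
  exact continuous_const.add u.toLinearMap.continuous_of_finiteDimensional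

/-- The Weyl group permutes the facets. -/
lemma map_facet {w : Equiv.Perm V} (hwW : w ∈ 𝔸.weyl) {u : V ≃ₗ[ℝ] V}
    (hu : u ∈ 𝔸.vWeyl) (hw : ∀ x v, w (x + v) = w x + u v) :
    map w (𝔸.facet x F) = 𝔸.facet (w x) (u '' F) := by
  have key : ∀ {w : Equiv.Perm V} (_ : w ∈ 𝔸.weyl) {u : V ≃ₗ[ℝ] V} (_ : u ∈ 𝔸.vWeyl)
      (_ : ∀ x v, w (x + v) = w x + u v) (x : V) (F : Set V),
      map w (𝔸.facet x F) ≤ 𝔸.facet (w x) (u '' F) := by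
    intro w hwW u hu hw x F
    rintro S ⟨k, o, hk, hE, hS⟩
    obtain ⟨k', o', hk', he⟩ := exists_preimage_halfSpaceInter hwW hu hw hk o
    refine ⟨k', o', hk', ?_, he ▸ preimage_mono hS⟩
    rw [← he]
    have ht : Tendsto w (localFacet x F) (localFacet (w x) (u '' F)) := by
      refine ((continuous_of_linear_part hw).continuousWithinAt).tendsto_nhdsWithin ?_
      rintro _ ⟨v, hv, rfl⟩
      exact ⟨u v, ⟨v, hv, rfl⟩, (hw x v).symm⟩
    exact ht hE
  refine le_antisymm (key hwW hu hw x F) ?_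
  have hw' : ∀ x v, w⁻¹ (x + v) = w⁻¹ x + u⁻¹ v := fun x v => by
    apply w.injective
    rw [hw, Equiv.Perm.inv_def, Equiv.apply_symm_apply, Equiv.apply_symm_apply]
    congr 1
    exact (u.apply_symm_apply v).symm
  have h1 := key (inv_mem hwW) (inv_mem hu) hw' (w x) (u '' F)
  have e1 : (w⁻¹ : Equiv.Perm V) (w x) = x := w.symm_apply_apply x
  have e2 : (u⁻¹ : V ≃ₗ[ℝ] V) '' (u '' F) = F := by
    rw [image_image]
    exact (image_congr fun v _ => u.symm_apply_apply v).trans (image_id _)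
  rw [e1, e2] at h1
  have h2 := map_mono (m := w) h1
  rw [map_map] at h2
  have e3 : (w ∘ (w⁻¹ : Equiv.Perm V)) = id := funext fun z => w.apply_symm_apply z
  rwa [e3, map_id] at h2

lemma eventually_sub_mem (hF : 𝔸.IsVFacet F) {ξ : V} (hξ : ξ ∈ F) :
    ∀ᶠ η in 𝓝[F] (0 : V), ξ - η ∈ F := by
  obtain ⟨ε, J, hF⟩ := hF
  obtain ⟨w, hw, rfl⟩ := isFacetOfType_iff.1 hF
  have h1 : ∀ᶠ η in 𝓝 (0 : V), ∀ i, i ∉ J → 0 < 𝔸.chamberRoot ε w i (ξ - η) := by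
    rw [eventually_all]
    intro i
    by_cases hi : i ∈ J
    · simp [hi]
    · have hc : Continuous fun η => 𝔸.chamberRoot ε w i (ξ - η) :=
        (𝔸.chamberRoot ε w i).continuous_of_finiteDimensional.comp (by fun_prop)
      have := (hc.tendsto 0).eventually_const_lt (u := 0) (by simpa using hξ.2 i hi)
      filter_upwards [this] with η hη _ using hη
  filter_upwards [mem_nhdsWithin_of_mem_nhds h1, self_mem_nhdsWithin] with η h2 h3
  exact ⟨fun i hi => by rw [map_sub, hξ.1 i hi, h3.1 i hi, sub_zero], h2⟩

/-- An enclosed set which contains a segment `[x, x + ξ]` with `ξ ∈ F^v` contains the local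
facet. -/
lemma halfSpaceInter_mem_localFacet (hF : 𝔸.IsVFacet F) {ξ : V} (hξ : ξ ∈ F)
    {k : Module.Dual ℝ V → WithTop ℝ} (hx : x ∈ 𝔸.halfSpaceInter k ∅)
    (hxξ : x + ξ ∈ 𝔸.halfSpaceInter k ∅) : 𝔸.halfSpaceInter k ∅ ∈ localFacet x F := by
  rw [mem_localFacet_iff]
  filter_upwards [eventually_sub_mem hF hξ, self_mem_nhdsWithin] with η h1 h2
  intro α hα r hr
  refine ⟨?_, fun h => h.elim⟩
  have hx := (hx α hα r hr).1
  have hxξ := (hxξ α hα r hr).1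
  rw [map_add] at hxξ ⊢
  by_cases h : 0 ≤ α η
  · linarith
  -- If `α η < 0`, then `α` is nonpositive on `F`, in particular at `ξ - η`; so its value at `x + η`
  -- is at least its value at `x + ξ`.
  · have h3 := hF.nonneg (neg_mem_roots hα) h2 (by rw [LinearMap.neg_apply]; linarith)
      (subset_closure h1)
    rw [LinearMap.neg_apply, map_sub] at h3
    linarith

/-- A half-space or the opposite open half-space contains a given local facet. -/
lemma mem_localFacet_or (hF : 𝔸.IsVFacet F) {α : Module.Dual ℝ V} (hα : α ∈ 𝔸.roots) (r : ℝ) :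
    {z | 0 < α z + r} ∈ localFacet y F ∨ {z | 0 ≤ -α z - r} ∈ localFacet y F := by
  have hc : Continuous fun z => α z + r :=
    α.continuous_of_finiteDimensional.add continuous_const
  rcases lt_trichotomy (α y + r) 0 with h | h | h
  · right
    refine mem_nhdsWithin_of_mem_nhds ?_
    filter_upwards [hc.continuousAt.eventually_lt_const h] with z hz
    linarith
  · by_cases h1 : ∃ v ∈ F, α v ≤ 0
    · right
      obtain ⟨v, hv, hv0⟩ := h1
      rw [mem_localFacet_iff]
      filter_upwards [self_mem_nhdsWithin] with η hη
      have := hF.nonneg (neg_mem_roots hα) hv (by simpa using hv0) (subset_closure hη)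
      rw [LinearMap.neg_apply] at this
      change 0 ≤ -α (y + η) - r
      rw [map_add]
      linarith
    · left
      push Not at h1
      rw [mem_localFacet_iff]
      filter_upwards [self_mem_nhdsWithin] with η hη
      have := h1 η hη
      change 0 < α (y + η) + r
      rw [map_add]
      linarith
  · left
    exact mem_nhdsWithin_of_mem_nhds (hc.continuousAt.eventually_const_lt h)

/-- If a facet is contained in another one, both are contained in the same half-spaces. -/
lemma halfSpace_mem_of_facet_le (hF : 𝔸.IsVFacet F) (hG : 𝔸.IsVFacet G)
    (hle : 𝔸.facet x F ≤ 𝔸.facet y G) {α : Module.Dual ℝ V} (hα : α ∈ 𝔸.roots) {r : ℝ}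
    (hr : r ∈ 𝔸.wallParams α) (h : {z | 0 ≤ α z + r} ∈ localFacet x F) :
    {z | 0 ≤ α z + r} ∈ 𝔸.facet y G := by
  -- Otherwise the facet at `y` would have the opposite open half-space as an element. So would the
  -- facet at `x`, which is a proper filter and already contains the disjoint closed one.
  rcases mem_localFacet_or (y := y) hG (neg_mem_roots hα) (-r) with h1 | h1
  · exfalso
    have h2 := hle (openHalfSpace_mem_facet (neg_mem_roots hα) (neg_mem_wallParams hr) h1)
    have := facet_neBot (𝔸 := 𝔸) (x := x) hF
    obtain ⟨z, hz, hz'⟩ := Filter.nonempty_of_mem (inter_mem h2 (halfSpace_mem_facet hα hr h))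
    have hz : 0 < (-α) z + -r := hz
    have hz' : 0 ≤ α z + r := hz'
    rw [LinearMap.neg_apply] at hz
    linarith
  · refine halfSpace_mem_facet hα hr ?_
    convert h1 using 4
    simp

lemma openHalfSpace_mem_of_facet_le (hF : 𝔸.IsVFacet F) (hG : 𝔸.IsVFacet G)
    (hle : 𝔸.facet x F ≤ 𝔸.facet y G) {α : Module.Dual ℝ V} (hα : α ∈ 𝔸.roots) {r : ℝ}
    (hr : r ∈ 𝔸.wallParams α) (h : {z | 0 < α z + r} ∈ localFacet x F) :
    {z | 0 < α z + r} ∈ 𝔸.facet y G := by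
  rcases mem_localFacet_or (y := y) hG hα r with h1 | h1
  · exact openHalfSpace_mem_facet hα hr h1
  · exfalso
    have h2 := hle (halfSpace_mem_facet (neg_mem_roots hα) (neg_mem_wallParams hr)
      (by convert h1 using 4; simp [sub_eq_add_neg]))
    have := facet_neBot (𝔸 := 𝔸) (x := x) hF
    obtain ⟨z, hz, hz'⟩ := Filter.nonempty_of_mem (inter_mem h2 (openHalfSpace_mem_facet hα hr h))
    have hz : 0 ≤ (-α) z + -r := hz
    have hz' : 0 < α z + r := hz'
    rw [LinearMap.neg_apply] at hz
    linarith

end ModelApartment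

/-! ## Special points -/

namespace ModelApartment

open VectorialDatum SimpleRoots

section Algebra

variable {ι V : Type*} [Fintype ι] [AddCommGroup V] [Module ℝ V] {𝔸 : ModelApartment ι V}

variable (𝔸) in
/-- A point is special if it lies on a wall in the direction of each simple root. -/
def IsSpecial (x : V) : Prop := ∀ i, affWall (𝔸.root i) (-𝔸.root i x) ∈ 𝔸.walls

variable (𝔸) in
/-- The values `t` such that `γ` takes the value `γ(x) + t` on a wall of direction `ker γ`. -/
def wallOffsets (x : V) (γ : Module.Dual ℝ V) : Set ℝ := {t | affWall γ (-γ x - t) ∈ 𝔸.walls}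

variable (𝔸) in
/-- The translations that stabilize the wall offsets. -/
def offsetTranslations (x : V) (γ : Module.Dual ℝ V) : AddSubgroup ℝ where
  carrier := {t | ∀ s, s ∈ 𝔸.wallOffsets x γ ↔ s + t ∈ 𝔸.wallOffsets x γ}
  zero_mem' := by simp
  add_mem' := by
    intro a b ha hb s
    rw [ha s, hb (s + a), add_assoc]
  neg_mem' := by
    intro a ha s
    rw [ha (s + -a), neg_add_cancel_right]

/-- One wall is chosen for each simple root. By freeness the simple roots take arbitrary values
simultaneously, so these walls have a common point. -/
lemma exists_isSpecial (𝔸 : ModelApartment ι V) : ∃ x, 𝔸.IsSpecial x := by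
  have h : ∀ i, ∃ k, affWall (𝔸.root i) k ∈ 𝔸.walls := fun i => by
    obtain ⟨M, hM, k, rfl⟩ := (𝔸.walls_infinite _ (𝔸.root_mem_realRoots i)).nonempty
    exact ⟨k, hM⟩
  choose k hk using h
  obtain ⟨x, hx⟩ := 𝔸.root_free.exists_dual_apply_eq fun i => -k i
  exact ⟨x, fun i => by rw [hx, neg_neg]; exact hk i⟩

lemma isRootPair_simple (i : ι) : 𝔸.IsRootPair (𝔸.root i) (𝔸.coroot i) :=
  ⟨1, one_mem _, i, rfl, rfl⟩

variable {x : V}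

/-- The stabilizer of a special point maps onto the vectorial Weyl group. -/
lemma IsSpecial.exists_weyl (hx : 𝔸.IsSpecial x) {u : V ≃ₗ[ℝ] V} (hu : u ∈ 𝔸.vWeyl) :
    ∃ w ∈ 𝔸.weyl, w x = x ∧ ∀ z v, w (z + v) = w z + u v := by
  induction hu using Subgroup.closure_induction with
  | mem g hg =>
    obtain ⟨i, rfl⟩ := hg
    refine ⟨wallReflection (isRootPair_simple i) _, wallReflection_mem _ (hx i), ?_, fun z v => ?_⟩
    · rw [wallReflection_apply]
      simp
    · rw [wallReflection_apply, wallReflection_apply, refl_apply, map_add]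
      module
  | one => exact ⟨1, one_mem _, rfl, fun _ _ => rfl⟩
  | mul u u' _ _ h h' =>
    obtain ⟨w, hw, hwx, hwl⟩ := h
    obtain ⟨w', hw', hwx', hwl'⟩ := h'
    refine ⟨w * w', mul_mem hw hw', by rw [Equiv.Perm.mul_apply, hwx', hwx], fun z v => ?_⟩
    rw [Equiv.Perm.mul_apply, hwl', hwl]
    rfl
  | inv u _ h =>
    obtain ⟨w, hw, hwx, hwl⟩ := h
    refine ⟨w⁻¹, inv_mem hw, w.injective ?_, fun z v => w.injective ?_⟩
    · rw [Equiv.Perm.inv_def, Equiv.apply_symm_apply, hwx]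
    · rw [hwl, Equiv.Perm.inv_def, Equiv.apply_symm_apply, Equiv.apply_symm_apply]
      congr 1
      exact (u.apply_symm_apply v).symm

/-- Some element of `W` fixes `x` and has linear part `u`; it permutes the walls without changing
their offsets from `x`. Hence all roots in an orbit share the offsets of a simple root. -/
lemma IsSpecial.wallOffsets_act (hx : 𝔸.IsSpecial x) {u : V ≃ₗ[ℝ] V} (hu : u ∈ 𝔸.vWeyl)
    (γ : Module.Dual ℝ V) : 𝔸.wallOffsets x (act u γ) = 𝔸.wallOffsets x γ := by
  have key : ∀ {u : V ≃ₗ[ℝ] V} (_ : u ∈ 𝔸.vWeyl) (γ : Module.Dual ℝ V),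
      𝔸.wallOffsets x γ ⊆ 𝔸.wallOffsets x (act u γ) := by
    intro u hu γ t ht
    obtain ⟨w, hw, hwx, hwl⟩ := hx.exists_weyl hu
    have h := image_mem_walls hw _ ht
    rw [image_affWall hwl _ _ x, hwx] at h
    change affWall (act u γ) _ ∈ 𝔸.walls
    convert h using 2
    ring
  refine Subset.antisymm ?_ (key hu γ)
  have := key (inv_mem hu) (act u γ)
  rwa [act_inv_act] at this

lemma IsSpecial.zero_mem_wallOffsets (hx : 𝔸.IsSpecial x) {γ : Module.Dual ℝ V}
    (hγ : γ ∈ 𝔸.realRoots) : 0 ∈ 𝔸.wallOffsets x γ := by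
  obtain ⟨a, u, hu, i, rfl, rfl⟩ := hγ
  rw [hx.wallOffsets_act hu]
  change affWall _ _ ∈ 𝔸.walls
  rw [sub_zero]
  exact hx i

lemma IsSpecial.neg_mem_wallOffsets (hx : 𝔸.IsSpecial x) {i : ι} {t : ℝ}
    (ht : t ∈ 𝔸.wallOffsets x (𝔸.root i)) : -t ∈ 𝔸.wallOffsets x (𝔸.root i) := by
  rw [← hx.wallOffsets_act (𝔸.refl_mem i), act_refl_root] at ht
  have ht : affWall (-𝔸.root i) (-(-𝔸.root i) x - t) ∈ 𝔸.walls := ht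
  change affWall _ _ ∈ 𝔸.walls
  rw [← affWall_neg]
  convert ht using 2
  rw [LinearMap.neg_apply]
  ring

lemma IsSpecial.exists_pos_mem_wallOffsets (hx : 𝔸.IsSpecial x) (i : ι) :
    ∃ t ∈ 𝔸.wallOffsets x (𝔸.root i), 0 < t := by
  have h : ∃ t ∈ 𝔸.wallOffsets x (𝔸.root i), t ≠ 0 := by
    by_contra hcon
    push Not at hcon
    refine 𝔸.walls_infinite _ (𝔸.root_mem_realRoots i)
      ((finite_singleton (affWall (𝔸.root i) (-𝔸.root i x))).subset ?_)
    rintro _ ⟨hM, k, rfl⟩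
    have := hcon (-𝔸.root i x - k) (by
      change affWall _ _ ∈ 𝔸.walls
      rwa [sub_sub_cancel])
    rw [mem_singleton_iff, sub_eq_zero.1 this]
  obtain ⟨t, ht, h0⟩ := h
  rcases lt_or_gt_of_ne h0 with h1 | h1
  · exact ⟨-t, hx.neg_mem_wallOffsets ht, neg_pos.2 h1⟩
  · exact ⟨t, ht, h1⟩

/-- The product of the reflections in two walls of direction `ker αⱼ` at offsets `0` and `t` is the
translation by `t αⱼ^∨`. It belongs to `W` and shifts the offsets of `γ` by `t γ(αⱼ^∨)`. -/
lemma IsSpecial.mul_coroot_mem (hx : 𝔸.IsSpecial x) {j : ι} {t : ℝ}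
    (ht : t ∈ 𝔸.wallOffsets x (𝔸.root j)) (γ : Module.Dual ℝ V) :
    t * γ (𝔸.coroot j) ∈ 𝔸.offsetTranslations x γ := by
  set τ : Equiv.Perm V := wallReflection (isRootPair_simple j) (-𝔸.root j x - t) *
    wallReflection (isRootPair_simple j) (-𝔸.root j x)
  have hτ : τ ∈ 𝔸.weyl := mul_mem (wallReflection_mem _ ht) (wallReflection_mem _ (hx j))
  have h1 : ∀ z, τ z = z + t • 𝔸.coroot j := fun z => by
    simp only [τ, Equiv.Perm.mul_apply, wallReflection_apply, map_sub, map_smul, smul_eq_mul,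
      𝔸.root_coroot]
    module
  have h2 : ∀ z v, τ (z + v) = τ z + (1 : V ≃ₗ[ℝ] V) v := fun z v => by
    rw [h1, h1, LinearEquiv.coe_one, id]
    abel
  have h3 : ∀ z v, τ⁻¹ (z + v) = τ⁻¹ z + (1 : V ≃ₗ[ℝ] V) v := fun z v => τ.injective <| by
    rw [h2, Equiv.Perm.inv_def, Equiv.apply_symm_apply, Equiv.apply_symm_apply]
    rfl
  intro s
  constructor
  · intro hs
    have h := image_mem_walls hτ _ hs
    rw [image_affWall h2 _ _ 0, h1, act_one] at h
    change affWall _ _ ∈ 𝔸.walls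
    convert h using 2
    simp
    ring
  · intro hs
    have h := image_mem_walls (inv_mem hτ) _ hs
    rw [image_affWall h3 _ _ (τ 0), act_one, Equiv.Perm.inv_def, Equiv.symm_apply_apply, h1] at h
    change affWall _ _ ∈ 𝔸.walls
    convert h using 2
    simp
    ring

/-- The coefficients of the roots in the orbit of a simple root lie in lattices. -/
lemma IsSpecial.exists_coeff (hx : 𝔸.IsSpecial x) {t : ι → ℝ}
    (ht : ∀ j, t j ∈ 𝔸.wallOffsets x (𝔸.root j)) (e : ι → ℝ) (i : ι)
    (he : 𝔸.root i = ∑ j, e j • 𝔸.root j) {u : V ≃ₗ[ℝ] V} (hu : u ∈ 𝔸.vWeyl) :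
    ∃ c : ι → ℝ, act u (𝔸.root i) = ∑ j, c j • 𝔸.root j ∧
      ∀ j, t j * (c j - e j) ∈ 𝔸.offsetTranslations x (𝔸.root i) := by
  classical
  have hT : ∀ u ∈ 𝔸.vWeyl, 𝔸.offsetTranslations x (act u (𝔸.root i)) =
      𝔸.offsetTranslations x (𝔸.root i) := fun u hu => by
    ext s
    change (∀ _, _ ↔ _) ↔ ∀ _, _ ↔ _
    rw [hx.wallOffsets_act hu]
  have step : ∀ (m : ι) (u : V ≃ₗ[ℝ] V), u ∈ 𝔸.vWeyl →
      (∃ c : ι → ℝ, act u (𝔸.root i) = ∑ j, c j • 𝔸.root j ∧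
        ∀ j, t j * (c j - e j) ∈ 𝔸.offsetTranslations x (𝔸.root i)) →
      ∃ c : ι → ℝ, act (𝔸.refl m * u) (𝔸.root i) = ∑ j, c j • 𝔸.root j ∧
        ∀ j, t j * (c j - e j) ∈ 𝔸.offsetTranslations x (𝔸.root i) := by
    rintro m u hu ⟨c, hc, hcT⟩
    -- Applying `r_m` changes only the coefficient of `α_m`, by `(u αᵢ)(α_m^∨)`; multiplied by `t m`
    -- this is an offset translation.
    refine ⟨fun j => c j - (if j = m then act u (𝔸.root i) (𝔸.coroot m) else 0), ?_, fun j => ?_⟩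
    · rw [act_mul, act_refl]
      ext v
      rw [LinearMap.sub_apply]
      nth_rewrite 1 [hc]
      simp [LinearMap.sum_apply, sub_mul, Finset.sum_sub_distrib]
    · by_cases hj : j = m
      · subst hj
        have h1 := hx.mul_coroot_mem (ht j) (act u (𝔸.root i))
        rw [hT u hu] at h1
        have h2 := sub_mem (hcT j) h1
        simp only [if_true]
        convert h2 using 1
        ring
      · simpa [hj] using hcT j
  induction hu using Subgroup.closure_induction_left with
  | one => exact ⟨e, he, fun j => by simp⟩
  | mul_left g hg u hu ih =>
    obtain ⟨m, rfl⟩ := hg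
    exact step m u hu ih
  | inv_mul_cancel g hg u hu ih =>
    obtain ⟨m, rfl⟩ := hg
    rw [𝔸.refl_inv]
    exact step m u hu ih

/-- As `0` is an offset, a translation is itself an offset; offsets being symmetric, a nonzero one
has absolute value at least `η`. -/
lemma offsetTranslations_bound (hx : 𝔸.IsSpecial x) {i : ι} {η : ℝ}
    (hη : ∀ t ∈ 𝔸.wallOffsets x (𝔸.root i), 0 < t → η ≤ t) {t : ℝ}
    (ht : t ∈ 𝔸.offsetTranslations x (𝔸.root i)) (hlt : |t| < η) : t = 0 := by
  have h1 : t ∈ 𝔸.wallOffsets x (𝔸.root i) := by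
    have := (ht 0).1 (hx.zero_mem_wallOffsets (𝔸.root_mem_realRoots i))
    rwa [zero_add] at this
  rcases lt_trichotomy t 0 with h | h | h
  · have := hη _ (hx.neg_mem_wallOffsets h1) (neg_pos.2 h)
    rw [abs_of_neg h] at hlt
    linarith
  · exact h
  · have := hη _ h1 h
    rw [abs_of_pos h] at hlt
    linarith

/-- A subset of a bounded interval on which distinct points have distance at least `η` in a
suitable scale is finite. -/
lemma finite_of_separated {A : Set ℝ} {c η M : ℝ} (hη : 0 < η) (hM : ∀ s ∈ A, |s| ≤ M)
    (hsep : ∀ s ∈ A, ∀ s' ∈ A, |c * (s - s')| < η → s = s') : A.Finite := by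
  -- This floor map is injective on `A`: equal floors mean that the scaled points differ by less
  -- than `η`.
  have h : MapsTo (fun s => ⌊c * s / η⌋) A (Icc ⌊-(|c| * M / η)⌋ ⌊|c| * M / η⌋) := by
    intro s hs
    have h1 : |c * s / η| ≤ |c| * M / η := by
      rw [abs_div, abs_mul, abs_of_pos hη]
      exact div_le_div_of_nonneg_right (mul_le_mul_of_nonneg_left (hM s hs) (abs_nonneg c)) hη.le
    exact ⟨Int.floor_le_floor (abs_le.1 h1).1, Int.floor_le_floor (abs_le.1 h1).2⟩
  refine Finite.of_injOn h ?_ (finite_Icc _ _)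
  intro s hs s' hs' he
  refine hsep s hs s' hs' ?_
  have h1 := Int.abs_sub_lt_one_of_floor_eq_floor he
  rw [← sub_div, abs_div, abs_of_pos hη, div_lt_one hη, ← mul_sub] at h1
  exact h1

/-- If the walls of direction `αᵢ` are not dense, there are finitely many roots in the orbit of
`αᵢ` with bounded value at a point of a chamber. -/
lemma IsSpecial.finite_roots (hx : 𝔸.IsSpecial x) {i : ι} {η : ℝ} (hη0 : 0 < η)
    (hη : ∀ t ∈ 𝔸.wallOffsets x (𝔸.root i), 0 < t → η ≤ t) {ε : ℤˣ} {w : V ≃ₗ[ℝ] V}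
    (hw : w ∈ 𝔸.vWeyl) {ξ : V} (hξ : ξ ∈ face (𝔸.chamberRoot ε w) ∅) (N : ℝ) :
    {γ : Module.Dual ℝ V | (∃ u ∈ 𝔸.vWeyl, γ = act u (𝔸.root i)) ∧ |γ ξ| ≤ N}.Finite := by
  classical
  choose t ht ht0 using hx.exists_pos_mem_wallOffsets
  set e : ι → ℝ := fun j => if j = i then 1 else 0
  have he : 𝔸.root i = ∑ j, e j • 𝔸.root j := by simp [e]
  have key : ∀ ξ ∈ face 𝔸.root ∅, ∀ N : ℝ,
      {γ : Module.Dual ℝ V | (∃ u ∈ 𝔸.vWeyl, γ = act u (𝔸.root i)) ∧ |γ ξ| ≤ N}.Finite := by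
    intro ξ hξ N
    -- All coefficients of a root have the same sign, so a bound on its value at `ξ` bounds each
    -- coefficient; each of them, once scaled, also lies in a translate of a discrete group.
    let A : ι → Set ℝ := fun j => {s | t j * (s - e j) ∈ 𝔸.offsetTranslations x (𝔸.root i) ∧
      |s| ≤ N / 𝔸.root j ξ}
    have hA : ∀ j, (A j).Finite := fun j => by
      refine finite_of_separated (c := t j) hη0 (fun s hs => hs.2) fun s hs s' hs' hlt => ?_
      have h1 := sub_mem hs.1 hs'.1
      rw [← mul_sub, sub_sub_sub_cancel_right] at h1
      have h2 := offsetTranslations_bound hx hη h1 hlt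
      exact sub_eq_zero.1 ((mul_eq_zero.1 h2).resolve_left (ht0 j).ne')
    refine ((Finite.pi hA).image fun c => ∑ j, c j • 𝔸.root j).subset ?_
    rintro γ ⟨⟨u, hu, rfl⟩, hN⟩
    obtain ⟨c, hc, hcT⟩ := hx.exists_coeff ht e i he hu
    refine ⟨c, fun j _ => ⟨hcT j, ?_⟩, hc.symm⟩
    have hpos : ∀ j, 0 < 𝔸.root j ξ := fun j => hξ.2 j (notMem_empty j)
    have huniq : ∀ d : ι → ℝ, act u (𝔸.root i) = ∑ j, d j • 𝔸.root j → ∀ j, c j = d j := by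
      intro d hd j
      have h0 : ∑ j, (c j - d j) • 𝔸.root j = 0 := by
        ext v
        have := LinearMap.congr_fun (hc.symm.trans hd) v
        simp only [LinearMap.sum_apply, LinearMap.smul_apply, smul_eq_mul] at this
        simp [LinearMap.sum_apply, sub_mul, Finset.sum_sub_distrib, this]
      exact sub_eq_zero.1 (Fintype.linearIndependent_iff.1 𝔸.root_free _ h0 j)
    rw [le_div_iff₀ (hpos j)]
    have hval : act u (𝔸.root i) ξ = ∑ j, c j * 𝔸.root j ξ := by
      rw [hc]; simp [LinearMap.sum_apply]
    have hsum : |c j| * 𝔸.root j ξ ≤ |act u (𝔸.root i) ξ| := by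
      rcases 𝔸.pos_or_neg _ (act_mem_realRoots (𝔸.root_mem_realRoots i) hu) with
        ⟨d, hd0, hd⟩ | ⟨d, hd0, hd⟩
      · have hcd := huniq d hd
        have hnn : ∀ j, 0 ≤ c j * 𝔸.root j ξ := fun j =>
          mul_nonneg (hcd j ▸ hd0 j) (hpos j).le
        rw [hval, abs_of_nonneg (Finset.sum_nonneg fun j _ => hnn j),
          abs_of_nonneg (hcd j ▸ hd0 j)]
        exact Finset.single_le_sum (f := fun j => c j * 𝔸.root j ξ) (fun j _ => hnn j)
          (Finset.mem_univ j)
      · have hcd := huniq (fun j => -d j) (by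
          rw [← neg_neg (act u (𝔸.root i)), hd]
          ext v
          simp [LinearMap.sum_apply])
        have hc0 : ∀ j, c j ≤ 0 := fun j => by rw [hcd j]; simpa using hd0 j
        have hnp : ∀ j, 0 ≤ -c j * 𝔸.root j ξ := fun j =>
          mul_nonneg (neg_nonneg.2 (hc0 j)) (hpos j).le
        have hval' : -act u (𝔸.root i) ξ = ∑ j, -c j * 𝔸.root j ξ := by
          rw [hval]; simp
        rw [← abs_neg (act u (𝔸.root i) ξ), hval',
          abs_of_nonneg (Finset.sum_nonneg fun j _ => hnp j), abs_of_nonpos (hc0 j)]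
        exact Finset.single_le_sum (f := fun j => -c j * 𝔸.root j ξ) (fun j _ => hnp j)
          (Finset.mem_univ j)
    exact hsum.trans hN
  refine ((key _ (mem_face_chamberRoot.1 hξ) N).image (act w)).subset ?_
  rintro γ ⟨⟨u, hu, rfl⟩, hN⟩
  refine ⟨act w⁻¹ (act u (𝔸.root i)), ⟨⟨w⁻¹ * u, mul_mem (inv_mem hw) hu, rfl⟩, ?_⟩,
    act_act_inv _ _⟩
  have h1 : act w⁻¹ (act u (𝔸.root i)) (w⁻¹ ξ) = act u (𝔸.root i) ξ := act_apply_apply _ _ _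
  rw [map_smul, h1, smul_eq_mul, abs_mul]
  have h2 : |((ε : ℤ) : ℝ)| = 1 := by
    rcases Int.units_eq_one_or ε with rfl | rfl <;> simp
  rw [h2, one_mul]
  exact hN

lemma IsSpecial.neg_apply_mem_wallParams (hx : 𝔸.IsSpecial x) {γ : Module.Dual ℝ V}
    (hγ : γ ∈ 𝔸.realRoots) : -γ x ∈ 𝔸.wallParams γ := by
  have := hx.zero_mem_wallOffsets hγ
  have : affWall γ (-γ x - 0) ∈ 𝔸.walls := this
  rw [sub_zero] at this
  exact Or.inr this

end Algebra

end ModelApartment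

/-! ## Chambers at a special point -/

namespace ModelApartment

open VectorialDatum SimpleRoots

variable {ι V : Type*} [Fintype ι] [NormedAddCommGroup V] [NormedSpace ℝ V]
  [FiniteDimensional ℝ V] {𝔸 : ModelApartment ι V} {F G : Set V} {x y : V}

lemma le_of_mem_localFacet (hF : 𝔸.IsVFacet F) (α : Module.Dual ℝ V) {r : ℝ} {S : Set V}
    (hS : S ∈ localFacet x F) (h : ∀ z ∈ S, 0 ≤ α z + r) : 0 ≤ α x + r := by
  have hc : IsClosed {z | 0 ≤ α z + r} :=
    isClosed_le continuous_const (α.continuous_of_finiteDimensional.add continuous_const)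
  exact closure_minimal h hc (mem_closure_of_mem_localFacet hF hS)

/-- A chamber based at a special point is minimal among the facets. -/
lemma IsSpecial.facet_eq_of_le (hx : 𝔸.IsSpecial x) {ε : ℤˣ} {w : V ≃ₗ[ℝ] V} (hw : w ∈ 𝔸.vWeyl)
    (hG : 𝔸.IsVFacet G) (hle : 𝔸.facet x (face (𝔸.chamberRoot ε w) ∅) ≤ 𝔸.facet y G) :
    𝔸.facet x (face (𝔸.chamberRoot ε w) ∅) = 𝔸.facet y G := by
  classical
  refine le_antisymm hle ?_
  rintro S ⟨k, o, hk, hE, hS⟩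
  refine ⟨k, o, hk, ?_, hS⟩
  set b := 𝔸.chamberRoot ε w
  have hC : 𝔸.IsVFacet (face b ∅) := ⟨ε, ∅, isFacetOfType_face ε hw ∅⟩
  have hbr : ∀ i, b i ∈ 𝔸.roots := fun i => Or.inl (chamberRoot_mem_realRoots ε hw i)
  have hxr : ∀ β ∈ 𝔸.roots, ∀ r : ℝ, k β = r → 0 ≤ β x + r := fun β hβ r hr =>
    le_of_mem_localFacet hC β hE fun z hz => (hz β hβ r hr).1
  obtain ⟨_, hzE, ξ, hξ, rfl⟩ : (𝔸.halfSpaceInter k o ∩ (fun v => x + v) '' face b ∅).Nonempty := by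
    have := localFacet_neBot (𝔸 := 𝔸) (x := x) hC
    exact Filter.nonempty_of_mem (inter_mem hE self_mem_nhdsWithin)
  have hchamber : ∀ᶠ z in localFacet y G, ∀ i, 0 < b i z + -b i x := by
    rw [eventually_all]
    intro i
    refine localFacet_le_facet (openHalfSpace_mem_of_facet_le hC hG hle (hbr i)
      (hx.neg_apply_mem_wallParams (chamberRoot_mem_realRoots ε hw i)) ?_)
    rw [mem_localFacet_iff]
    filter_upwards [self_mem_nhdsWithin] with η hη
    rw [map_add]
    linarith [hη.2 i (notMem_empty i)]
  -- If `y` were strictly beyond the wall at offset `t > 0`, the half-space beyond it would contain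
  -- the facet at `x`, whose closure contains `x`; this is absurd.
  have hgap : ∀ γ ∈ 𝔸.roots, ∀ t : ℝ, 0 < t → -γ x - t ∈ 𝔸.wallParams γ → γ y ≤ γ x + t := by
    intro γ hγ t ht hwt
    by_contra hlt
    have h1 : {z | 0 < γ z + (-γ x - t)} ∈ localFacet y G := by
      refine mem_nhdsWithin_of_mem_nhds ?_
      have hc : Continuous fun z => γ z + (-γ x - t) :=
        γ.continuous_of_finiteDimensional.add continuous_const
      exact hc.continuousAt.eventually_const_lt (by linarith)
    have h2 := localFacet_le_facet (hle (openHalfSpace_mem_facet hγ hwt h1))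
    have := le_of_mem_localFacet hC γ h2 fun z hz => le_of_lt hz
    linarith
  choose T hT hT0 using hx.exists_pos_mem_wallOffsets
  -- `P i` says that the offsets of `αᵢ` do not accumulate at `0` from above. Under it, only
  -- finitely many roots of the orbit are small at `ξ`; these form `Bad` and are treated one by one,
  -- while all other roots need a uniform estimate.
  let P : ι → Prop := fun i => ∃ η : ℝ, 0 < η ∧ ∀ t ∈ 𝔸.wallOffsets x (𝔸.root i), 0 < t → η ≤ t
  let Bad : Set (Module.Dual ℝ V) := ⋃ i, {γ | P i ∧ (∃ u ∈ 𝔸.vWeyl, γ = act u (𝔸.root i)) ∧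
    |γ ξ| ≤ 2 * ∑ j, T j}
  have hBadfin : Bad.Finite := by
    refine finite_iUnion fun i => ?_
    by_cases hP : P i
    · obtain ⟨η, hη0, hη⟩ := id hP
      exact (hx.finite_roots hη0 hη hw hξ (2 * ∑ j, T j)).subset fun γ hγ => hγ.2
    · exact finite_empty.subset fun γ hγ => hP hγ.1
  have hsingle : ∀ β ∈ 𝔸.roots, ∀ r : ℝ, k β = r →
      ∀ᶠ z in localFacet y G, 0 ≤ β z + r ∧ (β ∈ o → 0 < β z + r) := by
    intro β hβ r hr
    have h1 : ∀ᶠ z in localFacet y G, 0 ≤ β z + r :=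
      localFacet_le_facet (halfSpace_mem_of_facet_le hC hG hle hβ (hk β hβ r hr)
        (mem_of_superset hE fun z hz => (hz β hβ r hr).1))
    by_cases ho : β ∈ o
    · have h2 : ∀ᶠ z in localFacet y G, 0 < β z + r :=
        localFacet_le_facet (openHalfSpace_mem_of_facet_le hC hG hle hβ (hk β hβ r hr)
          (mem_of_superset hE fun z hz => (hz β hβ r hr).2 ho))
      filter_upwards [h2] with z hz using ⟨hz.le, fun _ => hz⟩
    · filter_upwards [h1] with z hz using ⟨hz, fun h => (ho h).elim⟩
  have hBad : ∀ᶠ z in localFacet y G, ∀ γ ∈ Bad, -γ ∈ 𝔸.roots → ∀ r : ℝ, k (-γ) = r →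
      0 ≤ (-γ) z + r ∧ (-γ ∈ o → 0 < (-γ) z + r) := by
    refine (eventually_all_finite hBadfin).2 fun γ _ => ?_
    by_cases hγ : -γ ∈ 𝔸.roots
    · cases hkγ : k (-γ) with
      | top => simp
      | coe r =>
        filter_upwards [hsingle _ hγ r hkγ] with z hz _ s hs
        rw [WithTop.coe_inj] at hs
        exact hs ▸ hz
    · simp [hγ]
  -- For such `z`, every root `γ` positive on the chamber satisfies `γ(z - y) < γ(ξ)/2`. Together
  -- with `γ(y) ≤ γ(x) + γ(ξ)/2` and the fact that `x + ξ` lies in the set, this settles infinitely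
  -- many roots at once.
  have hnear : ∀ᶠ z in 𝓝 y, ∀ i, 0 < b i ((1 / 2 : ℝ) • ξ - (z - y)) := by
    rw [eventually_all]
    intro i
    have hc : Continuous fun z => b i ((1 / 2 : ℝ) • ξ - (z - y)) :=
      (b i).continuous_of_finiteDimensional.comp (by fun_prop)
    refine hc.continuousAt.eventually_const_lt ?_
    have := hξ.2 i (notMem_empty i)
    change 0 < b i ((1 / 2 : ℝ) • ξ - (y - y))
    rw [sub_self, sub_zero, map_smul, smul_eq_mul]
    linarith
  filter_upwards [hchamber, hBad, mem_nhdsWithin_of_mem_nhds hnear] with z hz1 hz2 hz3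
  intro β hβ r hr
  rcases isPosComb_or_neg hβ ε hw with hp | hp
  · have h1 : 0 < β (z - x) := pos_of_mem_chamber hβ hp
      ⟨fun i hi => hi.elim, fun i _ => by rw [map_sub]; linarith [hz1 i]⟩
    have h2 := hxr β hβ r hr
    rw [map_sub] at h1
    have h3 : 0 < β z + r := by linarith
    exact ⟨h3.le, fun _ => h3⟩
  · by_cases hbad : -β ∈ Bad
    · have := hz2 (-β) hbad
      rw [neg_neg] at this
      exact this hβ r hr
    · have hγ := neg_mem_roots hβ
      have hγξ : 0 < (-β) ξ := pos_of_mem_chamber hγ hp hξ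
      have h1 := (hzE β hβ r hr).1
      have h2 : 0 < (-β) ((1 / 2 : ℝ) • ξ - (z - y)) := pos_of_mem_chamber hγ hp
        ⟨fun i hi => hi.elim, fun i _ => hz3 i⟩
      -- The point `y` is not beyond any wall at a positive offset. Either such offsets are
      -- arbitrarily small, or the offset `T i` is at most half of the value at `ξ` because the root
      -- is not in `Bad`.
      have h3 : (-β) y ≤ (-β) x ∨ (-β) y ≤ (-β) x + (-β) ξ / 2 := by
        rcases id hγ with hre | him
        · obtain ⟨a, u, hu, i, he, -⟩ := id hre
          have hoff : ∀ t ∈ 𝔸.wallOffsets x (𝔸.root i), 0 < t → (-β) y ≤ (-β) x + t := by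
            intro t ht ht0
            refine hgap _ hγ t ht0 (Or.inr ?_)
            rw [← hx.wallOffsets_act hu, ← he] at ht
            exact ht
          by_cases hP : P i
          · right
            have h4 : 2 * ∑ j, T j < |(-β) ξ| := by
              by_contra hcon
              exact hbad (mem_iUnion.2 ⟨i, hP, ⟨u, hu, he⟩, not_lt.1 hcon⟩)
            rw [abs_of_pos hγξ] at h4
            have h5 : T i ≤ ∑ j, T j :=
              Finset.single_le_sum (fun j _ => (hT0 j).le) (Finset.mem_univ i)
            have h6 := hoff (T i) (hT i) (hT0 i)
            linarith
          · left
            refine le_of_forall_pos_le_add fun δ hδ => ?_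
            have : ∃ t ∈ 𝔸.wallOffsets x (𝔸.root i), 0 < t ∧ t < δ := by
              by_contra hcon
              push Not at hcon
              exact hP ⟨δ, hδ, hcon⟩
            obtain ⟨t, ht, ht0, htδ⟩ := this
            have := hoff t ht ht0
            linarith
        · left
          exact le_of_forall_pos_le_add fun δ hδ => hgap _ hγ δ hδ (Or.inl him)
      have h4 : 0 < β z + r := by
        simp only [LinearMap.neg_apply, map_sub, map_smul, smul_eq_mul, map_add] at *
        rcases h3 with h3 | h3 <;> linarith
      exact ⟨h4.le, fun _ => h4⟩

/-- If a panel is contained in the closure of a facet that lies strictly on one side of its wall,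
the facet contains the chamber on this side of the panel. -/
lemma facet_le_of_le_closure {ε : ℤˣ} {w : V ≃ₗ[ℝ] V} (hw : w ∈ 𝔸.vWeyl) (hG : 𝔸.IsVFacet G)
    {i : ι}
    (hside : {z | 0 < 𝔸.chamberRoot ε w i z + -𝔸.chamberRoot ε w i x} ∈ 𝔸.facet y G)
    (hle : 𝔸.facet x (face (𝔸.chamberRoot ε w) {i}) ≤ (𝔸.facet y G).lift' closure) :
    𝔸.facet x (face (𝔸.chamberRoot ε w) ∅) ≤ 𝔸.facet y G := by
  rintro S ⟨k, o, hk, hE, hS⟩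
  refine ⟨k, o, hk, ?_, hS⟩
  set b := 𝔸.chamberRoot ε w
  have hF : 𝔸.IsVFacet (face b {i}) := ⟨ε, {i}, isFacetOfType_face ε hw {i}⟩
  have hbr : b i ∈ 𝔸.realRoots := chamberRoot_mem_realRoots ε hw i
  set E₁ := 𝔸.halfSpaceInter k o ∩ {z | 0 < b i z + -b i x}
  have hE₁ : E₁ ∈ 𝔸.facet y G := inter_mem ⟨k, o, hk, hE, Subset.rfl⟩ hside
  have hcl : closure E₁ ∈ localFacet x (face b {i}) := localFacet_le_facet (hle (mem_lift' hE₁))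
  have hsub : ∀ β ∈ 𝔸.roots, ∀ r : ℝ, k β = r → ∀ z ∈ closure E₁, 0 ≤ β z + r := by
    intro β hβ r hr z hz
    have hc : IsClosed {z | 0 ≤ β z + r} :=
      isClosed_le continuous_const (β.continuous_of_finiteDimensional.add continuous_const)
    exact closure_minimal (fun z hz => (hz.1 β hβ r hr).1) hc hz
  have hxr : ∀ β ∈ 𝔸.roots, ∀ r : ℝ, k β = r → 0 ≤ β x + r := fun β hβ r hr =>
    le_of_mem_localFacet hF β hcl (hsub β hβ r hr)
  obtain ⟨_, hzE, ξ, hξ, rfl⟩ : (closure E₁ ∩ (fun v => x + v) '' face b {i}).Nonempty := by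
    have := localFacet_neBot (𝔸 := 𝔸) (x := x) hF
    exact Filter.nonempty_of_mem (inter_mem hcl self_mem_nhdsWithin)
  set ρ : V ≃ₗ[ℝ] V := w * 𝔸.refl i * w⁻¹
  have hρ : ρ ∈ 𝔸.vWeyl := mul_mem (mul_mem hw (𝔸.refl_mem i)) (inv_mem hw)
  have hρ1 : ∀ v, w⁻¹ (ρ v) = 𝔸.refl i (w⁻¹ v) := fun v => by
    simp only [ρ, LinearEquiv.mul_apply]
    exact w.symm_apply_apply _
  have hρb : ∀ v, b i (ρ v) = -b i v := fun v => by
    simp only [b, chamberRoot_apply, hρ1, map_smul, refl_apply, map_sub, 𝔸.root_coroot,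
      smul_eq_mul]
    ring
  have hρξ : ρ ξ = ξ := by
    apply (w⁻¹ : V ≃ₗ[ℝ] V).injective
    have h0 : 𝔸.root i (w⁻¹ ξ) = 0 := by
      have h1 : b i ξ = 0 := hξ.1 i rfl
      simp only [b, chamberRoot_apply, map_smul (𝔸.root i), smul_eq_mul] at h1
      refine (mul_eq_zero.1 h1).resolve_left fun h => ?_
      have := sign_mul_self ε
      rw [h] at this
      simp at this
    rw [hρ1, refl_apply, h0, zero_smul, sub_zero]
  have hnear : ∀ᶠ η in 𝓝 (0 : V), ∀ j, j ≠ i → 0 < b j (ξ - ρ η) := by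
    rw [eventually_all]
    intro j
    by_cases hj : j = i
    · simp [hj]
    · have hc : Continuous fun η => b j (ξ - ρ η) :=
        (b j).continuous_of_finiteDimensional.comp
          (continuous_const.sub ρ.toLinearMap.continuous_of_finiteDimensional)
      have := (hc.tendsto 0).eventually_const_lt (u := 0)
        (by rw [map_zero, sub_zero]; exact hξ.2 j hj)
      filter_upwards [this] with η hη _ using hη
  -- The nonempty set `E₁` lies strictly on the positive side of the hyperplane `b i = b i x`, so
  -- the half-space of `-b i` cannot be bounded by this hyperplane: there is room at `x`.
  have hwall : ∀ᶠ η in 𝓝 (0 : V), ∀ r : ℝ, k (-b i) = r → 0 < (-b i) (x + η) + r := by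
    cases hk' : k (-b i) with
    | top => simp
    | coe r =>
      have hr : 0 < (-b i) x + r := by
        refine lt_of_le_of_ne (hxr _ (Or.inl (neg_mem_realRoots hbr)) r hk') fun h0 => ?_
        have := facet_neBot (𝔸 := 𝔸) (x := y) hG
        obtain ⟨z, hz1, hz2⟩ := Filter.nonempty_of_mem hE₁
        have h1 := (hz1 _ (Or.inl (neg_mem_realRoots hbr)) r hk').1
        have hz2 : 0 < b i z + -b i x := hz2
        rw [LinearMap.neg_apply] at h0 h1
        linarith
      have hc : Continuous fun η => (-b i) (x + η) + r :=
        ((-b i).continuous_of_finiteDimensional.comp (by fun_prop)).add continuous_const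
      have := (hc.tendsto 0).eventually_const_lt (u := 0) (by rw [add_zero]; exact hr)
      filter_upwards [this] with η hη s hs
      rw [WithTop.coe_inj] at hs
      exact hs ▸ hη
  rw [mem_localFacet_iff]
  filter_upwards [mem_nhdsWithin_of_mem_nhds hnear, mem_nhdsWithin_of_mem_nhds hwall,
    self_mem_nhdsWithin] with η h1 h2 h3
  intro β hβ r hr
  suffices hpos : 0 < β (x + η) + r from ⟨hpos.le, fun _ => hpos⟩
  have hx0 := hxr β hβ r hr
  rcases isPosComb_or_neg hβ ε hw with hp | hp
  · have := pos_of_mem_chamber hβ hp h3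
    rw [map_add]
    linarith
  · have hγ := neg_mem_roots hβ
    rcases (hp.nonneg (face_subset_closedFace hξ)).eq_or_lt with h0 | h0
    -- A root that is a positive combination and vanishes inside the panel is a multiple of `b i`.
    -- It is not imaginary, and reducedness makes it equal to `b i`.
    · have he : -β = b i := by
        obtain ⟨c, hc, hsum⟩ := id hp
        have hci : -β = c i • b i := by
          rw [hsum]
          refine Finset.sum_eq_single i (fun j _ hj => ?_) (by simp)
          rw [IsPosComb.coeff_eq_zero hc hξ (by rw [← hsum]; exact h0.ge) hj, zero_smul]
        rcases id hγ with hre | him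
        · rw [hci] at hre ⊢
          exact 𝔸.reduced _ hbr _ (hc i) hre
        · exact absurd hci (𝔸.imag_disjoint _ him _ hbr _)
      have he' : β = -b i := by rw [← he, neg_neg]
      rw [he'] at hr ⊢
      exact h2 r hr
    -- The reflection `ρ` fixes `ξ`, so `ρ(-β)` is positive there and hence on the chamber. As `ξ -
    -- ρ η` lies in the chamber for small `η`, uniformly in `β`, this gives `β η > β ξ`, and `x + ξ`
    -- already satisfies the inequality for `β`.
    · have hδ := act_mem_roots hγ hρ
      have hδv : ∀ v, act ρ (-β) (ρ v) = (-β) v := fun v => act_apply_apply _ _ _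
      have hδξ : 0 < act ρ (-β) ξ := by
        rw [← hρξ, hδv]
        exact h0
      have hδp : IsPosComb b (act ρ (-β)) := by
        refine (isPosComb_or_neg hδ ε hw).resolve_right fun hn => ?_
        have := hn.nonneg (face_subset_closedFace hξ)
        rw [LinearMap.neg_apply] at this
        linarith
      have hmem : ξ - ρ η ∈ face b ∅ := by
        refine ⟨fun j hj => hj.elim, fun j _ => ?_⟩
        by_cases hj : j = i
        · subst hj
          rw [map_sub, hρb, hξ.1 j rfl]
          linarith [h3.2 j (notMem_empty j)]
        · exact h1 j hj
      have h4 := pos_of_mem_chamber hδ hδp hmem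
      have h5 : ξ - ρ η = ρ (ξ - η) := by rw [map_sub, hρξ]
      rw [h5, hδv, LinearMap.neg_apply, map_sub] at h4
      have h6 := hsub β hβ r hr _ hzE
      simp only [map_add] at h6 ⊢
      linarith

/-- A chamber lies strictly on one side of a hyperplane of direction the kernel of a root. -/
lemma chamber_side {ε : ℤˣ} {w : V ≃ₗ[ℝ] V} (hw : w ∈ 𝔸.vWeyl) {α : Module.Dual ℝ V}
    (hα : α ∈ 𝔸.roots) (r : ℝ) :
    {z | 0 < α z + r} ∈ localFacet y (face (𝔸.chamberRoot ε w) ∅) ∨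
      {z | 0 < (-α) z + -r} ∈ localFacet y (face (𝔸.chamberRoot ε w) ∅) := by
  have hC : 𝔸.IsVFacet (face (𝔸.chamberRoot ε w) ∅) := ⟨ε, ∅, isFacetOfType_face ε hw ∅⟩
  have key : ∀ {α : Module.Dual ℝ V} {r : ℝ}, α ∈ 𝔸.roots → 0 ≤ α y + r →
      IsPosComb (𝔸.chamberRoot ε w) α →
      {z | 0 < α z + r} ∈ localFacet y (face (𝔸.chamberRoot ε w) ∅) := by
    intro α r hα h hp
    rw [mem_localFacet_iff]
    filter_upwards [self_mem_nhdsWithin] with η hη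
    have := pos_of_mem_chamber hα hp hη
    change 0 < α (y + η) + r
    rw [map_add]
    linarith
  have key' : ∀ {α : Module.Dual ℝ V} {r : ℝ}, 0 < α y + r →
      {z | 0 < α z + r} ∈ localFacet y (face (𝔸.chamberRoot ε w) ∅) := by
    intro α r h
    have hc : Continuous fun z => α z + r :=
      α.continuous_of_finiteDimensional.add continuous_const
    exact mem_nhdsWithin_of_mem_nhds (hc.continuousAt.eventually_const_lt h)
  rcases lt_trichotomy (α y + r) 0 with h | h | h
  · exact Or.inr (key' (by rw [LinearMap.neg_apply]; linarith))
  · rcases isPosComb_or_neg hα ε hw with hp | hp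
    · exact Or.inl (key hα h.ge hp)
    · exact Or.inr (key (neg_mem_roots hα) (by rw [LinearMap.neg_apply]; linarith) hp)
  · exact Or.inl (key' h)

/-- A panel with a special vertex is dominated by two chambers only. -/
lemma IsSpecial.eq_or_eq_of_le_closure (hx : 𝔸.IsSpecial x) {ε : ℤˣ} {w : V ≃ₗ[ℝ] V}
    (hw : w ∈ 𝔸.vWeyl) {i : ι} (hG : 𝔸.IsVChamber G)
    (hle : 𝔸.facet x (face (𝔸.chamberRoot ε w) {i}) ≤ (𝔸.facet y G).lift' closure) :
    𝔸.facet x (face (𝔸.chamberRoot ε w) ∅) = 𝔸.facet y G ∨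
      𝔸.facet x (face (𝔸.chamberRoot ε (w * 𝔸.refl i)) ∅) = 𝔸.facet y G := by
  obtain ⟨ε', hG⟩ := hG
  have hG' : 𝔸.IsVFacet G := ⟨ε', ∅, hG⟩
  obtain ⟨w', hw', rfl⟩ := isFacetOfType_iff.1 hG
  have hb := chamberRoot_mem_realRoots (D := 𝔸.toVectorialDatum) ε hw i
  have hwall := hx.neg_apply_mem_wallParams hb
  have hwr := mul_mem hw (𝔸.refl_mem i)
  -- On whichever side of the wall through `x` the given chamber lies, it contains the chamber at
  -- `x` on that side, and minimality turns this containment into equality.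
  rcases chamber_side (y := y) (ε := ε') hw' (Or.inl hb) (-𝔸.chamberRoot ε w i x) with h | h
  · left
    exact hx.facet_eq_of_le hw hG'
      (facet_le_of_le_closure hw hG' (openHalfSpace_mem_facet (Or.inl hb) hwall h) hle)
  · right
    have he : 𝔸.chamberRoot ε (w * 𝔸.refl i) i = -𝔸.chamberRoot ε w i := by
      ext v
      simp [chamberRoot, act_mul, act_refl_root, act_neg]
    refine hx.facet_eq_of_le hwr hG' (facet_le_of_le_closure (i := i) hwr hG' ?_ ?_)
    · rw [he]
      exact openHalfSpace_mem_facet (neg_mem_roots (Or.inl hb)) (neg_mem_wallParams hwall) h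
    · have hr : 𝔸.refl i ∈ 𝔸.parabolic {i} := Subgroup.subset_closure ⟨i, rfl, rfl⟩
      rw [face_chamberRoot_mul hr]
      exact hle

end ModelApartment

/-! ## Thickness of the building at infinity -/

lemma Filter.map_lift'_closure_le {α β : Type*} [TopologicalSpace α] [TopologicalSpace β]
    {w : α → β} (hw : Continuous w) (C : Filter α) :
    map w (C.lift' closure) ≤ (map w C).lift' closure := by
  intro S hS
  obtain ⟨T, hT, hTS⟩ := (mem_lift'_sets (monotone_closure β)).1 hS
  rw [mem_map]
  refine (mem_lift'_sets (monotone_closure α)).2 ⟨w ⁻¹' T, hT, ?_⟩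
  exact (hw.closure_preimage_subset T).trans (preimage_mono hTS)

namespace ModelApartment

open VectorialDatum SimpleRoots

variable {ι V : Type*} [Fintype ι] [NormedAddCommGroup V] [NormedSpace ℝ V]
  {𝔸 : ModelApartment ι V} {F : Set V} {x y : V}

lemma isPreorderedIntervalGerm_of_mem (hF : 𝔸.IsVFacet F) {ξ : V} (hξ : ξ ∈ F) (h0 : ξ ≠ 0)
    (y : V) : 𝔸.IsPreorderedIntervalGerm (𝓝[(fun t : ℝ => y + t • (y + ξ - y)) '' Ioc 0 1] y) := by
  refine ⟨y, y + ξ, by simpa using h0, ?_, rfl⟩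
  obtain ⟨ε, J, w, hw, rfl⟩ := hF
  obtain ⟨v, hv, rfl⟩ := hξ
  have h1 : w v ∈ 𝔸.titsCone :=
    ⟨J, _, ⟨w, hw, rfl⟩, v, hv, by simp⟩
  rcases Int.units_eq_one_or ε with rfl | rfl
  · left
    simpa using h1
  · right
    simpa using h1

/-- The germ of a segment with origin `y` in the direction of a facet is contained in the local
facet. -/
lemma intervalGerm_le_localFacet (hF : 𝔸.IsVFacet F) {ξ : V} (hξ : ξ ∈ F) (y : V) :
    𝓝[(fun t : ℝ => y + t • (y + ξ - y)) '' Ioc 0 1] y ≤ localFacet y F := by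
  refine nhdsWithin_mono _ ?_
  rintro _ ⟨t, ht, rfl⟩
  exact ⟨t • ξ, hF.smul_mem ht.1 hξ, by simp⟩

/-- Through a special point passes a wall in the direction of each real root, so every vectorial
panel based there gives a panel to which thickness applies. -/
lemma IsSpecial.isPanel_facet (hx : 𝔸.IsSpecial x) {ε : ℤˣ} {w : V ≃ₗ[ℝ] V} (hw : w ∈ 𝔸.vWeyl)
    (i : ι) : 𝔸.IsPanel (𝔸.facet x (face (𝔸.chamberRoot ε w) {i})) := by
  have hb := hx.zero_mem_wallOffsets
    (chamberRoot_mem_realRoots (D := 𝔸.toVectorialDatum) ε hw i)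
  refine ⟨x, _, ⟨ε, i, isFacetOfType_face ε hw {i}⟩, ⟨_, hb, ?_, fun v hv => ?_⟩, rfl⟩
  · simp [affWall]
  · have := hv.1 i rfl
    simp [affWall, this]

variable [FiniteDimensional ℝ V]

lemma mem_of_halfSpaceInter_mem_facet (hF : 𝔸.IsVFacet F) {k : Module.Dual ℝ V → WithTop ℝ}
    (h : 𝔸.halfSpaceInter k ∅ ∈ 𝔸.facet x F) : x ∈ 𝔸.halfSpaceInter k ∅ := by
  rw [← (isClosed_halfSpaceInter k).closure_eq]
  exact mem_closure_of_mem_localFacet hF (localFacet_le_facet h)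

/-- The enclosure of the germ of a segment in the direction of a facet contains the closure of the
facet. -/
lemma exists_isClosed_of_mem_cl_intervalGerm (hF : 𝔸.IsVFacet F) {ξ : V} (hξ : ξ ∈ F) {S : Set V}
    (hS : S ∈ 𝔸.cl (𝓝[(fun t : ℝ => y + t • (y + ξ - y)) '' Ioc 0 1] y)) :
    ∃ E, IsClosed E ∧ E ∈ 𝔸.facet y F ∧ E ⊆ S := by
  obtain ⟨k, hk, hE, hS⟩ := hS
  refine ⟨_, isClosed_halfSpaceInter k, ⟨k, ∅, hk, ?_, Subset.rfl⟩, hS⟩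
  have hc : Tendsto (fun t : ℝ => y + t • (y + ξ - y)) (𝓝[>] 0) (𝓝 y) := by
    have h1 : Continuous fun t : ℝ => y + t • (y + ξ - y) := by fun_prop
    have h2 := h1.tendsto 0
    rw [zero_smul, add_zero] at h2
    exact h2.mono_left nhdsWithin_le_nhds
  have hev : ∀ᶠ t : ℝ in 𝓝[>] 0, y + t • (y + ξ - y) ∈ 𝔸.halfSpaceInter k ∅ := by
    refine (tendsto_nhdsWithin_iff.2 ⟨hc, ?_⟩).eventually hE
    filter_upwards [Ioc_mem_nhdsGT one_pos] with t ht using ⟨t, ht, rfl⟩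
  obtain ⟨t, ht, ht0⟩ := (hev.and self_mem_nhdsWithin).exists
  rw [add_sub_cancel_left] at ht
  exact halfSpaceInter_mem_localFacet hF (hF.smul_mem ht0 hξ)
    ((isClosed_halfSpaceInter k).mem_of_tendsto hc hev) ht

/-- The germ of a sector only depends on its direction. -/
lemma sectorFaceGerm_eq_of_chamber {ε : ℤˣ} (hF : 𝔸.IsFacetOfType ε ∅ F) (x y : V) :
    sectorFaceGerm x F = sectorFaceGerm y F := by
  have hF' : 𝔸.IsVFacet F := ⟨ε, ∅, hF⟩
  obtain ⟨ζ, hζ⟩ := hF'.nonempty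
  -- A chamber is open, so any vector enters it after adding a large multiple of `ζ`; both germs
  -- then equal the germ at `x + t • ζ`.
  obtain ⟨t, ht0, ht⟩ : ∃ t : ℝ, 0 < t ∧ x - y + t • ζ ∈ F := by
    obtain ⟨w, hw, rfl⟩ := isFacetOfType_iff.1 hF
    have h : ∀ᶠ t : ℝ in atTop, ∀ i, 0 < 𝔸.chamberRoot ε w i (x - y + t • ζ) := by
      rw [eventually_all]
      intro i
      simp only [map_add, map_smul, smul_eq_mul]
      exact (tendsto_atTop_add_const_left _ _
        (tendsto_id.atTop_mul_const (hζ.2 i (notMem_empty i)))).eventually_gt_atTop 0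
    obtain ⟨t, ht, ht0⟩ := (h.and (eventually_gt_atTop 0)).exists
    exact ⟨t, ht0, fun i hi => hi.elim, fun i _ => ht i⟩
  rw [← sectorFaceGerm_add hF' (subset_closure (hF'.smul_mem ht0 hζ)) (x := x),
    ← sectorFaceGerm_add hF' (subset_closure ht) (x := y)]
  congr 1
  abel

end ModelApartment

namespace AffineHovel

open ModelApartment VectorialDatum SimpleRoots

variable {ι V : Type*} [Fintype ι] [NormedAddCommGroup V] [NormedSpace ℝ V] [FiniteDimensional ℝ V]
  {𝔸 : ModelApartment ι V} {X : Type*} {H : AffineHovel 𝔸 X}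
  {F C : Set V} {x y : V} {f g h : V → X} {ε : ℤˣ}

/-- If an apartment contains a facet, there is an isomorphism that fixes its closure. -/
lemma exists_chart_fixing_facet (hg : g ∈ H.charts) (hh : h ∈ H.charts) (hF : 𝔸.IsVFacet F)
    {ξ : V} (hξ : ξ ∈ F) (h0 : ξ ≠ 0) (hr : range h ∈ map g (𝔸.facet y F)) :
    ∃ h' ∈ H.charts, range h' = range h ∧
      ∃ E, IsClosed E ∧ E ∈ 𝔸.facet y F ∧ ∀ z ∈ E, h' z = g z := by
  have hle := (intervalGerm_le_localFacet hF hξ y).trans (localFacet_le_facet (𝔸 := 𝔸))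
  obtain ⟨-, h', hh', hr', hfix⟩ := H.ma2 g hg _
    (Or.inr (Or.inl (isPreorderedIntervalGerm_of_mem hF hξ h0 y))) h hh (map_mono hle hr)
  obtain ⟨E, hE, hEF, hsub⟩ := exists_isClosed_of_mem_cl_intervalGerm hF hξ hfix
  exact ⟨h', hh', hr', E, hE, hEF, hsub⟩

/-- A chamber of the hovel dominating a panel with a special vertex lies in an apartment that
contains the germ of the corresponding sector face. -/
lemma exists_chart_of_isChamberDominating (hf : f ∈ H.charts) (hx : 𝔸.IsSpecial x)
    {w : V ≃ₗ[ℝ] V} (hw : w ∈ 𝔸.vWeyl) {i : ι} {𝔠 : Filter X}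
    (h𝔠 : H.IsChamberDominating (map f (𝔸.facet x (face (𝔸.chamberRoot ε w) {i}))) 𝔠) :
    ∃ h ∈ H.charts, map h (𝔸.facet x (face (𝔸.chamberRoot ε w) ∅)) = 𝔠 ∧
      map h (𝔸.facet x (face (𝔸.chamberRoot ε w) {i})) =
        map f (𝔸.facet x (face (𝔸.chamberRoot ε w) {i})) ∧
      map h (sectorFaceGerm x (face (𝔸.chamberRoot ε w) {i})) =
        map f (sectorFaceGerm x (face (𝔸.chamberRoot ε w) {i})) ∧ h x = f x := by
  set F := face (𝔸.chamberRoot ε w) {i} with hFdef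
  have hFs : 𝔸.IsSphericalFacet ε F := ⟨{i}, isSpherical_singleton i, isFacetOfType_face ε hw {i}⟩
  have hF := hFs.isVFacet
  obtain ⟨g, hg, _, ⟨y, C, ⟨ε', hC⟩, rfl⟩, rfl, hle⟩ := h𝔠
  have hC' : 𝔸.IsVFacet C := ⟨ε', ∅, hC⟩
  obtain ⟨ξ, hξ⟩ := hC'.nonempty
  have hξ0 : ξ ≠ 0 := by
    rintro rfl
    obtain ⟨w', -, rfl⟩ := isFacetOfType_iff.1 hC
    simpa using hξ.2 i (notMem_empty i)
  have hR : 𝔸.IsSplayedChimneyGerm (𝔸.chimneyGerm (𝔸.facet x F) F) :=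
    ⟨_, _, ⟨_, _, hF, rfl⟩, ⟨ε, hFs⟩, rfl⟩
  -- An apartment containing the chimney germ along the panel direction together with the given
  -- chamber.
  obtain ⟨h, hh, h1, h2⟩ := H.ma3 f hf g hg _ (𝔸.facet y C) hR (Or.inl ⟨_, _, hC', rfl⟩)
  obtain ⟨h₁, hh₁, hr₁, E, hE, hEC, hfix⟩ := exists_chart_fixing_facet hg hh hC' hξ hξ0 h2
  have hEcl : E ∈ (𝔸.facet y C).lift' closure := by
    have := mem_lift' (h := closure) hEC
    rwa [hE.closure_eq] at this
  -- The chart `h₁` agrees with `g` on a closed element of the chamber, hence on an element of its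
  -- closure, so its apartment contains the panel. (MA4) can then fix the panel and the chimney germ
  -- together.
  have hP : range h₁ ∈ map f (𝔸.facet x F) :=
    hle (mem_map.2 (mem_of_superset hEcl fun z hz => ⟨z, hfix z hz⟩))
  obtain ⟨-, h₂, hh₂, hr₂, k, hk, hEk, hfix₂⟩ := H.ma4 f hf _ (𝔸.facet x F) hR
    (Or.inl ⟨_, _, hF, rfl⟩) h₁ hh₁ (by rw [hr₁]; exact h1) hP
  have e1 : map h₂ (𝔸.facet x F) = map f (𝔸.facet x F) :=
    map_congr (mem_of_superset hEk.2 hfix₂)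
  have e2 : map h₂ (sectorFaceGerm x F) = map f (sectorFaceGerm x F) :=
    map_congr (mem_of_superset (sectorFaceGerm_le_chimneyGerm hF hF hEk.1) hfix₂)
  have e3 : h₂ x = f x := hfix₂ (mem_of_halfSpaceInter_mem_facet hF hEk.2)
  obtain ⟨w₀, hw₀, e4⟩ := exists_weyl_of_range_eq hh₂ hh₁ hr₂.symm
  obtain ⟨u, hu, huw⟩ := exists_linear_of_mem_weyl hw₀
  have e5 : map h₂ (map w₀ (𝔸.facet y C)) = map g (𝔸.facet y C) := by
    rw [map_map, ← e4]
    exact map_congr (mem_of_superset hEC hfix)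
  have hle₂ : 𝔸.facet x F ≤ (𝔸.facet (w₀ y) (u '' C)).lift' closure := by
    rw [← map_facet hw₀ hu huw]
    refine le_trans ?_ (map_lift'_closure_le (continuous_of_linear_part huw) _)
    rw [← map_le_map_iff (H.charts_injective h₂ hh₂), e1, map_map, ← e4]
    exact hle.trans (map_congr (mem_of_superset hEcl hfix)).ge
  rw [map_facet hw₀ hu huw] at e5
  -- Seen through `h₂`, the given chamber is one of the two chambers at `x` dominating the panel. If
  -- it is the wrong one, `h₂` is composed with the reflection that fixes `x` and the panel and
  -- exchanges them.
  rcases hx.eq_or_eq_of_le_closure hw ⟨ε', hC.image hu⟩ hle₂ with e6 | e6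
  · exact ⟨h₂, hh₂, by rw [e6, e5], e1, e2, e3⟩
  · have hρ : w * 𝔸.refl i * w⁻¹ ∈ 𝔸.vWeyl := mul_mem (mul_mem hw (𝔸.refl_mem i)) (inv_mem hw)
    obtain ⟨s, hs, hsx, hsl⟩ := hx.exists_weyl hρ
    have himage : ∀ J, ⇑(w * 𝔸.refl i * w⁻¹) '' face (𝔸.chamberRoot ε w) J =
        face (𝔸.chamberRoot ε (w * 𝔸.refl i)) J := fun J => by
      rw [image_face_chamberRoot, inv_mul_cancel_right]
    have hr : 𝔸.refl i ∈ 𝔸.parabolic {i} := Subgroup.subset_closure ⟨i, rfl, rfl⟩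
    have hρF : ⇑(w * 𝔸.refl i * w⁻¹) '' F = F := by
      rw [hFdef, himage, face_chamberRoot_mul hr]
    refine ⟨h₂ ∘ s, ((H.charts_orbit h₂ hh₂ _).2 ⟨s, hs, rfl⟩).1, ?_, ?_, ?_, ?_⟩
    · rw [← map_map, map_facet hs hρ hsl, hsx, himage, e6, e5]
    · rw [← map_map, map_facet hs hρ hsl, hsx, hρF, e1]
    · rw [← map_map, map_sectorFaceGerm hF hρ hsl, hsx, hρF, e2]
    · rw [Function.comp_apply, hsx, e3]

/-- If two apartments have a facet at `x` in common, a common chamber at infinity yields a common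
chamber at `x`. -/
lemma map_facet_eq_of_atInfinity_eq {hg : g ∈ H.charts} {hh : h ∈ H.charts} (hF : 𝔸.IsVFacet F)
    (hC : 𝔸.IsFacetOfType ε ∅ C) {hCs : 𝔸.IsSphericalFacet ε C}
    (hP : map g (𝔸.facet x F) = map h (𝔸.facet x F)) (hx : g x = h x)
    (heq : atInfinity hg hCs = atInfinity hh hCs) :
    map g (𝔸.facet x C) = map h (𝔸.facet x C) := by
  have hC' := hCs.isVFacet
  rw [← toInfinity_faceGerm hg x hCs, ← toInfinity_faceGerm hh x hCs, toInfinity_eq_iff] at heq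
  obtain ⟨k, hk, a, b, K, hK, h1, h2⟩ := heq
  change map g (sectorFaceGerm x C) = _ at h1
  change map h (sectorFaceGerm x C) = _ at h2
  have hKc : 𝔸.IsFacetOfType ε ∅ K := by
    obtain ⟨u, hu, e, -⟩ := directions_unique hk hg hK hK hCs hCs h1.symm h1.symm
    rw [e]
    exact hC.image hu
  -- Parallel sectors in one apartment have equal germs, so `g` and `h` send the germ of `x + C` to
  -- the same germ.
  rw [sectorFaceGerm_eq_of_chamber hKc b a, ← h1] at h2
  obtain ⟨ξ, hξ, h3, -⟩ := exists_chart_fixing_sector hg hh hCs (x := x) (h2 ▸ range_mem_map)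
  obtain ⟨-, h', hh', hr, κ, hκ, hE, hfix⟩ := H.ma4 g hg
    (𝔸.chimneyGerm (𝔸.facet (x + ξ) C) C) (𝔸.facet x F)
    ⟨_, _, ⟨_, _, hC', rfl⟩, ⟨ε, hCs⟩, rfl⟩ (Or.inl ⟨_, _, hF, rfl⟩) h hh
    (map_mono (chimneyGerm_le_cl hC') h3) (hP ▸ range_mem_map)
  have hxE := mem_of_halfSpaceInter_mem_facet hF hE.2
  obtain ⟨ξ', hξ', h4⟩ := (mem_sectorFaceGerm hC').1 (sectorFaceGerm_le_chimneyGerm hC' hC' hE.1)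
  -- The enclosed set fixed by `h'` contains `x` and a subsector, hence the whole sector `x + C`; so
  -- `h'` and `g` agree on the facet of `C` at `x`.
  have h5 : ∀ v ∈ C, x + v ∈ 𝔸.halfSpaceInter κ ∅ := fun v hv =>
    add_mem_halfSpaceInter hC' h4 hxE (subset_closure hv)
  obtain ⟨v, hv⟩ := hC'.nonempty
  have e1 : map h' (𝔸.facet x C) = map g (𝔸.facet x C) :=
    map_congr ⟨κ, ∅, hκ, halfSpaceInter_mem_localFacet hC' hv hxE (h5 v hv), hfix⟩
  have e2 : map h' (sectorFaceGerm x C) = map h (sectorFaceGerm x C) := by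
    rw [h2]
    refine map_congr ((mem_sectorFaceGerm hC').2 ⟨0, hC'.zero_mem, fun v hv => ?_⟩)
    rw [add_zero]
    exact hfix (h5 v hv)
  have e3 : h' x = h x := (hfix hxE).trans hx
  obtain ⟨w, hw, rfl⟩ := exists_weyl_of_range_eq hh hh' hr
  obtain ⟨u, hu, huw⟩ := exists_linear_of_mem_weyl hw
  -- With `h' = h ∘ w`, the map `w` fixes `x` and preserves the direction `C`, so `h'` and `h` agree
  -- on this facet as a filter.
  have e4 : w x = x := H.charts_injective h hh e3
  have hinj := map_injective (H.charts_injective h hh)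
  rw [← map_map, map_sectorFaceGerm hC' hu huw] at e2
  have e5 := direction_unique (hCs.image hu) hCs (hinj e2)
  rw [← e1, ← map_map, map_facet hw hu huw, e4, e5]

lemma isBuildingChamber_atInfinity {hf : f ∈ H.charts} {hCs : 𝔸.IsSphericalFacet ε C}
    (hC : 𝔸.IsFacetOfType ε ∅ C) : IsBuildingChamber (H.leInfinity ε) (atInfinity hf hCs) := by
  intro d hd
  obtain ⟨g, hg, F, hF, G, hG, e1, rfl⟩ := exists_common_chart (atInfinity hf hCs) d
  rw [e1] at hd ⊢
  rw [leInfinity_atInfinity_iff] at hd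
  obtain ⟨J, hJ, hFJ⟩ := id hF
  obtain ⟨J', hJ', hGJ⟩ := id hG
  have hJ0 : J = ∅ := by
    rw [← typeAtInfinity_eq (hf := hg) (hF := hF) hFJ, ← e1]
    exact typeAtInfinity_eq hC
  subst hJ0
  rw [atInfinity_eq_iff]
  obtain ⟨u, hu, rfl⟩ := isFacetOfType_iff.1 hFJ
  obtain ⟨u', hu', rfl⟩ := isFacetOfType_iff.1 hGJ
  rw [closure_face_chamberRoot, face_subset_closedFace_iff hu hu'] at hd
  exact ((face_eq_iff hu hu').2 ⟨hd.1, subset_empty_iff.1 hd.2⟩).symm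

/-- The panels at infinity are the facets at infinity with a panel as direction. -/
lemma IsBuildingPanel.exists_eq_atInfinity {p : H.Infinity ε}
    (hp : IsBuildingPanel (H.leInfinity ε) p) :
    ∃ f, ∃ hf : f ∈ H.charts, ∃ w ∈ 𝔸.vWeyl, ∃ i,
      ∃ hF : 𝔸.IsSphericalFacet ε (face (𝔸.chamberRoot ε w) {i}), p = atInfinity hf hF := by
  obtain ⟨f, hf, F, hF, rfl⟩ := AffineHovel.exists_eq_atInfinity p
  obtain ⟨J, hJ, hFJ⟩ := id hF
  have hne : J.Nonempty := by
    rw [nonempty_iff_ne_empty]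
    rintro rfl
    exact hp.1 (isBuildingChamber_atInfinity hFJ)
  obtain ⟨i, hi⟩ := hne
  obtain ⟨w, hw, rfl⟩ := isFacetOfType_iff.1 hFJ
  have hG : 𝔸.IsSphericalFacet ε (face (𝔸.chamberRoot ε w) {i}) :=
    ⟨{i}, isSpherical_singleton i, isFacetOfType_face ε hw {i}⟩
  have hC : 𝔸.IsSphericalFacet ε (face (𝔸.chamberRoot ε w) ∅) :=
    ⟨∅, isSpherical_empty, isFacetOfType_face ε hw ∅⟩
  -- The face of type `{i}` of the same chamber dominates `p` and is not maximal, so it is `p` by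
  -- the definition of panels.
  refine ⟨f, hf, w, hw, i, hG, (hp.2 _ ?_ fun hch => ?_).symm⟩
  · rw [leInfinity_atInfinity_iff, closure_face_chamberRoot, face_subset_closedFace_iff hw hw]
    exact ⟨by simp [one_mem], singleton_subset_iff.2 hi⟩
  · have h1 : H.leInfinity ε (atInfinity hf hG) (atInfinity hf hC) := by
      rw [leInfinity_atInfinity_iff, closure_face_chamberRoot, face_subset_closedFace_iff hw hw]
      exact ⟨by simp [one_mem], empty_subset _⟩
    have h2 := atInfinity_eq_iff.1 (hch _ h1)
    exact singleton_ne_empty i ((face_eq_iff hw hw).1 h2).2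

variable (ε) in
/-- The building at infinity of a thick hovel is thick. -/
lemma IsThick.isThickBuilding_infinity (hH : H.IsThick) : IsThickBuilding (H.leInfinity ε) := by
  intro p hp
  obtain ⟨f, hf, w, hw, i, hF, rfl⟩ := IsBuildingPanel.exists_eq_atInfinity hp
  obtain ⟨x, hx⟩ := 𝔸.exists_isSpecial
  -- Thickness is applied at a special vertex in the direction of `p`. Each chamber found there
  -- opens onto a sector of one and the same vectorial direction, read in its own chart.
  obtain ⟨𝔠, hinj, hdom⟩ := hH f hf _ (hx.isPanel_facet hw i)
  choose h hh h1 h2 h3 h4 using fun j =>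
    exists_chart_of_isChamberDominating (ε := ε) hf hx hw (hdom j)
  have hC := isFacetOfType_face (D := 𝔸.toVectorialDatum) ε hw ∅
  have hCs : 𝔸.IsSphericalFacet ε (face (𝔸.chamberRoot ε w) ∅) := ⟨∅, isSpherical_empty, hC⟩
  refine ⟨fun j => atInfinity (hh j) hCs, fun j l hjl => hinj ?_, fun j =>
    ⟨isBuildingChamber_atInfinity hC, ?_⟩⟩
  · rw [← h1 j, ← h1 l]
    exact map_facet_eq_of_atInfinity_eq hF.isVFacet hC ((h2 j).trans (h2 l).symm)
      ((h4 j).trans (h4 l).symm) hjl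
  · have e : atInfinity hf hF = atInfinity (hh j) hF := by
      rw [← toInfinity_faceGerm hf x hF, ← toInfinity_faceGerm (hh j) x hF]
      exact congrArg _ (Subtype.ext (h3 j).symm)
    rw [e, leInfinity_atInfinity_iff, closure_face_chamberRoot, face_subset_closedFace_iff hw hw]
    exact ⟨by simp [one_mem], empty_subset _⟩

end AffineHovel

end

theorem mainTheorem2 {ι V X : Type*} [Fintype ι] [NormedAddCommGroup V] [NormedSpace ℝ V]
    [FiniteDimensional ℝ V] [Nonempty X] (𝔸 : ModelApartment ι V) (H : AffineHovel 𝔸 X) (ε : ℤˣ) :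
    Equivalence (H.Parallel ε) ∧
    (∀ 𝔉 𝔊 : H.FaceGerm ε,
      H.leInfinity ε (H.toInfinity ε 𝔊) (H.toInfinity ε 𝔉) ↔ H.Dominates ε 𝔉 𝔊) ∧
    IsCombinatorialBuilding 𝔸.cs (H.leInfinity ε) (H.apartmentsAtInfinity ε) ∧
    (H.IsThick → IsThickBuilding (H.leInfinity ε)) := by
  exact ⟨H.parallel_equivalence ε, fun _ _ => AffineHovel.leInfinity_toInfinity_iff,
    ⟨_, H.isTypedBuilding_infinity ε⟩, fun h => h.isThickBuilding_infinity ε⟩
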